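/- **Setting.** Let $dA(z)=d^2z/\pi$ on $\mathbb C$ and $\Delta=\partial\bar\partial$ (one quarter of the usual Laplacian). Let $Q(z)=q(|z|)$ be a real-valued radially symmetric potential on $\mathbb{C}$ that is smooth and subharmonic on $\mathbb C\setminus\{0\}$ (equivalently, $q$ is smooth and $rq'(r)$ is increasing on $(0,\infty)$; nothing is required at the origin) and satisfies $$\liminf_{|z|\to\infty}\frac{Q(z)}{2\log|z|}>1 .$$ Let $r_0$ be the largest solution of $rq'(r)=0$ and $r_1$ the smallest solution of $rq'(r)=2$. Assume that $r_0>0$, so that the droplet is the annulus $\mathbb A_{r_0,r_1}=\{z\in\mathbb C: r_0\le|z|\le r_1\}$, and that $\Delta Q>0$ in a neighbourhood of $\mathbb A_{r_0,r_1}$. Put $$Z_N=\int_{\mathbb C^N}\prod_{j>k}|z_j-z_k|^2\prod_{j=1}^N e^{-NQ(z_j)}\,dA(z_j),$$ $$\widetilde Z_N=\int_{\mathbb C^N}\prod_{j>k}|z_j-z_k|^2|z_j-\bar z_k|^2\prod_{j=1}^N|z_j-\bar z_j|^2e^{-2NQ(z_j)}\,dA(z_j).$$ Let $\mu_Q$ be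 the equilibrium measure, i.e. the minimizer, among the Borel probability measures $\mu$ on $\mathbb C$, of $$I_Q[\mu]=\iint\log\frac1{|z-w|}\,d\mu(z)\,d\mu(w)+\int Q\,d\mu ,$$ and let $$E_Q[\mu]=\int\log(\Delta Q)\,d\mu,\qquad U_\mu(z)=\int\log\frac1{|z-w|}\,d\mu(w).$$ Write $\Delta Q(r)$ for the value of $\Delta Q$ at the points with $|z|=r$, and set $$F_Q[\mathbb A_{r_0,r_1}]=\frac1{12}\log\Big(\frac{r_0^2\Delta Q(r_0)}{r_1^2\Delta Q(r_1)}\Big)-\frac1{16}\Big(r_1\frac{(\partial_r\Delta Q)(r_1)}{\Delta Q(r_1)}-r_0\frac{(\partial_r\Delta Q)(r_0)}{\Delta Q(r_0)}\Big)+\frac1{24}\int_{r_0}^{r_1}\Big(\frac{\partial_r\Delta Q(r)}{\Delta Q(r)}\Big)^2r\,dr .$$ **Theorem.** As $N\to\infty$ the following holds. (i) (Random normal matrix ensemble) $$\log Z_N=-N^2I_Q[\mu_Q]+\tfrac12N\log N+\Big(\frac{\log(2\pi)}2-1-\frac12E_Q[\mu_Q]\Big)N+\frac12\log N+\frac{\log(2\pi)}2+F_Q[\mathbb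 A_{r_0,r_1}]+O(N^{-1}).$$ (ii) (Planar symplectic ensemble) $$\log\widetilde Z_N=-2N^2I_Q[\mu_Q]+\tfrac12N\log N+\Big(\frac{\log(4\pi)}2-1-U_{\mu_Q}(0)-\frac12E_Q[\mu_Q]\Big)N+\frac12\log N+\frac{\log(2\pi)}2+\frac12F_Q[\mathbb A_{r_0,r_1}]+\frac18\log\Big(\frac{\Delta Q(r_0)}{\Delta Q(r_1)}\Big)+O(N^{-1}).$$ -/

import Mathlib

open MeasureTheory Filter Topology Asymptotics
open scoped ContDiff

noncomputable section

namespace CoulombGas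

/-- The area measure `dA(z) = d²z / π` on the complex plane. -/
def areaMeasure : Measure ℂ := ENNReal.ofReal (Real.pi⁻¹) • (volume : Measure ℂ)

/-- `Δ = ∂ ∂̄`, one quarter of the usual Laplacian. -/
def quarterLaplacian (Q : ℂ → ℝ) (z : ℂ) : ℝ := (1 / 4) * Laplacian.laplacian Q z

/-- The partition function of the random normal matrix ensemble (`β = 2`):
`∫ ∏_{j > k} |z_j - z_k|² ∏_j exp (-N Q(z_j)) dA(z_j)` over `ℂ^N`. -/
def partitionNormal (Q : ℂ → ℝ) (N : ℕ) : ℝ :=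
  ∫ z : Fin N → ℂ,
    (∏ j, ∏ k ∈ Finset.Iio j, ‖z j - z k‖ ^ 2) * ∏ j, Real.exp (-((N : ℝ) * Q (z j)))
    ∂(Measure.pi fun _ : Fin N => areaMeasure)

/-- The partition function of the planar symplectic ensemble (`β = 2`):
`∫ ∏_{j > k} |z_j - z_k|² |z_j - conj z_k|² ∏_j |z_j - conj z_j|² exp (-2 N Q(z_j)) dA(z_j)`
over `ℂ^N`. -/
def partitionSymplectic (Q : ℂ → ℝ) (N : ℕ) : ℝ :=
  ∫ z : Fin N → ℂ,
    (∏ j, ∏ k ∈ Finset.Iio j,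
        ‖z j - z k‖ ^ 2 * ‖z j - (starRingEnd ℂ) (z k)‖ ^ 2) *
      ∏ j, ‖z j - (starRingEnd ℂ) (z j)‖ ^ 2 * Real.exp (-(2 * (N : ℝ) * Q (z j)))
    ∂(Measure.pi fun _ : Fin N => areaMeasure)

/-- The weighted logarithmic energy `I_Q[μ] = ∬ log (1 / |z - w|) dμ(z) dμ(w) + ∫ Q dμ`. -/
def weightedEnergy (Q : ℂ → ℝ) (μ : Measure ℂ) : ℝ :=
  (∫ p : ℂ × ℂ, Real.log (1 / ‖p.1 - p.2‖) ∂(μ.prod μ)) + ∫ z, Q z ∂μ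

/-- `μ` has finite weighted logarithmic energy. Point masses are excluded explicitly, because
their energy is `+∞` while `Real.log 0 = 0`; a measure without point masses does not charge
the diagonal, on which the logarithmic kernel is infinite. -/
structure HasFiniteEnergy (Q : ℂ → ℝ) (μ : Measure ℂ) : Prop where
  noAtoms : ∀ z : ℂ, μ {z} = 0
  integrable_log : Integrable (fun p : ℂ × ℂ => Real.log (1 / ‖p.1 - p.2‖)) (μ.prod μ)
  integrable_potential : Integrable Q μ

/-- `μ` is a probability measure that minimizes the weighted logarithmic energy among all
probability measures (those that do not have finite energy have energy `+∞`). -/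
structure IsEquilibriumMeasure (Q : ℂ → ℝ) (μ : Measure ℂ) : Prop where
  isProbabilityMeasure : IsProbabilityMeasure μ
  hasFiniteEnergy : HasFiniteEnergy Q μ
  energy_le : ∀ ν : Measure ℂ, IsProbabilityMeasure ν → HasFiniteEnergy Q ν →
    weightedEnergy Q μ ≤ weightedEnergy Q ν

/-- Frostman's equilibrium measure `μ_Q`: the minimizer of the weighted logarithmic energy. -/
def equilibriumMeasure (Q : ℂ → ℝ) : Measure ℂ :=
  Classical.epsilon fun μ => IsEquilibriumMeasure Q μ

/-- The entropy `E_Q[μ] = ∫ log (ΔQ) dμ`. -/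
def entropy (Q : ℂ → ℝ) (μ : Measure ℂ) : ℝ :=
  ∫ z, Real.log (quarterLaplacian Q z) ∂μ

/-- The logarithmic potential `U_μ(z) = ∫ log (1 / |z - w|) dμ(w)`. -/
def logPotential (μ : Measure ℂ) (z : ℂ) : ℝ :=
  ∫ w, Real.log (1 / ‖z - w‖) ∂μ

/-- The closed annulus `{z : r₀ ≤ |z| ≤ r₁}`. -/
def annulus (r₀ r₁ : ℝ) : Set ℂ := {z : ℂ | r₀ ≤ ‖z‖ ∧ ‖z‖ ≤ r₁}

/-- `ΔQ` as a function of the radius (its restriction to the real axis). -/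
def radialLaplacian (Q : ℂ → ℝ) (r : ℝ) : ℝ := quarterLaplacian Q (r : ℂ)

/-- The functional `F_Q` of the annulus `{z : r₀ ≤ |z| ≤ r₁}`. -/
def annulusFunctional (Q : ℂ → ℝ) (r₀ r₁ : ℝ) : ℝ :=
  (1 / 12) * Real.log
      ((r₀ ^ 2 * radialLaplacian Q r₀) / (r₁ ^ 2 * radialLaplacian Q r₁))
    - (1 / 16) *
      (r₁ * (deriv (radialLaplacian Q) r₁ / radialLaplacian Q r₁)
        - r₀ * (deriv (radialLaplacian Q) r₀ / radialLaplacian Q r₀))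
    + (1 / 24) *
      ∫ r in r₀..r₁, (deriv (radialLaplacian Q) r / radialLaplacian Q r) ^ 2 * r

/-- The standing assumptions on a radially symmetric potential `Q(z) = q(|z|)` whose droplet is
the annulus `{z : r₀ ≤ |z| ≤ r₁}` with `r₀ > 0`. A radially symmetric potential that is smooth
at the origin and subharmonic in the whole plane is constant on `{z : |z| ≤ r₀}`, hence not
strictly subharmonic near `|z| = r₀`; therefore, as for `Q(z) = |z|^(2 a) - 2 c log |z|`,
nothing is required at the origin. -/
structure IsAnnularPotential (Q : ℂ → ℝ) (q : ℝ → ℝ) (r₀ r₁ : ℝ) : Prop where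
  /-- radial symmetry -/
  radial : ∀ z : ℂ, Q z = q ‖z‖
  /-- smoothness away from the origin -/
  smooth : ContDiffOn ℝ ∞ Q {0}ᶜ
  /-- `liminf_{|z| → ∞} Q(z) / (2 log |z|) > 1` -/
  growth : 1 < liminf (fun z : ℂ => ((Q z / (2 * Real.log ‖z‖) : ℝ) : EReal))
    (Bornology.cobounded ℂ)
  /-- subharmonicity away from the origin, i.e. `r q'(r)` is increasing on `(0, ∞)` -/
  subharmonic : ∀ z : ℂ, z ≠ 0 → 0 ≤ quarterLaplacian Q z
  /-- `r₀` is the largest solution of `r q'(r) = 0` -/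
  inner_radius : IsGreatest {r : ℝ | 0 ≤ r ∧ r * deriv q r = 0} r₀
  /-- `r₁` is the smallest solution of `r q'(r) = 2` -/
  outer_radius : IsLeast {r : ℝ | 0 ≤ r ∧ r * deriv q r = 2} r₁
  /-- strict subharmonicity in a neighbourhood of the droplet -/
  strictly_subharmonic : ∀ᶠ z in 𝓝ˢ (annulus r₀ r₁), 0 < quarterLaplacian Q z
  /-- the droplet is an annulus -/
  inner_radius_pos : 0 < r₀

end CoulombGas

end

namespace CoulombGas

/-! ### Taylor estimates -/

/-! Radial symmetry makes the monomials orthogonal. Expanding the Vandermonde determinants and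
integrating one variable at a time therefore gives exact products: `Z_N = N! ∏ h_k`
(`partitionNormal_eq`), and in the symplectic case `N! ∏ 2 h_{2k+1}` with the weight `exp (-2NQ)`
(`partitionSymplectic_eq`). There the expansion pairs the exponents, and only permutations matching
neighbouring integers survive. With `u = log |z|` and `p u = q (exp u)`, both families of norms are
values of `radialMoment p M s = 2 ∫ exp (-M (p u - 2 s u)) du` at the nodes `s = (k+1)/N`, `k < N`,
with `M = N` and `M = 2N` respectively.

Subharmonicity means that `p` is convex, and strict subharmonicity near the droplet that `p''` is
bounded below near `[u₀, u₁] = [log r₀, log r₁]`. Hence each integral has a nondegenerate saddle `ψ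
s`, where `p' = 2s`, with `ψ` running from `u₀` to `u₁`. Laplace's method is uniform in `s`
(`exists_log_radialMoment`): `log h = log 2 + M L(s) + (1/2) log (2π/M) - (1/2) log p''(ψ) + B(ψ)/M
+ O(M⁻²)`, where `L` is the Legendre transform and `B` is `laplaceCoeff`. No saddle degenerates
because `r₀ > 0`. The sum over the nodes is evaluated by Euler–Maclaurin for `L`, the trapezoidal
rule for `log p''` and a Riemann sum for `B` (`sum_log_radialMoment_isBigO`). Stirling's formula
handles `N!`.

It remains to recognise the coefficients. The substitution `u = ψ s` and an integration by parts
turn `∫ B(ψ)` into the functional of the annulus, since `p'' = 4 r² ΔQ` (`laplace_constant_eq`). The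
other integrals come from the equilibrium measure: its energy is `-∫ L`, its potential at `0` is `-∫
ψ` and its entropy is `∫ log ΔQ(exp ψ)`, because under it `log |z|` is distributed as `ψ` under the
uniform law on `[0, 1]`.

That law is found without potential theory. Write `log |z-w|` as `max (log |z|) (log |w|) + log |1 -
x|`, with `x` in the unit disc. The powers of `x` are positive definite kernels, so the last term
has nonpositive mean, and the energy is at least its radial part (`integral_log_max_norm_ge`). The
radial part is an integral over `t` of a quadratic polynomial in the distribution function `F t` of
`log |z|`, minimized pointwise by `p'/2` truncated to `[0, 1]`. The excess energy dominates the
squared `L²` distance to this minimizer (`weightedEnergy_sub_ge`), which gives both minimality and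
uniqueness of the radial law. -/

theorem abs_le_of_abs_deriv_le {f f' : ℝ → ℝ} {s : Set ℝ} (hs : Convex ℝ s) {a K : ℝ} (ha : a ∈ s)
    {n : ℕ} (h0 : f a = 0) (hf : ∀ x ∈ s, HasDerivAt f (f' x) x)
    (hb : ∀ x ∈ s, |f' x| ≤ K * |x - a| ^ n) :
    ∀ x ∈ s, |f x| ≤ K * |x - a| ^ (n + 1) := by
  intro x hx
  have hsub : Set.uIcc a x ⊆ s := by
    rw [← segment_eq_uIcc]; exact hs.segment_subset ha hx
  rcases eq_or_ne x a with rfl | hne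
  · simp [h0]
  have hpos : 0 < |x - a| := abs_pos.2 (sub_ne_zero.2 hne)
  have hK : 0 ≤ K := by
    have := (abs_nonneg _).trans (hb x hx)
    by_contra! hK
    have := mul_neg_of_neg_of_pos hK (pow_pos hpos n)
    linarith
  have key := (convex_uIcc a x).norm_image_sub_le_of_norm_hasDerivWithin_le
    (f := f) (f' := f') (C := K * |x - a| ^ n)
    (fun y hy => (hf y (hsub hy)).hasDerivWithinAt)
    (fun y hy => by
      refine (hb y (hsub hy)).trans ?_
      have : |y - a| ≤ |x - a| := Set.abs_sub_left_of_mem_uIcc hy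
      gcongr)
    Set.left_mem_uIcc Set.right_mem_uIcc
  rw [h0, sub_zero, Real.norm_eq_abs, Real.norm_eq_abs] at key
  calc |f x| ≤ _ := key
    _ = _ := by ring

/-- Induction along the chain of derivatives `g k`: the remainder for the shifted chain bounds the
derivative of the remainder. The mean value inequality replaces integration, so the factor `1 / n!`
is lost, which is harmless here. -/
theorem abs_sub_taylor_le {s : Set ℝ} (hs : Convex ℝ s) {a K : ℝ} (ha : a ∈ s) (n : ℕ) :
    ∀ g : ℕ → ℝ → ℝ, (∀ k < n, ∀ x ∈ s, HasDerivAt (g k) (g (k + 1) x) x) →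
      (∀ x ∈ s, |g n x| ≤ K) →
      ∀ x ∈ s, |g 0 x - ∑ i ∈ Finset.range n, g i a * ((x - a) ^ i / (i.factorial : ℝ))|
        ≤ K * |x - a| ^ n := by
  induction n with
  | zero => intro g _ hb x hx; simpa using hb x hx
  | succ n ih =>
    intro g hg hb
    refine abs_le_of_abs_deriv_le hs ha
      (f' := fun x => g 1 x - ∑ i ∈ Finset.range n, g (i + 1) a * ((x - a) ^ i / (i.factorial : ℝ)))
      ?_ ?_ ?_
    · rw [Finset.sum_range_succ']; simp
    · intro x hx
      refine (hg 0 (by omega) x hx).sub ?_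
      simp only [Finset.sum_range_succ' _ n]
      have : ∀ i ∈ Finset.range n, HasDerivAt
          (fun y : ℝ => g (i + 1) a * ((y - a) ^ (i + 1) / ((i + 1).factorial : ℝ)))
          (g (i + 1) a * ((x - a) ^ i / (i.factorial : ℝ))) x := by
        intro i _
        have h1 : HasDerivAt (fun y : ℝ => (y - a) ^ (i + 1)) ((i + 1 : ℕ) * (x - a) ^ i) x := by
          simpa using ((hasDerivAt_id x).sub_const a).fun_pow (i + 1)
        have h2 := (h1.div_const ((i + 1).factorial : ℝ)).const_mul (g (i + 1) a)
        refine h2.congr_deriv ?_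
        rw [Nat.factorial_succ]
        push_cast
        field_simp
      simpa using (HasDerivAt.fun_sum this).add_const (g 0 a * ((0:ℝ)+1))
    · exact ih (fun k => g (k + 1)) (fun k hk => hg (k + 1) (by omega)) hb

theorem nonneg_of_second_deriv_nonneg {f f' f'' : ℝ → ℝ} {s : Set ℝ} (hs : Convex ℝ s) {a : ℝ}
    (ha : a ∈ s) (h0 : f a = 0) (h0' : f' a = 0) (hf : ∀ x ∈ s, HasDerivAt f (f' x) x)
    (hf' : ∀ x ∈ s, HasDerivAt f' (f'' x) x) (hf'' : ∀ x ∈ s, 0 ≤ f'' x) :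
    ∀ x ∈ s, 0 ≤ f x := by
  intro x hx
  have hmono : MonotoneOn f' s := by
    refine monotoneOn_of_deriv_nonneg hs
      (fun y hy => (hf' y hy).continuousAt.continuousWithinAt)
      (fun y hy => (hf' y (interior_subset hy)).differentiableAt.differentiableWithinAt) ?_
    intro y hy
    rw [(hf' y (interior_subset hy)).deriv]
    exact hf'' y (interior_subset hy)
  rcases le_total a x with hax | hax
  · have hsub : Set.Icc a x ⊆ s := hs.ordConnected.out ha hx
    have : MonotoneOn f (Set.Icc a x) := by
      refine monotoneOn_of_deriv_nonneg (convex_Icc a x)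
        (fun y hy => (hf y (hsub hy)).continuousAt.continuousWithinAt)
        (fun y hy => (hf y (hsub (interior_subset hy))).differentiableAt.differentiableWithinAt) ?_
      intro y hy
      have hy' := interior_subset hy
      rw [(hf y (hsub hy')).deriv, ← h0']
      exact hmono ha (hsub hy') hy'.1
    have h := this (Set.left_mem_Icc.2 hax) (Set.right_mem_Icc.2 hax) hax
    rwa [h0] at h
  · have hsub : Set.Icc x a ⊆ s := hs.ordConnected.out hx ha
    have : AntitoneOn f (Set.Icc x a) := by
      refine antitoneOn_of_deriv_nonpos (convex_Icc x a)
        (fun y hy => (hf y (hsub hy)).continuousAt.continuousWithinAt)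
        (fun y hy => (hf y (hsub (interior_subset hy))).differentiableAt.differentiableWithinAt) ?_
      intro y hy
      have hy' := interior_subset hy
      rw [(hf y (hsub hy')).deriv, ← h0']
      exact hmono (hsub hy') ha hy'.2
    have h := this (Set.left_mem_Icc.2 hax) (Set.right_mem_Icc.2 hax) hax
    rwa [h0] at h

/-! ### Gaussian moments -/

theorem integrable_pow_mul_gaussian {b : ℝ} (hb : 0 < b) (n : ℕ) :
    Integrable fun x : ℝ => x ^ n * Real.exp (-b * x ^ 2) := by
  have := integrable_rpow_mul_exp_neg_mul_sq hb (s := n) (by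
    have : (0:ℝ) ≤ n := Nat.cast_nonneg n
    linarith)
  simpa using this

/-- The derivative of `x ^ (n + 1) * exp (-b x²)` has integral zero. -/
theorem gaussian_moment_step {b : ℝ} (hb : 0 < b) (n : ℕ) :
    2 * b * ∫ x : ℝ, x ^ (n + 2) * Real.exp (-b * x ^ 2) =
      (n + 1) * ∫ x : ℝ, x ^ n * Real.exp (-b * x ^ 2) := by
  have h := integral_eq_zero_of_hasDerivAt_of_integrable
    (f := fun x : ℝ => x ^ (n + 1) * Real.exp (-b * x ^ 2))
    (f' := fun x : ℝ => (n + 1) * (x ^ n * Real.exp (-b * x ^ 2))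
      - 2 * b * (x ^ (n + 2) * Real.exp (-b * x ^ 2))) ?_ ?_ (integrable_pow_mul_gaussian hb _)
  · rw [integral_sub ((integrable_pow_mul_gaussian hb _).const_mul _)
      ((integrable_pow_mul_gaussian hb _).const_mul _), integral_const_mul, integral_const_mul] at h
    linarith
  · intro x
    have h1 : HasDerivAt (fun x : ℝ => -b * x ^ 2) (-b * (2 * x)) x := by
      simpa using (hasDerivAt_pow 2 x).const_mul (-b)
    have h2 := (hasDerivAt_pow (n + 1) x).mul h1.exp
    refine h2.congr_deriv ?_
    rw [Nat.add_sub_cancel]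
    push_cast
    ring
  · exact ((integrable_pow_mul_gaussian hb _).const_mul _).sub
      ((integrable_pow_mul_gaussian hb _).const_mul _)

theorem gaussian_moment_one {b : ℝ} (hb : 0 < b) :
    ∫ x : ℝ, x ^ 1 * Real.exp (-b * x ^ 2) = 0 := by
  have h := integral_eq_zero_of_hasDerivAt_of_integrable
    (f := fun x : ℝ => Real.exp (-b * x ^ 2))
    (f' := fun x : ℝ => (-2 * b) * (x ^ 1 * Real.exp (-b * x ^ 2))) ?_
    ((integrable_pow_mul_gaussian hb 1).const_mul _)
    (by simpa using integrable_pow_mul_gaussian hb 0)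
  · rw [integral_const_mul] at h
    simpa [hb.ne'] using h
  · intro x
    have h1 : HasDerivAt (fun x : ℝ => -b * x ^ 2) (-b * (2 * x)) x := by
      simpa using (hasDerivAt_pow 2 x).const_mul (-b)
    refine h1.exp.congr_deriv ?_
    ring

theorem gaussian_moment_odd {b : ℝ} (hb : 0 < b) (k : ℕ) :
    ∫ x : ℝ, x ^ (2 * k + 1) * Real.exp (-b * x ^ 2) = 0 := by
  induction k with
  | zero => exact gaussian_moment_one hb
  | succ k ih =>
    have h := gaussian_moment_step hb (2 * k + 1)
    rw [ih, mul_zero] at h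
    have h2 : 2 * b ≠ 0 := by positivity
    exact (mul_eq_zero.1 h).resolve_left h2

theorem gaussian_moment_four {w : ℝ} (hw : 0 < w) :
    ∫ x : ℝ, x ^ 4 * Real.exp (-(w / 2) * x ^ 2) = 3 / w ^ 2 * √(2 * Real.pi / w) := by
  have h0 := integral_gaussian (w / 2)
  have h1 := gaussian_moment_step (half_pos hw) 0
  have h2 := gaussian_moment_step (half_pos hw) 2
  simp only [pow_zero, one_mul, h0, zero_add, Nat.reduceAdd] at h1 h2
  have e : Real.pi / (w / 2) = 2 * Real.pi / w := by field_simp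
  rw [e] at h1
  set A := ∫ x : ℝ, x ^ 4 * Real.exp (-(w / 2) * x ^ 2)
  set B := ∫ x : ℝ, x ^ 2 * Real.exp (-(w / 2) * x ^ 2)
  rw [div_mul_eq_mul_div, eq_div_iff (by positivity)]
  push_cast at h1 h2
  linear_combination w * h2 + 3 * h1

theorem gaussian_moment_six {w : ℝ} (hw : 0 < w) :
    ∫ x : ℝ, x ^ 6 * Real.exp (-(w / 2) * x ^ 2) = 15 / w ^ 3 * √(2 * Real.pi / w) := by
  have h1 := gaussian_moment_four hw
  have h2 := gaussian_moment_step (half_pos hw) 4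
  simp only [Nat.reduceAdd] at h2
  set A := ∫ x : ℝ, x ^ 6 * Real.exp (-(w / 2) * x ^ 2)
  set B := ∫ x : ℝ, x ^ 4 * Real.exp (-(w / 2) * x ^ 2)
  rw [div_mul_eq_mul_div, eq_div_iff (by positivity)] at h1 ⊢
  push_cast at h2
  linear_combination w ^ 2 * h2 + 5 * h1

/-! ### Polynomial weights against exponential decay -/

theorem integrable_exp_neg_mul_abs {c : ℝ} (hc : 0 < c) :
    Integrable fun x : ℝ => Real.exp (-c * |x|) := by
  have h : IntegrableOn (fun x : ℝ => Real.exp (-c * |x|)) (Set.Ioi 0) :=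
    (integrableOn_exp_mul_Ioi (neg_neg_of_pos hc) 0).congr_fun
      (fun x hx => by simp [abs_of_pos (Set.mem_Ioi.1 hx)]) measurableSet_Ioi
  have h' : IntegrableOn (fun x : ℝ => Real.exp (-c * |x|)) (Set.Iic 0) :=
    (integrableOn_exp_mul_Iic hc 0).congr_fun
      (fun x hx => by simp [abs_of_nonpos (Set.mem_Iic.1 hx)]) measurableSet_Iic
  rw [← integrableOn_univ, ← Set.Iic_union_Ioi (a := (0 : ℝ)), integrableOn_union]
  exact ⟨h', h⟩

theorem integrable_one_add_abs_pow_mul_exp {c : ℝ} (hc : 0 < c) (n : ℕ) :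
    Integrable fun x : ℝ => (1 + |x|) ^ n * Real.exp (-c * |x|) := by
  have hc2 : 0 < c / 2 := half_pos hc
  refine ((integrable_exp_neg_mul_abs hc2).const_mul
    ((n.factorial : ℝ) / (c / 2) ^ n * Real.exp (c / 2))).mono' (by fun_prop) ?_
  refine ae_of_all _ fun x => ?_
  have h := Real.pow_div_factorial_le_exp (c / 2 * (1 + |x|)) (by positivity) n
  have h1 : (1 + |x|) ^ n ≤ (n.factorial : ℝ) / (c / 2) ^ n * Real.exp (c / 2 * (1 + |x|)) := by
    rw [mul_pow, div_le_iff₀ (by positivity)] at h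
    rw [div_mul_eq_mul_div, le_div_iff₀ (by positivity)]
    linarith
  rw [Real.norm_eq_abs, abs_of_nonneg (by positivity)]
  calc _ ≤ (n.factorial : ℝ) / (c / 2) ^ n * Real.exp (c / 2 * (1 + |x|)) * Real.exp (-c * |x|) := by
        gcongr
    _ = _ := by
        rw [mul_assoc, mul_assoc, ← Real.exp_add, ← Real.exp_add]
        ring_nf


/-! ### Convex profiles and Laplace's method -/

/-- A smooth convex function `p` on the line whose derivative vanishes at `u₀` and equals `2` at
`u₁`, and whose second derivative is at least `m` on the `δ`-neighbourhood of `[u₀, u₁]`. -/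
structure IsConvexProfile (p : ℝ → ℝ) (u₀ u₁ δ m : ℝ) : Prop where
  smooth : ContDiff ℝ ∞ p
  δ_pos : 0 < δ
  m_pos : 0 < m
  lt : u₀ < u₁
  deriv_left : iteratedDeriv 1 p u₀ = 0
  deriv_right : iteratedDeriv 1 p u₁ = 2
  convex : ∀ u, 0 ≤ iteratedDeriv 2 p u
  strict : ∀ u ∈ Set.Icc (u₀ - δ) (u₁ + δ), m ≤ iteratedDeriv 2 p u

/-- The excess of `p` over its tangent line at `a`. -/
noncomputable def tangentExcess (p : ℝ → ℝ) (a t : ℝ) : ℝ := p (a + t) - p a - iteratedDeriv 1 p a * t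

/-- The coefficient of `1 / M` in the relative Laplace expansion. -/
noncomputable def laplaceCoeff (p : ℝ → ℝ) (a : ℝ) : ℝ :=
  5 * iteratedDeriv 3 p a ^ 2 / (24 * iteratedDeriv 2 p a ^ 3)
    - iteratedDeriv 4 p a / (8 * iteratedDeriv 2 p a ^ 2)

namespace IsConvexProfile

variable {p : ℝ → ℝ} {u₀ u₁ δ m : ℝ}

theorem hasDerivAt (h : IsConvexProfile p u₀ u₁ δ m) (k : ℕ) (x : ℝ) :
    HasDerivAt (iteratedDeriv k p) (iteratedDeriv (k + 1) p x) x := by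
  rw [iteratedDeriv_succ]
  exact ((h.smooth.differentiable_iteratedDeriv k
    (mod_cast ENat.natCast_lt_top k)) x).hasDerivAt

theorem hasDerivAt_self (h : IsConvexProfile p u₀ u₁ δ m) (x : ℝ) :
    HasDerivAt p (iteratedDeriv 1 p x) x := by
  simpa using h.hasDerivAt 0 x

theorem continuous (h : IsConvexProfile p u₀ u₁ δ m) (k : ℕ) : Continuous (iteratedDeriv k p) :=
  continuous_iff_continuousAt.2 fun x => (h.hasDerivAt k x).continuousAt

theorem exists_bound (h : IsConvexProfile p u₀ u₁ δ m) :
    ∃ K, 1 ≤ K ∧ ∀ k ≤ 6, ∀ u ∈ Set.Icc (u₀ - δ) (u₁ + δ), |iteratedDeriv k p u| ≤ K := by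
  have : ∀ k, ∃ K, ∀ u ∈ Set.Icc (u₀ - δ) (u₁ + δ), |iteratedDeriv k p u| ≤ K := fun k =>
    isCompact_Icc.exists_bound_of_continuousOn (h.continuous k).continuousOn
  choose K hK using this
  refine ⟨1 + ∑ k ∈ Finset.range 7, |K k|, ?_, ?_⟩
  · have : 0 ≤ ∑ k ∈ Finset.range 7, |K k| := by positivity
    linarith
  · intro k hk u hu
    have := Finset.single_le_sum (f := fun k => |K k|) (fun i _ => abs_nonneg _)
      (Finset.mem_range.2 (by omega : k < 7))
    linarith [hK k u hu, le_abs_self (K k)]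

theorem convexOn (h : IsConvexProfile p u₀ u₁ δ m) : ConvexOn ℝ Set.univ p := by
  refine convexOn_univ_of_deriv2_nonneg (fun x => (h.hasDerivAt_self x).differentiableAt) ?_ ?_
  · have : deriv p = iteratedDeriv 1 p := by rw [iteratedDeriv_one]
    rw [this]
    exact fun x => (h.hasDerivAt 1 x).differentiableAt
  · intro x
    rw [← iteratedDeriv_eq_iterate]
    exact h.convex x

theorem tangentExcess_convexOn (h : IsConvexProfile p u₀ u₁ δ m) (a : ℝ) :
    ConvexOn ℝ Set.univ (tangentExcess p a) := by
  refine ⟨convex_univ, fun x _ y _ α β hα hβ hαβ => ?_⟩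
  have := h.convexOn.2 (Set.mem_univ (a + x)) (Set.mem_univ (a + y)) hα hβ hαβ
  simp only [smul_eq_mul, tangentExcess] at this ⊢
  have e : α * (a + x) + β * (a + y) = a + (α * x + β * y) := by
    linear_combination a * hαβ
  rw [e] at this
  have e2 : p a = α * p a + β * p a := by rw [← add_mul, hαβ, one_mul]
  linarith

theorem tangentExcess_ge_sq (h : IsConvexProfile p u₀ u₁ δ m) {a : ℝ} (ha : a ∈ Set.Icc u₀ u₁)
    {t : ℝ} (ht : |t| ≤ δ) : m / 2 * t ^ 2 ≤ tangentExcess p a t := by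
  have := nonneg_of_second_deriv_nonneg (convex_Icc (a - δ) (a + δ)) (a := a)
    (f := fun x => p x - p a - iteratedDeriv 1 p a * (x - a) - m / 2 * (x - a) ^ 2)
    (f' := fun x => iteratedDeriv 1 p x - iteratedDeriv 1 p a - m * (x - a))
    (f'' := fun x => iteratedDeriv 2 p x - m)
    ⟨by linarith [h.δ_pos], by linarith [h.δ_pos]⟩ (by simp) (by simp) ?_ ?_ ?_ (a + t)
    ⟨by linarith [neg_le_of_abs_le ht], by linarith [le_of_abs_le ht]⟩
  · simp only [add_sub_cancel_left] at this
    unfold tangentExcess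
    linarith
  · intro x _
    have h1 : HasDerivAt (fun x : ℝ => x - a) 1 x := (hasDerivAt_id x).sub_const a
    have h2 := (((h.hasDerivAt_self x).sub_const (p a)).sub
      (h1.const_mul (iteratedDeriv 1 p a))).sub ((h1.fun_pow 2).const_mul (m / 2))
    refine h2.congr_deriv ?_
    push_cast
    ring
  · intro x _
    have h1 : HasDerivAt (fun x : ℝ => x - a) 1 x := (hasDerivAt_id x).sub_const a
    refine (((h.hasDerivAt 1 x).sub_const _).sub (h1.const_mul m)).congr_deriv ?_
    ring
  · intro x hx
    have := h.strict x ⟨by linarith [hx.1, ha.1], by linarith [hx.2, ha.2]⟩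
    linarith

/-- The excess is convex and vanishes at `0`, so beyond distance `δ` it stays above the ray through
its value there. This gives exponential tails although `p` need not be strictly convex far away. -/
theorem tangentExcess_ge_abs (h : IsConvexProfile p u₀ u₁ δ m) {a : ℝ} (ha : a ∈ Set.Icc u₀ u₁)
    {t : ℝ} (ht : δ ≤ |t|) : m / 2 * δ * |t| ≤ tangentExcess p a t := by
  have hδ := h.δ_pos
  have ht0 : 0 < |t| := hδ.trans_le ht
  have hc := (h.tangentExcess_convexOn a).2 (Set.mem_univ t) (Set.mem_univ 0)
    (show 0 ≤ δ / |t| by positivity)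
    (show 0 ≤ 1 - δ / |t| by rw [sub_nonneg, div_le_one ht0]; exact ht) (by ring)
  have h0 : tangentExcess p a 0 = 0 := by simp [tangentExcess]
  simp only [smul_eq_mul, mul_zero, add_zero, h0] at hc
  have habs : |δ / |t| * t| = δ := by
    rw [abs_mul, abs_div, abs_abs, abs_of_pos hδ]; field_simp
  have h1 := h.tangentExcess_ge_sq ha habs.le
  rw [← sq_abs, habs] at h1
  have h2 : m / 2 * δ ^ 2 ≤ δ * tangentExcess p a t / |t| :=
    (h1.trans hc).trans_eq (by ring)
  rw [le_div_iff₀ ht0] at h2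
  have : δ * (m / 2 * δ * |t|) ≤ δ * tangentExcess p a t := by linarith
  exact le_of_mul_le_mul_left this hδ

/-- The rate of exponential decay in the scaled variable. -/
theorem scaled_tangentExcess_ge (h : IsConvexProfile p u₀ u₁ δ m) {a : ℝ}
    (ha : a ∈ Set.Icc u₀ u₁) {ε : ℝ} (hε : 0 < ε) (hε1 : ε ≤ 1) (x : ℝ) :
    m / 2 * min 1 δ * (|x| - 1) ≤ tangentExcess p a (ε * x) / ε ^ 2 := by
  have hδ := h.δ_pos
  have hm := h.m_pos
  rw [le_div_iff₀ (by positivity)]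
  have hmin : 0 < min 1 δ := lt_min one_pos hδ
  rcases le_total |ε * x| δ with hx | hx
  · refine le_trans ?_ (h.tangentExcess_ge_sq ha hx)
    have h1 : min 1 δ * (|x| - 1) ≤ x ^ 2 := by
      rw [← sq_abs]
      rcases le_total |x| 1 with h1 | h1
      · nlinarith [sq_nonneg |x|]
      · nlinarith [min_le_left 1 δ, abs_nonneg x]
    calc m / 2 * min 1 δ * (|x| - 1) * ε ^ 2 = m / 2 * (min 1 δ * (|x| - 1)) * ε ^ 2 := by ring
      _ ≤ m / 2 * x ^ 2 * ε ^ 2 := by gcongr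
      _ = _ := by ring
  · refine le_trans ?_ (h.tangentExcess_ge_abs ha hx)
    rw [abs_mul, abs_of_pos hε]
    have h1 : min 1 δ * (|x| - 1) * ε ^ 2 ≤ δ * (ε * |x|) := by
      calc min 1 δ * (|x| - 1) * ε ^ 2 ≤ min 1 δ * |x| * ε ^ 2 := by gcongr; linarith
        _ ≤ δ * |x| * ε ^ 2 := by gcongr; exact min_le_right _ _
        _ ≤ δ * |x| * ε := by
          gcongr
          nlinarith
        _ = _ := by ring
    calc m / 2 * min 1 δ * (|x| - 1) * ε ^ 2 = m / 2 * (min 1 δ * (|x| - 1) * ε ^ 2) := by ring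
      _ ≤ m / 2 * (δ * (ε * |x|)) := by gcongr
      _ = _ := by ring

end IsConvexProfile

/-! ### The exponential of a small perturbation -/

/-- The maximum bounds the exponential between `0` and `y` for either sign of `y`. Multiplied by the
Gaussian it becomes the maximum of the Gaussian and the true integrand, both of which decay. -/
theorem abs_exp_neg_sub_cubic_le (y : ℝ) :
    |Real.exp (-y) - (1 - y + y ^ 2 / 2 - y ^ 3 / 6)| ≤ y ^ 4 * max 1 (Real.exp (-y)) := by
  have hs : Convex ℝ (Set.uIcc 0 y) := convex_uIcc 0 y
  have := abs_sub_taylor_le hs (a := 0) (K := max 1 (Real.exp (-y))) Set.left_mem_uIcc 4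
    (fun k x => (-1) ^ k * Real.exp (-x)) (fun k _ x _ => by
      refine (((hasDerivAt_neg x).exp).const_mul ((-1) ^ k)).congr_deriv ?_
      ring) (fun x hx => by
      norm_num
      rcases le_total 0 y with h | h
      · rw [Set.uIcc_of_le h] at hx
        left; exact hx.1
      · rw [Set.uIcc_of_ge h] at hx
        right; exact hx.1) y Set.right_mem_uIcc
  simp only [Finset.sum_range_succ, Finset.sum_range_zero, Nat.factorial] at this
  norm_num at this
  have e : |y| ^ 4 = y ^ 4 := by rw [Even.pow_abs (by decide)]
  rw [e, mul_comm] at this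
  refine le_trans (le_of_eq ?_) this
  congr 1

theorem abs_cubic_sub_expansion_le {ε A₁ A₂ A₃ r Y : ℝ} (hε : 0 ≤ ε) (hε1 : ε ≤ 1) (hY : 1 ≤ Y)
    (h1 : |A₁| ≤ Y) (h2 : |A₂| ≤ Y) (h3 : |A₃| ≤ Y) (hr : |r| ≤ Y) {y : ℝ}
    (hy : y = ε * A₁ + ε ^ 2 * A₂ + ε ^ 3 * A₃ + ε ^ 4 * r) :
    |(1 - y + y ^ 2 / 2 - y ^ 3 / 6) - (1 - ε * A₁ + ε ^ 2 * (A₁ ^ 2 / 2 - A₂)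
      + ε ^ 3 * (-A₃ + A₁ * A₂ - A₁ ^ 3 / 6))| ≤ ε ^ 4 * (18 * Y ^ 3) := by
  have hY0 : 0 ≤ Y := by linarith
  have hsm : ∀ z : ℝ, |z| ≤ Y → |ε * z| ≤ Y := fun z hz => by
    rw [abs_mul, abs_of_nonneg hε]
    calc ε * |z| ≤ 1 * |z| := by gcongr
      _ ≤ Y := by linarith
  -- Horner form `y = ε A₁ + ε² z`, `z = A₂ + ε v`: the difference is then exactly `ε ^ 4` times a
  -- polynomial. Its terms contribute `1 + 2 + 9/2 + 3/2 + 9/2 + 9/2 = 18`.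
  set v := A₃ + ε * r with hv
  set z := A₂ + ε * v with hz
  have hvb : |v| ≤ 2 * Y := (abs_add_le _ _).trans (by linarith [hsm r hr])
  have hzb : |z| ≤ 3 * Y := by
    refine (abs_add_le _ _).trans ?_
    have : |ε * v| ≤ 2 * Y := by
      rw [abs_mul, abs_of_nonneg hε]
      calc ε * |v| ≤ 1 * |v| := by gcongr
        _ ≤ 2 * Y := by linarith
    linarith
  have e : (1 - y + y ^ 2 / 2 - y ^ 3 / 6) - (1 - ε * A₁ + ε ^ 2 * (A₁ ^ 2 / 2 - A₂)
      + ε ^ 3 * (-A₃ + A₁ * A₂ - A₁ ^ 3 / 6)) =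
      ε ^ 4 * (-r + A₁ * v + z ^ 2 / 2 - A₁ ^ 2 * z / 2 - ε * (A₁ * z ^ 2) / 2
        - ε ^ 2 * z ^ 3 / 6) := by
    rw [hy, hz, hv]; ring
  rw [e, abs_mul, abs_of_nonneg (by positivity : (0:ℝ) ≤ ε ^ 4)]
  gcongr
  have b1 : |A₁ * v| ≤ 2 * Y ^ 3 := by
    rw [abs_mul]
    calc |A₁| * |v| ≤ Y * (2 * Y) := by gcongr
      _ ≤ 2 * Y ^ 3 := by nlinarith [mul_nonneg hY0 hY0]
  have b2 : |z ^ 2| ≤ 9 * Y ^ 3 := by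
    rw [abs_pow]
    calc |z| ^ 2 ≤ (3 * Y) ^ 2 := by gcongr
      _ ≤ 9 * Y ^ 3 := by nlinarith [mul_nonneg hY0 hY0]
  have b3 : |A₁ ^ 2 * z| ≤ 3 * Y ^ 3 := by
    rw [abs_mul, abs_pow]
    calc |A₁| ^ 2 * |z| ≤ Y ^ 2 * (3 * Y) := by gcongr
      _ = 3 * Y ^ 3 := by ring
  have b4 : |ε * (A₁ * z ^ 2)| ≤ 9 * Y ^ 3 := by
    rw [abs_mul, abs_mul, abs_pow, abs_of_nonneg hε]
    calc ε * (|A₁| * |z| ^ 2) ≤ 1 * (Y * (3 * Y) ^ 2) := by gcongr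
      _ = 9 * Y ^ 3 := by ring
  have b5 : |ε ^ 2 * z ^ 3| ≤ 27 * Y ^ 3 := by
    rw [abs_mul, abs_pow, abs_pow, abs_of_nonneg hε]
    calc ε ^ 2 * |z| ^ 3 ≤ 1 ^ 2 * (3 * Y) ^ 3 := by gcongr
      _ = 27 * Y ^ 3 := by ring
  have b6 : |r| ≤ Y ^ 3 := hr.trans (by nlinarith [mul_nonneg hY0 hY0])
  rw [abs_le] at *
  constructor <;> linarith [b1.1, b1.2, b2.1, b2.2, b3.1, b3.2, b4.1, b4.2, b5.1, b5.2, b6.1, b6.2]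

theorem abs_expansion_le {ε A₁ A₂ A₃ Y : ℝ} (hε : 0 < ε) (hε1 : ε ≤ 1) (hY1 : 1 ≤ Y)
    (b1 : |A₁| ≤ Y) (b2 : |A₂| ≤ Y) (b3 : |A₃| ≤ Y) :
    |1 - ε * A₁ + ε ^ 2 * (A₁ ^ 2 / 2 - A₂) + ε ^ 3 * (-A₃ + A₁ * A₂ - A₁ ^ 3 / 6)|
      ≤ 6 * Y ^ 3 := by
  have q1 : 1 ≤ Y ^ 3 := one_le_pow₀ hY1
  have q2 : Y ≤ Y ^ 3 := by simpa using pow_le_pow_right₀ hY1 (show 1 ≤ 3 by norm_num)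
  have q4 : Y * Y = Y ^ 2 := by ring
  have q3 : Y ^ 2 ≤ Y ^ 3 := pow_le_pow_right₀ hY1 (by norm_num)
  have e1 : |ε * A₁| ≤ Y := by
    rw [abs_mul, abs_of_pos hε]
    calc ε * |A₁| ≤ 1 * Y := by gcongr
      _ = Y := one_mul Y
  have s1 : |A₁ ^ 2 / 2 - A₂| ≤ Y ^ 2 / 2 + Y := by
    refine (abs_sub _ _).trans ?_
    rw [abs_div, abs_pow, abs_of_pos (by norm_num : (0:ℝ) < 2)]
    gcongr
  have s2 : |-A₃ + A₁ * A₂ - A₁ ^ 3 / 6| ≤ Y + Y * Y + Y ^ 3 / 6 := by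
    refine (abs_sub _ _).trans ?_
    rw [abs_div, abs_pow, abs_of_pos (by norm_num : (0:ℝ) < 6)]
    gcongr
    refine (abs_add_le _ _).trans ?_
    rw [abs_neg, abs_mul]
    gcongr
  have e2 : |ε ^ 2 * (A₁ ^ 2 / 2 - A₂)| ≤ Y ^ 2 / 2 + Y := by
    rw [abs_mul, abs_of_pos (by positivity : 0 < ε ^ 2)]
    calc _ ≤ 1 * (Y ^ 2 / 2 + Y) := by gcongr; exact pow_le_one₀ hε.le hε1
      _ = _ := one_mul _
  have e3 : |ε ^ 3 * (-A₃ + A₁ * A₂ - A₁ ^ 3 / 6)| ≤ Y + Y * Y + Y ^ 3 / 6 := by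
    rw [abs_mul, abs_of_pos (by positivity : 0 < ε ^ 3)]
    calc _ ≤ 1 * (Y + Y * Y + Y ^ 3 / 6) := by gcongr; exact pow_le_one₀ hε.le hε1
      _ = _ := one_mul _
  rw [abs_le] at e1 e2 e3 ⊢
  constructor <;> linarith [e1.1, e1.2, e2.1, e2.2, e3.1, e3.2]

/-! ### Laplace expansion, uniform in the base point -/

namespace IsConvexProfile

variable {p : ℝ → ℝ} {u₀ u₁ δ m : ℝ}

theorem abs_tangentExcess_sub_le (h : IsConvexProfile p u₀ u₁ δ m) {a K t : ℝ}
    (ha : a ∈ Set.Icc u₀ u₁) (ht : |t| ≤ δ)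
    (hK : ∀ u ∈ Set.Icc (u₀ - δ) (u₁ + δ), |iteratedDeriv 6 p u| ≤ K) :
    |tangentExcess p a t - (iteratedDeriv 2 p a / 2 * t ^ 2 + iteratedDeriv 3 p a / 6 * t ^ 3
      + iteratedDeriv 4 p a / 24 * t ^ 4 + iteratedDeriv 5 p a / 120 * t ^ 5)| ≤ K * |t| ^ 6 := by
  have := abs_sub_taylor_le (convex_Icc (u₀ - δ) (u₁ + δ)) (a := a)
    ⟨by linarith [ha.1, h.δ_pos], by linarith [ha.2, h.δ_pos]⟩ 6
    (fun k => iteratedDeriv k p) (fun k _ x _ => h.hasDerivAt k x) hK (a + t)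
    ⟨by linarith [ha.1, neg_le_of_abs_le ht], by linarith [ha.2, le_of_abs_le ht]⟩
  simp only [Finset.sum_range_succ, Finset.sum_range_zero, add_sub_cancel_left] at this
  norm_num [Nat.factorial] at this
  refine le_trans (le_of_eq ?_) this
  congr 1
  rw [tangentExcess, iteratedDeriv_one]
  ring

set_option maxHeartbeats 800000 in
-- Two regimes. For `|ε x| ≤ δ`, Taylor's formula to sixth order writes the scaled excess as a
-- quadratic plus `ε A₁ + ε² A₂ + ε³ A₃ + O(ε⁴)`, and the exponential is expanded. For `|ε x| > δ`
-- nothing needs to cancel: both terms decay exponentially, and a factor `ε⁴ ((1 + |x|)/δ)⁴ ≥ 1` can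
-- be inserted. The exponent `28` is `4 · 6` from `Y ^ 4`, plus this `4`.
theorem exists_pointwise_laplace (h : IsConvexProfile p u₀ u₁ δ m) :
    ∃ C, ∀ a ∈ Set.Icc u₀ u₁, ∀ ε : ℝ, 0 < ε → ε ≤ 1 → ∀ x : ℝ,
      |Real.exp (-(tangentExcess p a (ε * x) / ε ^ 2)) -
        Real.exp (-(iteratedDeriv 2 p a / 2) * x ^ 2) *
          (1 - ε * (iteratedDeriv 3 p a / 6 * x ^ 3)
            + ε ^ 2 * ((iteratedDeriv 3 p a / 6 * x ^ 3) ^ 2 / 2 - iteratedDeriv 4 p a / 24 * x ^ 4)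
            + ε ^ 3 * (-(iteratedDeriv 5 p a / 120 * x ^ 5)
                + (iteratedDeriv 3 p a / 6 * x ^ 3) * (iteratedDeriv 4 p a / 24 * x ^ 4)
                - (iteratedDeriv 3 p a / 6 * x ^ 3) ^ 3 / 6))|
      ≤ ε ^ 4 * (C * ((1 + |x|) ^ 28 * Real.exp (-(m / 2 * min 1 δ) * |x|))) := by
  obtain ⟨K, hK1, hK⟩ := h.exists_bound
  have hδ := h.δ_pos
  set c := m / 2 * min 1 δ with hc
  -- `274 = 256 + 18` comes from the near regime and `7 / δ ^ 4` from the far one; `exp c` pays for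
  -- the shift in the decay rate `c (|x| - 1)`.
  refine ⟨K ^ 4 * (274 + 7 / δ ^ 4) * Real.exp c, fun a ha ε hε hε1 x => ?_⟩
  have haδ : a ∈ Set.Icc (u₀ - δ) (u₁ + δ) := ⟨by linarith [ha.1], by linarith [ha.2]⟩
  have hK0 : 0 < K := by linarith
  set w₂ := iteratedDeriv 2 p a with hw₂
  set A₁ := iteratedDeriv 3 p a / 6 * x ^ 3 with hA₁
  set A₂ := iteratedDeriv 4 p a / 24 * x ^ 4 with hA₂
  set A₃ := iteratedDeriv 5 p a / 120 * x ^ 5 with hA₃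
  set P := 1 - ε * A₁ + ε ^ 2 * (A₁ ^ 2 / 2 - A₂) + ε ^ 3 * (-A₃ + A₁ * A₂ - A₁ ^ 3 / 6) with hP
  set E₀ := Real.exp (-(w₂ / 2) * x ^ 2) with hE₀
  set E₁ := Real.exp (-(tangentExcess p a (ε * x) / ε ^ 2)) with hE₁
  set X := 1 + |x| with hX
  have hX1 : 1 ≤ X := by rw [hX]; linarith [abs_nonneg x]
  set Y := K * X ^ 6 with hY
  have hXn : ∀ n : ℕ, 1 ≤ X ^ n := fun n => one_le_pow₀ hX1
  have hY1 : 1 ≤ Y := by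
    calc (1:ℝ) = 1 * 1 := by ring
      _ ≤ K * X ^ 6 := by gcongr; exact hXn 6
  set D := Real.exp c * Real.exp (-c * |x|) with hD
  have hD0 : 0 < D := by positivity
  have hE₁D : E₁ ≤ D := by
    rw [hE₁, hD, ← Real.exp_add]
    gcongr
    have := h.scaled_tangentExcess_ge ha hε hε1 x
    rw [← hc] at this
    linarith
  have hE₀D : E₀ ≤ D := by
    rw [hE₀, hD, ← Real.exp_add]
    gcongr
    have h1 := h.strict a haδ
    have hmin : 0 < min 1 δ := lt_min one_pos hδ
    have h2 : min 1 δ * (|x| - 1) ≤ x ^ 2 := by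
      rw [← sq_abs]
      rcases le_total |x| 1 with h1 | h1
      · nlinarith [sq_nonneg |x|]
      · nlinarith [min_le_left 1 δ, abs_nonneg x]
    have hm := h.m_pos
    have h3 : m / 2 * (min 1 δ * (|x| - 1)) ≤ m / 2 * x ^ 2 := by gcongr
    have h4 : m / 2 * x ^ 2 ≤ w₂ / 2 * x ^ 2 := by gcongr
    rw [hc]
    linarith
  have hE₀0 : 0 < E₀ := Real.exp_pos _
  have hE₁0 : 0 < E₁ := Real.exp_pos _
  have hpow : ∀ n ≤ 6, |x| ^ n ≤ X ^ 6 := fun n hn =>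
    (pow_le_pow_left₀ (abs_nonneg x) (by rw [hX]; linarith) n).trans (pow_le_pow_right₀ hX1 hn)
  have hcoef : ∀ (k n : ℕ) (d : ℝ), k ≤ 6 → n ≤ 6 → 1 ≤ d →
      |iteratedDeriv k p a / d * x ^ n| ≤ Y := by
    intro k n d hk hn hd
    rw [abs_mul, abs_div, abs_pow, abs_of_pos (by linarith : 0 < d)]
    have h1 : |iteratedDeriv k p a| / d ≤ K :=
      (div_le_self (abs_nonneg _) hd).trans (hK k hk a haδ)
    exact mul_le_mul h1 (hpow n hn) (by positivity) hK0.le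
  have b1 : |A₁| ≤ Y := hcoef 3 3 6 (by norm_num) (by norm_num) (by norm_num)
  have b2 : |A₂| ≤ Y := hcoef 4 4 24 (by norm_num) (by norm_num) (by norm_num)
  have b3 : |A₃| ≤ Y := hcoef 5 5 120 (by norm_num) (by norm_num) (by norm_num)
  have hfinal : ε ^ 4 * (K ^ 4 * (274 + 7 / δ ^ 4) * Real.exp c
      * (X ^ 28 * Real.exp (-c * |x|))) =
      ε ^ 4 * (274 * Y ^ 4 * X ^ 4 * D) + ε ^ 4 * (X ^ 4 / δ ^ 4) * (7 * Y ^ 4 * D) := by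
    rw [hY, hD]; ring
  rw [hfinal]
  rcases le_or_gt |ε * x| δ with hx | hx
  · set y := tangentExcess p a (ε * x) / ε ^ 2 - w₂ / 2 * x ^ 2 with hy
    set r := (y - (ε * A₁ + ε ^ 2 * A₂ + ε ^ 3 * A₃)) / ε ^ 4 with hr
    have hyr : y = ε * A₁ + ε ^ 2 * A₂ + ε ^ 3 * A₃ + ε ^ 4 * r := by
      rw [hr]; field_simp; ring
    have br : |r| ≤ Y := by
      have hT := h.abs_tangentExcess_sub_le ha hx (hK 6 le_rfl)
      have e : r = (tangentExcess p a (ε * x) - (iteratedDeriv 2 p a / 2 * (ε * x) ^ 2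
          + iteratedDeriv 3 p a / 6 * (ε * x) ^ 3 + iteratedDeriv 4 p a / 24 * (ε * x) ^ 4
          + iteratedDeriv 5 p a / 120 * (ε * x) ^ 5)) / ε ^ 6 := by
        rw [hr, hy, hA₁, hA₂, hA₃, hw₂]; field_simp; ring
      rw [e, abs_div, abs_of_pos (by positivity : 0 < ε ^ 6), div_le_iff₀ (by positivity)]
      refine hT.trans ?_
      rw [abs_mul, abs_of_pos hε, mul_pow]
      calc K * (ε ^ 6 * |x| ^ 6) = K * |x| ^ 6 * ε ^ 6 := by ring
        _ ≤ K * X ^ 6 * ε ^ 6 := by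
          have := hpow 6 le_rfl
          gcongr K * ?_ * ε ^ 6
    have by4 : y ^ 4 ≤ ε ^ 4 * (256 * Y ^ 4) := by
      have hsm : ∀ (n : ℕ) (z : ℝ), 1 ≤ n → |z| ≤ Y → |ε ^ n * z| ≤ ε * Y := by
        intro n z hn hz
        rw [abs_mul, abs_of_pos (by positivity)]
        have : ε ^ n ≤ ε := by simpa using pow_le_pow_of_le_one hε.le hε1 hn
        gcongr
      have : |y| ≤ 4 * (ε * Y) := by
        have c1 := hsm 1 _ le_rfl b1
        have c2 := hsm 2 _ (by norm_num) b2
        have c3 := hsm 3 _ (by norm_num) b3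
        have c4 := hsm 4 _ (by norm_num) br
        rw [pow_one] at c1
        rw [hyr]
        refine (abs_add_le _ _).trans ?_
        refine (add_le_add_left (abs_add_le _ _) _).trans ?_
        refine (add_le_add_left (add_le_add_left (abs_add_le _ _) _) _).trans ?_
        linarith
      calc y ^ 4 = |y| ^ 4 := by rw [Even.pow_abs (by decide)]
        _ ≤ (4 * (ε * Y)) ^ 4 := by gcongr
        _ = _ := by ring
    have hE : E₁ = E₀ * Real.exp (-y) := by
      rw [hE₁, hE₀, ← Real.exp_add, hy]; ring_nf
    have t1 : E₀ * |Real.exp (-y) - (1 - y + y ^ 2 / 2 - y ^ 3 / 6)| ≤ ε ^ 4 * (256 * Y ^ 4) * D := by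
      calc _ ≤ E₀ * (y ^ 4 * max 1 (Real.exp (-y))) := by
            gcongr; exact abs_exp_neg_sub_cubic_le y
        _ = y ^ 4 * max E₀ E₁ := by
            rw [hE, mul_left_comm, mul_max_of_nonneg _ _ hE₀0.le, mul_one]
        _ ≤ ε ^ 4 * (256 * Y ^ 4) * D := by gcongr; exact max_le hE₀D hE₁D
    have t2 : E₀ * |(1 - y + y ^ 2 / 2 - y ^ 3 / 6) - P| ≤ ε ^ 4 * (18 * Y ^ 3) * D := by
      have := abs_cubic_sub_expansion_le hε.le hε1 hY1 b1 b2 b3 br hyr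
      rw [← hP] at this
      calc _ ≤ D * (ε ^ 4 * (18 * Y ^ 3)) := by gcongr
        _ = _ := by ring
    have t3 : |E₁ - E₀ * P| ≤ E₀ * |Real.exp (-y) - (1 - y + y ^ 2 / 2 - y ^ 3 / 6)|
        + E₀ * |(1 - y + y ^ 2 / 2 - y ^ 3 / 6) - P| := by
      rw [hE, ← mul_sub, abs_mul, abs_of_pos hE₀0, ← mul_add]
      gcongr
      exact abs_sub_le _ _ _
    have t4 : ε ^ 4 * (256 * Y ^ 4) * D + ε ^ 4 * (18 * Y ^ 3) * D
        ≤ ε ^ 4 * (274 * Y ^ 4 * X ^ 4 * D) := by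
      have q1 : Y ^ 3 ≤ Y ^ 4 := pow_le_pow_right₀ hY1 (by norm_num)
      have q2 : Y ^ 4 * 1 ≤ Y ^ 4 * X ^ 4 := by gcongr; exact hXn 4
      have q3 : 0 < ε ^ 4 * D := by positivity
      calc _ = ε ^ 4 * D * (256 * Y ^ 4 + 18 * Y ^ 3) := by ring
        _ ≤ ε ^ 4 * D * (274 * (Y ^ 4 * X ^ 4)) := by gcongr; linarith
        _ = _ := by ring
    have : 0 ≤ ε ^ 4 * (X ^ 4 / δ ^ 4) * (7 * Y ^ 4 * D) := by positivity
    linarith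
  · have hone : 1 ≤ ε ^ 4 * (X ^ 4 / δ ^ 4) := by
      rw [mul_div_assoc', one_le_div (by positivity), ← mul_pow]
      gcongr
      refine hx.le.trans ?_
      rw [abs_mul, abs_of_pos hε]
      gcongr
      rw [hX]; linarith
    have hPb : |P| ≤ 6 * Y ^ 3 := abs_expansion_le hε hε1 hY1 b1 b2 b3
    calc |E₁ - E₀ * P| ≤ E₁ + E₀ * |P| := by
          refine (abs_sub _ _).trans ?_
          rw [abs_mul, abs_of_pos hE₀0, abs_of_pos hE₁0]
      _ ≤ D + D * (6 * Y ^ 3) := by gcongr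
      _ ≤ 7 * Y ^ 4 * D := by
          have q1 : 1 ≤ Y ^ 4 := one_le_pow₀ hY1
          have q2 : Y ^ 3 ≤ Y ^ 4 := pow_le_pow_right₀ hY1 (by norm_num)
          have q3 : D * 1 ≤ D * Y ^ 4 := by gcongr
          have q4 : D * Y ^ 3 ≤ D * Y ^ 4 := by gcongr
          linarith
      _ = 1 * (7 * Y ^ 4 * D) := by ring
      _ ≤ ε ^ 4 * (X ^ 4 / δ ^ 4) * (7 * Y ^ 4 * D) := by gcongr
      _ ≤ _ := by
          have : 0 ≤ ε ^ 4 * (274 * Y ^ 4 * X ^ 4 * D) := by positivity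
          linarith

theorem integrable_exp_neg_tangentExcess (h : IsConvexProfile p u₀ u₁ δ m) {a : ℝ}
    (ha : a ∈ Set.Icc u₀ u₁) {ε : ℝ} (hε : 0 < ε) (hε1 : ε ≤ 1) :
    Integrable fun x => Real.exp (-(tangentExcess p a (ε * x) / ε ^ 2)) := by
  have hc : 0 < m / 2 * min 1 δ := mul_pos (half_pos h.m_pos) (lt_min one_pos h.δ_pos)
  refine ((integrable_exp_neg_mul_abs hc).const_mul (Real.exp (m / 2 * min 1 δ))).mono' ?_ ?_
  · have hp : Continuous p := by simpa using h.continuous 0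
    unfold tangentExcess
    exact Continuous.aestronglyMeasurable (by fun_prop)
  · refine ae_of_all _ fun x => ?_
    rw [Real.norm_eq_abs, Real.abs_exp, ← Real.exp_add]
    gcongr
    have := h.scaled_tangentExcess_ge ha hε hε1 x
    linarith

/-- Odd powers of `ε` come with odd powers of `x`, whose Gaussian moments vanish. Expanding the
integrand through `ε ^ 3` therefore leaves an error `ε ^ 4` after the single correction at `ε ^ 2`.
The moments of order four and six produce `laplaceCoeff`. -/
theorem exists_laplace (h : IsConvexProfile p u₀ u₁ δ m) :
    ∃ C, ∀ a ∈ Set.Icc u₀ u₁, ∀ ε : ℝ, 0 < ε → ε ≤ 1 →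
      |(∫ x, Real.exp (-(tangentExcess p a (ε * x) / ε ^ 2))) -
        √(2 * Real.pi / iteratedDeriv 2 p a) * (1 + ε ^ 2 * laplaceCoeff p a)| ≤ C * ε ^ 4 := by
  obtain ⟨C, hC⟩ := h.exists_pointwise_laplace
  have hδ := h.δ_pos
  have hc : 0 < m / 2 * min 1 δ := mul_pos (half_pos h.m_pos) (lt_min one_pos hδ)
  refine ⟨C * ∫ x, (1 + |x|) ^ 28 * Real.exp (-(m / 2 * min 1 δ) * |x|), fun a ha ε hε hε1 => ?_⟩
  have haδ : a ∈ Set.Icc (u₀ - δ) (u₁ + δ) := ⟨by linarith [ha.1], by linarith [ha.2]⟩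
  have hw : 0 < iteratedDeriv 2 p a := h.m_pos.trans_le (h.strict a haδ)
  set w₂ := iteratedDeriv 2 p a with hw₂
  set w₃ := iteratedDeriv 3 p a with hw₃
  set w₄ := iteratedDeriv 4 p a with hw₄
  set w₅ := iteratedDeriv 5 p a with hw₅
  have hI := fun n => integrable_pow_mul_gaussian (half_pos hw) n
  have hodd := gaussian_moment_odd (half_pos hw)
  have hm4 := gaussian_moment_four hw
  have hm6 := gaussian_moment_six hw
  have hm0 := integral_gaussian (w₂ / 2)
  obtain ⟨F, hF⟩ : ∃ F : ℕ → ℝ → ℝ, F = fun n x => x ^ n * Real.exp (-(w₂ / 2) * x ^ 2) := ⟨_, rfl⟩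
  have hFI : ∀ n, Integrable (F n) := fun n => by rw [hF]; exact hI n
  -- `c n` is the coefficient of `x ^ n` in the polynomial of degree nine that multiplies the
  -- Gaussian.
  set c : ℕ → ℝ := fun n => if n = 0 then 1 else if n = 3 then -(ε * w₃ / 6)
    else if n = 4 then -(ε ^ 2 * w₄ / 24) else if n = 5 then -(ε ^ 3 * w₅ / 120)
    else if n = 6 then ε ^ 2 * w₃ ^ 2 / 72 else if n = 7 then ε ^ 3 * w₃ * w₄ / 144
    else if n = 9 then -(ε ^ 3 * w₃ ^ 3 / 1296) else 0 with hc'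
  have hint : Integrable fun x => ∑ n ∈ Finset.range 10, c n * F n x :=
    integrable_finsetSum _ fun n _ => (hFI n).const_mul _
  have hval : ∫ x, ∑ n ∈ Finset.range 10, c n * F n x =
      √(2 * Real.pi / w₂) * (1 + ε ^ 2 * laplaceCoeff p a) := by
    rw [integral_finsetSum _ fun n _ => (hFI n).const_mul _]
    simp only [integral_const_mul]
    have i0 : ∫ x, F 0 x = √(2 * Real.pi / w₂) := by
      rw [show Real.pi / (w₂ / 2) = 2 * Real.pi / w₂ by field_simp] at hm0
      simpa [hF] using hm0
    have i3 : ∫ x, F 3 x = 0 := by rw [hF]; exact hodd 1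
    have i5 : ∫ x, F 5 x = 0 := by rw [hF]; exact hodd 2
    have i7 : ∫ x, F 7 x = 0 := by rw [hF]; exact hodd 3
    have i9 : ∫ x, F 9 x = 0 := by rw [hF]; exact hodd 4
    have i4 : ∫ x, F 4 x = 3 / w₂ ^ 2 * √(2 * Real.pi / w₂) := by rw [hF]; exact hm4
    have i6 : ∫ x, F 6 x = 15 / w₂ ^ 3 * √(2 * Real.pi / w₂) := by rw [hF]; exact hm6
    set S := √(2 * Real.pi / w₂)
    simp only [Finset.sum_range_succ, Finset.sum_range_zero, i0, i3, i4, i5, i6, i7, i9, hc']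
    norm_num
    rw [laplaceCoeff, ← hw₂, ← hw₃, ← hw₄]
    field_simp
    ring
  rw [← hval, ← integral_sub (h.integrable_exp_neg_tangentExcess ha hε hε1) hint]
  have hG := integrable_one_add_abs_pow_mul_exp hc 28
  rw [← Real.norm_eq_abs]
  calc _ ≤ ∫ x, ε ^ 4 * (C * ((1 + |x|) ^ 28 * Real.exp (-(m / 2 * min 1 δ) * |x|))) := by
        refine norm_integral_le_of_norm_le ((hG.const_mul C).const_mul (ε ^ 4)) ?_
        refine ae_of_all _ fun x => ?_
        refine (le_of_eq ?_).trans (hC a ha ε hε hε1 x)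
        rw [Real.norm_eq_abs]
        congr 2
        simp only [Finset.sum_range_succ, Finset.sum_range_zero, hc', hF]
        norm_num
        ring
    _ = _ := by rw [integral_const_mul, integral_const_mul]; ring

end IsConvexProfile

/-- The `s`-th radial moment of the weight `exp (-M p)` in the logarithmic variable. -/
noncomputable def radialMoment (p : ℝ → ℝ) (M s : ℝ) : ℝ :=
  2 * ∫ u, Real.exp (-(M * (p u - 2 * s * u)))

/-! ### Logarithms of the radial moments; the saddle point as a function of `s` -/

namespace IsConvexProfile

variable {p : ℝ → ℝ} {u₀ u₁ δ m : ℝ}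

theorem mem_enlarged (h : IsConvexProfile p u₀ u₁ δ m) {a : ℝ} (ha : a ∈ Set.Icc u₀ u₁) :
    a ∈ Set.Icc (u₀ - δ) (u₁ + δ) :=
  ⟨by linarith [ha.1, h.δ_pos], by linarith [ha.2, h.δ_pos]⟩

theorem exp_neg_eq_tangentExcess {a s M : ℝ} (has : iteratedDeriv 1 p a = 2 * s) (u : ℝ) :
    Real.exp (-(M * (p u - 2 * s * u))) =
      Real.exp (M * (2 * s * a - p a)) * Real.exp (-(M * tangentExcess p a (u - a))) := by
  rw [← Real.exp_add, tangentExcess, has]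
  ring_nf

theorem integral_exp_neg_tangentExcess {a M : ℝ} (hM : 0 < M) :
    ∫ t, Real.exp (-(M * tangentExcess p a t)) =
      (√M)⁻¹ * ∫ x, Real.exp (-(tangentExcess p a ((√M)⁻¹ * x) / (√M)⁻¹ ^ 2)) := by
  have h := Measure.integral_comp_mul_left
    (fun t => Real.exp (-(M * tangentExcess p a t))) (√M)⁻¹
  have e : ∀ t : ℝ, t / (√M)⁻¹ ^ 2 = M * t := fun t => by
    rw [inv_pow, Real.sq_sqrt hM.le, div_inv_eq_mul, mul_comm]
  have hs : 0 < √M := Real.sqrt_pos.2 hM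
  simp only [e]
  rw [h, smul_eq_mul, inv_inv, abs_of_pos hs, inv_mul_cancel_left₀ hs.ne']

theorem integrable_radialMoment (h : IsConvexProfile p u₀ u₁ δ m) {a s M : ℝ}
    (ha : a ∈ Set.Icc u₀ u₁) (has : iteratedDeriv 1 p a = 2 * s) (hM : 1 ≤ M) :
    Integrable fun u => Real.exp (-(M * (p u - 2 * s * u))) := by
  have hM0 : 0 < M := by linarith
  have hs : 0 < √M := Real.sqrt_pos.2 hM0
  have hs1 : (√M)⁻¹ ≤ 1 := inv_le_one_of_one_le₀ (Real.one_le_sqrt.2 hM)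
  have h1 := h.integrable_exp_neg_tangentExcess ha (inv_pos.2 hs) hs1
  have e : ∀ t : ℝ, t / (√M)⁻¹ ^ 2 = M * t := fun t => by
    rw [inv_pow, Real.sq_sqrt hM0.le, div_inv_eq_mul, mul_comm]
  simp only [e] at h1
  have h2 := (integrable_comp_mul_left_iff
    (fun t => Real.exp (-(M * tangentExcess p a t))) (inv_ne_zero hs.ne')).1 h1
  have h3 := (h2.comp_sub_right a).const_mul (Real.exp (M * (2 * s * a - p a)))
  refine h3.congr (ae_of_all _ fun u => ?_)
  exact (exp_neg_eq_tangentExcess has u).symm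

theorem radialMoment_pos (h : IsConvexProfile p u₀ u₁ δ m) {a s M : ℝ}
    (ha : a ∈ Set.Icc u₀ u₁) (has : iteratedDeriv 1 p a = 2 * s) (hM : 1 ≤ M) :
    0 < radialMoment p M s := by
  refine mul_pos two_pos ?_
  rw [integral_pos_iff_support_of_nonneg (fun _ => (Real.exp_pos _).le)
    (h.integrable_radialMoment ha has hM)]
  have : (Function.support fun u => Real.exp (-(M * (p u - 2 * s * u)))) = Set.univ :=
    Set.eq_univ_of_forall fun u => (Real.exp_pos _).ne'
  rw [this]
  simp

theorem continuousOn_laplaceCoeff (h : IsConvexProfile p u₀ u₁ δ m) :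
    ContinuousOn (laplaceCoeff p) (Set.Icc (u₀ - δ) (u₁ + δ)) := by
  have hpos : ∀ u ∈ Set.Icc (u₀ - δ) (u₁ + δ), 0 < iteratedDeriv 2 p u :=
    fun u hu => h.m_pos.trans_le (h.strict u hu)
  have h2 := h.continuous 2
  have h3 := h.continuous 3
  have h4 := h.continuous 4
  unfold laplaceCoeff
  refine ContinuousOn.sub (ContinuousOn.div (by fun_prop) (by fun_prop) ?_)
    (ContinuousOn.div (by fun_prop) (by fun_prop) ?_)
  · intro u hu; have := hpos u hu; positivity
  · intro u hu; have := hpos u hu; positivity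

/-- Rescaling by `ε = M ^ (-1/2)` gives the moment as its leading term times `1 + z` with `z = b / M
+ O(M⁻²)`, and `log (1 + z) = z + O(z²)`. The upper bound on `p''` keeps the Gaussian factor away
from zero, so the relative error is uniform in `a`. -/
theorem exists_log_radialMoment (h : IsConvexProfile p u₀ u₁ δ m) :
    ∃ C M₀, 1 ≤ M₀ ∧ ∀ M ≥ M₀, ∀ s, ∀ a ∈ Set.Icc u₀ u₁, iteratedDeriv 1 p a = 2 * s →
      |Real.log (radialMoment p M s) - (Real.log 2 + M * (2 * s * a - p a)
        + Real.log (2 * Real.pi / M) / 2 - Real.log (iteratedDeriv 2 p a) / 2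
        + laplaceCoeff p a / M)| ≤ C / M ^ 2 := by
  obtain ⟨C₀, hC₀⟩ := h.exists_laplace
  obtain ⟨K, hK1, hK⟩ := h.exists_bound
  obtain ⟨B, hB⟩ := isCompact_Icc.exists_bound_of_continuousOn h.continuousOn_laplaceCoeff
  set σ := √(2 * Real.pi / K) with hσ
  have hσ0 : 0 < σ := by positivity
  set C₁ := |C₀| / σ with hC₁
  set T := |B| + C₁ with hT
  have hC₁0 : 0 ≤ C₁ := by positivity
  have hT0 : 0 ≤ T := by positivity
  -- `M ≥ 2 T` forces `|z| ≤ T / M ≤ 1/2`, where the quadratic bound for the logarithm holds.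
  refine ⟨C₁ + 2 * T ^ 2, max 1 (2 * T), le_max_left _ _, fun M hM s a ha has => ?_⟩
  have hM1 : 1 ≤ M := (le_max_left _ _).trans hM
  have hM2 : 2 * T ≤ M := (le_max_right _ _).trans hM
  have hM0 : 0 < M := by linarith
  have haδ := h.mem_enlarged ha
  have hw : 0 < iteratedDeriv 2 p a := h.m_pos.trans_le (h.strict a haδ)
  have hs : 0 < √M := Real.sqrt_pos.2 hM0
  have hs1 : (√M)⁻¹ ≤ 1 := inv_le_one_of_one_le₀ (Real.one_le_sqrt.2 hM1)
  have key := hC₀ a ha (√M)⁻¹ (inv_pos.2 hs) hs1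
  have he2 : (√M)⁻¹ ^ 2 = M⁻¹ := by rw [inv_pow, Real.sq_sqrt hM0.le]
  have he4 : (√M)⁻¹ ^ 4 = M⁻¹ ^ 2 := by rw [← he2]; ring
  set I := ∫ x, Real.exp (-(tangentExcess p a ((√M)⁻¹ * x) / (√M)⁻¹ ^ 2)) with hI
  rw [he2, he4] at key
  set S := √(2 * Real.pi / iteratedDeriv 2 p a) with hS
  have hS0 : 0 < S := by positivity
  have hσS : σ ≤ S := by
    rw [hσ, hS]
    have := (le_abs_self _).trans (hK 2 (by norm_num) a haδ)
    gcongr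
  set b := laplaceCoeff p a with hb
  have hbB : |b| ≤ |B| := (hB a haδ).trans (le_abs_self B)
  set z := I / S - 1 with hz
  set ρ := z - b / M with hρ
  have hρb : |ρ| ≤ C₁ / M ^ 2 := by
    have e : ρ = (I - S * (1 + M⁻¹ * b)) / S := by
      rw [hρ, hz]; field_simp; ring
    rw [e, abs_div, abs_of_pos hS0, div_le_iff₀ hS0]
    calc _ ≤ C₀ * M⁻¹ ^ 2 := key
      _ ≤ |C₀| * M⁻¹ ^ 2 := by gcongr; exact le_abs_self _
      _ = C₁ / M ^ 2 * σ := by rw [hC₁]; field_simp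
      _ ≤ C₁ / M ^ 2 * S := by gcongr
  have hzb : |z| ≤ T / M := by
    have e : z = b / M + ρ := by rw [hρ]; ring
    rw [e]
    refine (abs_add_le _ _).trans ?_
    have h1 : |b / M| ≤ |B| / M := by rw [abs_div, abs_of_pos hM0]; gcongr
    have h2 : C₁ / M ^ 2 ≤ C₁ / M := by
      gcongr
      nlinarith
    rw [hT, add_div]
    linarith
  have hz2 : |z| ≤ 1 / 2 := hzb.trans (by rw [div_le_iff₀ hM0]; linarith)
  have hlog : |Real.log (1 + z) - z| ≤ 2 * z ^ 2 := by
    have := Real.abs_log_sub_add_sum_range_le (x := -z) (by rw [abs_neg]; linarith) 1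
    simp at this
    rw [show Real.log (1 + z) - z = -z + Real.log (1 + z) by ring]
    refine this.trans ?_
    rw [div_le_iff₀ (by linarith)]
    nlinarith [sq_nonneg z]
  have hIS : I = S * (1 + z) := by rw [hz]; field_simp; ring
  have h1z : 0 < 1 + z := by linarith [neg_le_of_abs_le hz2]
  have hmoment : radialMoment p M s =
      2 * (Real.exp (M * (2 * s * a - p a)) * ((√M)⁻¹ * (S * (1 + z)))) := by
    rw [radialMoment]
    simp only [exp_neg_eq_tangentExcess has]
    rw [integral_const_mul, integral_sub_right_eq_self
      (fun u => Real.exp (-(M * tangentExcess p a u))) a, integral_exp_neg_tangentExcess hM0,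
      ← hI, hIS]
  have hlogm : Real.log (radialMoment p M s) = Real.log 2 + M * (2 * s * a - p a)
        + Real.log (2 * Real.pi / M) / 2 - Real.log (iteratedDeriv 2 p a) / 2
        + Real.log (1 + z) := by
    rw [hmoment, Real.log_mul (by positivity) (by positivity),
      Real.log_mul (by positivity) (by positivity), Real.log_mul (by positivity) (by positivity),
      Real.log_mul (by positivity) (by positivity), Real.log_exp, Real.log_inv,
      Real.log_sqrt hM0.le, hS, Real.log_sqrt (by positivity), Real.log_div (by positivity) hw.ne',
      Real.log_div (by positivity) hM0.ne']
    ring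
  rw [hlogm, add_sub_add_left_eq_sub]
  have e : Real.log (1 + z) - b / M = (Real.log (1 + z) - z) + ρ := by rw [hρ]; ring
  rw [e]
  refine (abs_add_le _ _).trans ?_
  have hz3 : z ^ 2 ≤ T ^ 2 / M ^ 2 := by
    rw [← div_pow, ← sq_abs]
    gcongr
  rw [add_div, mul_div_assoc]
  linarith

/-- On the enlarged interval `p'` expands distances by at least `m`, so its inverse is Lipschitz.
Inverting on an interval larger than `[0, 1]` makes `ψ` differentiable from both sides at `0` and
`1`. -/
theorem exists_saddle (h : IsConvexProfile p u₀ u₁ δ m) : ∃ ψ : ℝ → ℝ, Continuous ψ ∧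
    (∀ s, ψ s ∈ Set.Icc (u₀ - δ) (u₁ + δ)) ∧
    (∀ s ∈ Set.Icc (0 : ℝ) 1, iteratedDeriv 1 p (ψ s) = 2 * s) ∧
    (∀ s ∈ Set.Icc (0 : ℝ) 1, HasDerivAt ψ (2 / iteratedDeriv 2 p (ψ s)) s) ∧
    (∀ s ∈ Set.Icc (0 : ℝ) 1, ψ s ∈ Set.Icc u₀ u₁) ∧ ψ 0 = u₀ ∧ ψ 1 = u₁ := by
  have hδ := h.δ_pos
  have hm := h.m_pos
  have hlt := h.lt
  set J := Set.Icc (u₀ - δ) (u₁ + δ) with hJ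
  have hexp : ∀ x ∈ J, ∀ y ∈ J, x ≤ y →
      m * (y - x) ≤ iteratedDeriv 1 p y - iteratedDeriv 1 p x := by
    refine (convex_Icc _ _).mul_sub_le_image_sub_of_le_deriv (h.continuous 1).continuousOn
      (fun x _ => (h.hasDerivAt 1 x).differentiableAt.differentiableWithinAt) fun x hx => ?_
    rw [(h.hasDerivAt 1 x).deriv]
    exact h.strict x (interior_subset hx)
  have habs : ∀ x ∈ J, ∀ y ∈ J, m * |x - y| ≤ |iteratedDeriv 1 p x - iteratedDeriv 1 p y| := by
    intro x hx y hy
    rcases le_total x y with hxy | hxy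
    · rw [abs_sub_comm x, abs_of_nonneg (sub_nonneg.2 hxy), abs_sub_comm]
      exact (hexp x hx y hy hxy).trans (le_abs_self _)
    · rw [abs_of_nonneg (sub_nonneg.2 hxy)]
      exact (hexp y hy x hx hxy).trans (le_abs_self _)
  have hu₀ : u₀ ∈ J := ⟨by linarith, by linarith⟩
  have hu₁ : u₁ ∈ J := ⟨by linarith, by linarith⟩
  -- Over a length `δ` the derivative changes by at least `m δ = 2 η`, so `p' / 2` attains every
  -- value in `[-η, 1 + η]`.
  set η := m * δ / 2 with hη
  have hη0 : 0 < η := by positivity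
  have hlow : iteratedDeriv 1 p (u₀ - δ) ≤ 2 * (-η) := by
    have := hexp (u₀ - δ) ⟨by linarith, by linarith⟩ u₀ hu₀ (by linarith)
    rw [h.deriv_left] at this
    rw [hη]; linarith
  have hhigh : 2 * (1 + η) ≤ iteratedDeriv 1 p (u₁ + δ) := by
    have := hexp u₁ hu₁ (u₁ + δ) ⟨by linarith, by linarith⟩ (by linarith)
    rw [h.deriv_right] at this
    rw [hη]; linarith
  have hex : ∀ s : Set.Icc (-η) (1 + η), ∃ u ∈ J, iteratedDeriv 1 p u = 2 * s := by
    intro s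
    have := intermediate_value_Icc (show u₀ - δ ≤ u₁ + δ by linarith)
      (h.continuous 1).continuousOn (show 2 * (s : ℝ) ∈ Set.Icc _ _ from
        ⟨by linarith [s.2.1], by linarith [s.2.2]⟩)
    exact this
  choose φ hφJ hφ using hex
  have hηle : -η ≤ 1 + η := by linarith
  -- Clamping `s` makes `ψ` continuous on the whole line without altering it near `[0, 1]`.
  set ψ : ℝ → ℝ := fun s => φ (Set.projIcc (-η) (1 + η) hηle s) with hψ
  have hφc : Continuous φ := by
    have : LipschitzWith (Real.toNNReal (2 / m)) φ := LipschitzWith.of_dist_le_mul fun s t => by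
      have := habs _ (hφJ s) _ (hφJ t)
      rw [hφ, hφ, ← mul_sub, abs_mul, abs_of_pos (two_pos : (0:ℝ) < 2)] at this
      rw [Real.dist_eq, Subtype.dist_eq, Real.dist_eq, Real.coe_toNNReal _ (by positivity),
        div_mul_eq_mul_div, le_div_iff₀ hm]
      linarith
    exact this.continuous
  have hψc : Continuous ψ := hφc.comp continuous_projIcc
  have hψeq : ∀ s ∈ Set.Icc (-η) (1 + η), iteratedDeriv 1 p (ψ s) = 2 * s := by
    intro s hs
    simp only [hψ]
    rw [hφ, Set.projIcc_of_mem hηle hs]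
  have hψJ : ∀ s, ψ s ∈ J := fun s => hφJ _
  have hinj : ∀ x ∈ J, ∀ y ∈ J, iteratedDeriv 1 p x = iteratedDeriv 1 p y → x = y := by
    intro x hx y hy hxy
    have := habs x hx y hy
    rw [hxy, sub_self, abs_zero] at this
    have h1 : |x - y| ≤ 0 := by
      by_contra! h2
      have := mul_pos hm h2
      linarith
    exact sub_eq_zero.1 (abs_nonpos_iff.1 h1)
  have hunit : Set.Icc (0:ℝ) 1 ⊆ Set.Icc (-η) (1 + η) :=
    Set.Icc_subset_Icc (by linarith) (by linarith)
  refine ⟨ψ, hψc, hψJ, fun s hs => hψeq s (hunit hs), ?_, ?_, ?_, ?_⟩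
  · intro s hs
    have hpos : 0 < iteratedDeriv 2 p (ψ s) := hm.trans_le (h.strict _ (hψJ s))
    have := HasDerivAt.of_local_left_inverse (f := fun u => iteratedDeriv 1 p u / 2) (g := ψ)
      (f' := iteratedDeriv 2 p (ψ s) / 2) (a := s) hψc.continuousAt
      ((h.hasDerivAt 1 (ψ s)).div_const 2) (by positivity) ?_
    · rwa [inv_div] at this
    · filter_upwards [Ioo_mem_nhds (show -η < s by linarith [hs.1])
        (show s < 1 + η by linarith [hs.2])] with t ht
      rw [hψeq t ⟨ht.1.le, ht.2.le⟩]
      ring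
  · intro s hs
    constructor
    · by_contra! hlt'
      have := hexp _ (hψJ s) _ hu₀ hlt'.le
      rw [h.deriv_left, hψeq s (hunit hs)] at this
      have h2 := mul_pos hm (sub_pos.2 hlt')
      linarith [hs.1]
    · by_contra! hlt'
      have := hexp _ hu₁ _ (hψJ s) hlt'.le
      rw [h.deriv_right, hψeq s (hunit hs)] at this
      have h2 := mul_pos hm (sub_pos.2 hlt')
      linarith [hs.2]
  · refine hinj _ (hψJ 0) _ hu₀ ?_
    rw [hψeq 0 (hunit ⟨le_rfl, zero_le_one⟩), h.deriv_left, mul_zero]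
  · refine hinj _ (hψJ 1) _ hu₁ ?_
    rw [hψeq 1 (hunit ⟨zero_le_one, le_rfl⟩), h.deriv_right, mul_one]

end IsConvexProfile

/-! ### Euler–Maclaurin summation -/

theorem grid_mem {N k : ℕ} (hk : k < N) :
    ((k : ℝ) / N ∈ Set.Icc (0 : ℝ) 1) ∧ (((k : ℝ) + 1) / N ∈ Set.Icc (0 : ℝ) 1) := by
  have hN : (0 : ℝ) < N := by exact_mod_cast (Nat.zero_le k).trans_lt hk
  have h1 : (k : ℝ) + 1 ≤ N := by exact_mod_cast hk
  refine ⟨⟨by positivity, ?_⟩, ⟨by positivity, ?_⟩⟩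
  · rw [div_le_one hN]; linarith
  · rw [div_le_one hN]; exact h1

theorem abs_sum_le_of_abs_le {N : ℕ} {e : ℕ → ℝ} {B : ℝ} (he : ∀ k < N, |e k| ≤ B) :
    |∑ k ∈ Finset.range N, e k| ≤ N * B := by
  refine (Finset.abs_sum_le_sum_abs _ _).trans ?_
  refine (Finset.sum_le_card_nsmul _ _ B fun k hk => he k (Finset.mem_range.1 hk)).trans ?_
  simp

theorem sum_grid_telescope (F : ℝ → ℝ) {N : ℕ} (hN : 0 < N) :
    ∑ k ∈ Finset.range N, (F (((k : ℝ) + 1) / N) - F ((k : ℝ) / N)) = F 1 - F 0 := by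
  have := Finset.sum_range_sub (fun k : ℕ => F ((k : ℝ) / N)) N
  have hN' : (N : ℝ) ≠ 0 := by positivity
  simpa [hN'] using this

theorem taylor_on_grid {g : ℕ → ℝ → ℝ} {n : ℕ} {K : ℝ}
    (hg : ∀ k < n, ∀ x ∈ Set.Icc (0 : ℝ) 1, HasDerivAt (g k) (g (k + 1) x) x)
    (hK : ∀ x ∈ Set.Icc (0 : ℝ) 1, |g n x| ≤ K) {N k : ℕ} (hk : k < N) {j r : ℕ} (hj : j + r = n) :
    |g j (((k : ℝ) + 1) / N) - ∑ i ∈ Finset.range r,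
      g (j + i) ((k : ℝ) / N) * ((1 / (N : ℝ)) ^ i / (i.factorial : ℝ))| ≤ K * (1 / (N : ℝ)) ^ r := by
  obtain ⟨h0, h1⟩ := grid_mem hk
  have := abs_sub_taylor_le (convex_Icc (0 : ℝ) 1) h0 r (fun i => g (j + i))
    (fun i hi x hx => hg (j + i) (by omega) x hx) (by simpa only [hj] using hK) _ h1
  have e : ((k : ℝ) + 1) / N - (k : ℝ) / N = 1 / N := by ring
  rw [e, abs_of_nonneg (by positivity : (0 : ℝ) ≤ 1 / N)] at this
  simpa using this

/-- Right Riemann sums. -/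
theorem abs_riemann_sum_sub_le {g : ℕ → ℝ → ℝ} {K : ℝ}
    (hg : ∀ k < 2, ∀ x ∈ Set.Icc (0 : ℝ) 1, HasDerivAt (g k) (g (k + 1) x) x)
    (hK : ∀ x ∈ Set.Icc (0 : ℝ) 1, |g 2 x| ≤ K) {N : ℕ} (hN : 0 < N) :
    |∑ k ∈ Finset.range N, g 1 (((k : ℝ) + 1) / N) - N * (g 0 1 - g 0 0)| ≤ 2 * K := by
  have hN' : (0 : ℝ) < N := by exact_mod_cast hN
  have hK0 : 0 ≤ K := (abs_nonneg _).trans (hK 0 ⟨le_rfl, zero_le_one⟩)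
  have h := abs_sum_le_of_abs_le (N := N) (B := 2 * K / N)
    (e := fun k => g 1 (((k : ℝ) + 1) / N) - N * (g 0 (((k : ℝ) + 1) / N) - g 0 ((k : ℝ) / N))) ?_
  · rw [Finset.sum_sub_distrib, ← Finset.mul_sum, sum_grid_telescope _ hN] at h
    refine h.trans (le_of_eq ?_)
    field_simp
  · intro k hk
    have t0 := taylor_on_grid hg hK hk (j := 0) (r := 2) rfl
    have t1 := taylor_on_grid hg hK hk (j := 1) (r := 1) rfl
    simp only [Finset.sum_range_succ, Finset.sum_range_zero, Nat.factorial] at t0 t1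
    norm_num at t0 t1
    set f0 := g 0 (((k : ℝ) + 1) / N)
    set f1 := g 1 (((k : ℝ) + 1) / N)
    set a0 := g 0 ((k : ℝ) / N)
    set a1 := g 1 ((k : ℝ) / N)
    have e : f1 - N * (f0 - a0) = (f1 - a1) - N * (f0 - (a0 + a1 * (N : ℝ)⁻¹)) := by
      field_simp; ring
    rw [e]
    refine (abs_sub _ _).trans ?_
    rw [abs_mul, abs_of_pos hN']
    have : (N : ℝ) * |f0 - (a0 + a1 * (N : ℝ)⁻¹)| ≤ N * (K * ((N : ℝ) ^ 2)⁻¹) := by gcongr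
    have e2 : (N : ℝ) * (K * ((N : ℝ) ^ 2)⁻¹) = K * (N : ℝ)⁻¹ := by field_simp
    rw [e2] at this
    calc _ ≤ K * (N : ℝ)⁻¹ + K * (N : ℝ)⁻¹ := add_le_add t1 this
      _ = _ := by ring

/-- The trapezoidal rule. -/
theorem abs_trapezoid_sum_sub_le {g : ℕ → ℝ → ℝ} {K : ℝ}
    (hg : ∀ k < 3, ∀ x ∈ Set.Icc (0 : ℝ) 1, HasDerivAt (g k) (g (k + 1) x) x)
    (hK : ∀ x ∈ Set.Icc (0 : ℝ) 1, |g 3 x| ≤ K) {N : ℕ} (hN : 0 < N) :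
    |∑ k ∈ Finset.range N, g 1 (((k : ℝ) + 1) / N)
      - (N * (g 0 1 - g 0 0) + (g 1 1 - g 1 0) / 2)| ≤ 2 * K / N := by
  have hN' : (0 : ℝ) < N := by exact_mod_cast hN
  have hK0 : 0 ≤ K := (abs_nonneg _).trans (hK 0 ⟨le_rfl, zero_le_one⟩)
  have h := abs_sum_le_of_abs_le (N := N) (B := 2 * K / N ^ 2)
    (e := fun k => g 1 (((k : ℝ) + 1) / N) - (N * (g 0 (((k : ℝ) + 1) / N) - g 0 ((k : ℝ) / N))
      + 1 / 2 * (g 1 (((k : ℝ) + 1) / N) - g 1 ((k : ℝ) / N)))) ?_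
  · rw [Finset.sum_sub_distrib, Finset.sum_add_distrib, ← Finset.mul_sum, ← Finset.mul_sum,
      sum_grid_telescope _ hN, sum_grid_telescope _ hN] at h
    refine le_trans (le_of_eq ?_) (h.trans (le_of_eq ?_))
    · congr 1; ring
    · field_simp
  · intro k hk
    have t0 := taylor_on_grid hg hK hk (j := 0) (r := 3) rfl
    have t1 := taylor_on_grid hg hK hk (j := 1) (r := 2) rfl
    simp only [Finset.sum_range_succ, Finset.sum_range_zero, Nat.factorial] at t0 t1
    norm_num at t0 t1
    set f0 := g 0 (((k : ℝ) + 1) / N)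
    set f1 := g 1 (((k : ℝ) + 1) / N)
    set a0 := g 0 ((k : ℝ) / N)
    set a1 := g 1 ((k : ℝ) / N)
    set a2 := g 2 ((k : ℝ) / N)
    have e : f1 - (N * (f0 - a0) + 1 / 2 * (f1 - a1)) = 1 / 2 * (f1 - (a1 + a2 * (N : ℝ)⁻¹))
        - N * (f0 - (a0 + a1 * (N : ℝ)⁻¹ + a2 * (((N : ℝ) ^ 2)⁻¹ / 2))) := by
      field_simp; ring
    rw [e]
    refine (abs_sub _ _).trans ?_
    rw [abs_mul, abs_mul, abs_of_pos hN', abs_of_pos (by norm_num : (0:ℝ) < 1 / 2)]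
    have h0 := mul_le_mul_of_nonneg_left t0 hN'.le
    have h1 := mul_le_mul_of_nonneg_left t1 (by norm_num : (0:ℝ) ≤ 1 / 2)
    have e0 : (N : ℝ) * (K * ((N : ℝ) ^ 3)⁻¹) = K / N ^ 2 := by field_simp
    have e1 : 1 / 2 * (K * ((N : ℝ) ^ 2)⁻¹) = 1 / 2 * (K / N ^ 2) := by field_simp
    have e2 : 2 * K / (N : ℝ) ^ 2 = 2 * (K / N ^ 2) := by ring
    have h3 : 0 ≤ K / (N : ℝ) ^ 2 := by positivity
    rw [e0] at h0
    rw [e1] at h1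
    rw [e2]
    linarith

/-- Euler–Maclaurin summation with one correction term. -/
theorem abs_eulerMaclaurin_sum_sub_le {g : ℕ → ℝ → ℝ} {K : ℝ}
    (hg : ∀ k < 4, ∀ x ∈ Set.Icc (0 : ℝ) 1, HasDerivAt (g k) (g (k + 1) x) x)
    (hK : ∀ x ∈ Set.Icc (0 : ℝ) 1, |g 4 x| ≤ K) {N : ℕ} (hN : 0 < N) :
    |∑ k ∈ Finset.range N, g 1 (((k : ℝ) + 1) / N)
      - (N * (g 0 1 - g 0 0) + (g 1 1 - g 1 0) / 2 + (g 2 1 - g 2 0) / (12 * N))|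
        ≤ 2 * K / N ^ 2 := by
  have hN' : (0 : ℝ) < N := by exact_mod_cast hN
  have hK0 : 0 ≤ K := (abs_nonneg _).trans (hK 0 ⟨le_rfl, zero_le_one⟩)
  have h := abs_sum_le_of_abs_le (N := N) (B := 2 * K / N ^ 3)
    (e := fun k => g 1 (((k : ℝ) + 1) / N) - (N * (g 0 (((k : ℝ) + 1) / N) - g 0 ((k : ℝ) / N))
      + 1 / 2 * (g 1 (((k : ℝ) + 1) / N) - g 1 ((k : ℝ) / N))
      + 1 / (12 * N) * (g 2 (((k : ℝ) + 1) / N) - g 2 ((k : ℝ) / N)))) ?_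
  · rw [Finset.sum_sub_distrib, Finset.sum_add_distrib, Finset.sum_add_distrib, ← Finset.mul_sum,
      ← Finset.mul_sum, ← Finset.mul_sum, sum_grid_telescope _ hN, sum_grid_telescope _ hN,
      sum_grid_telescope _ hN] at h
    refine le_trans (le_of_eq ?_) (h.trans (le_of_eq ?_))
    · congr 1; ring
    · field_simp
  · intro k hk
    have t0 := taylor_on_grid hg hK hk (j := 0) (r := 4) rfl
    have t1 := taylor_on_grid hg hK hk (j := 1) (r := 3) rfl
    have t2 := taylor_on_grid hg hK hk (j := 2) (r := 2) rfl
    simp only [Finset.sum_range_succ, Finset.sum_range_zero, Nat.factorial] at t0 t1 t2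
    norm_num at t0 t1 t2
    set f0 := g 0 (((k : ℝ) + 1) / N)
    set f1 := g 1 (((k : ℝ) + 1) / N)
    set f2 := g 2 (((k : ℝ) + 1) / N)
    set a0 := g 0 ((k : ℝ) / N)
    set a1 := g 1 ((k : ℝ) / N)
    set a2 := g 2 ((k : ℝ) / N)
    set a3 := g 3 ((k : ℝ) / N)
    -- The weights `1/2` and `1/12` make every Taylor term through `a3` cancel, leaving three
    -- remainders with total weight `1 + 1/2 + 1/12 ≤ 2`.
    have e : f1 - (N * (f0 - a0) + 1 / 2 * (f1 - a1) + 1 / (12 * N) * (f2 - a2))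
        = 1 / 2 * (f1 - (a1 + a2 * (N : ℝ)⁻¹ + a3 * (((N : ℝ) ^ 2)⁻¹ / 2)))
        - N * (f0 - (a0 + a1 * (N : ℝ)⁻¹ + a2 * (((N : ℝ) ^ 2)⁻¹ / 2) + a3 * (((N : ℝ) ^ 3)⁻¹ / 6)))
        - 1 / (12 * N) * (f2 - (a2 + a3 * (N : ℝ)⁻¹)) := by
      field_simp; ring
    rw [e]
    refine (abs_sub _ _).trans ?_
    refine (add_le_add_left (abs_sub _ _) _).trans ?_
    rw [abs_mul, abs_mul, abs_mul, abs_of_pos hN', abs_of_pos (by norm_num : (0:ℝ) < 1 / 2),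
      abs_of_pos (by positivity : (0:ℝ) < 1 / (12 * N))]
    have h0 := mul_le_mul_of_nonneg_left t0 hN'.le
    have h1 := mul_le_mul_of_nonneg_left t1 (by norm_num : (0:ℝ) ≤ 1 / 2)
    have h2 := mul_le_mul_of_nonneg_left t2 (by positivity : (0:ℝ) ≤ 1 / (12 * N))
    have e0 : (N : ℝ) * (K * ((N : ℝ) ^ 4)⁻¹) = K / N ^ 3 := by field_simp
    have e1 : 1 / 2 * (K * ((N : ℝ) ^ 3)⁻¹) = 1 / 2 * (K / N ^ 3) := by field_simp
    have e2 : 1 / (12 * (N : ℝ)) * (K * ((N : ℝ) ^ 2)⁻¹) = 1 / 12 * (K / N ^ 3) := by field_simp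
    have e3 : 2 * K / (N : ℝ) ^ 3 = 2 * (K / N ^ 3) := by ring
    have h3 : 0 ≤ K / (N : ℝ) ^ 3 := by positivity
    rw [e0] at h0
    rw [e1] at h1
    rw [e2] at h2
    rw [e3]
    linarith


/-- `ψ` parametrizes the points at which the derivative of `p` equals `2 s`, `0 ≤ s ≤ 1`. -/
structure IsSaddle (p : ℝ → ℝ) (u₀ u₁ δ : ℝ) (ψ : ℝ → ℝ) : Prop where
  continuous : Continuous ψ
  mem_enlarged : ∀ s, ψ s ∈ Set.Icc (u₀ - δ) (u₁ + δ)
  deriv_eq : ∀ s ∈ Set.Icc (0 : ℝ) 1, iteratedDeriv 1 p (ψ s) = 2 * s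
  hasDerivAt : ∀ s ∈ Set.Icc (0 : ℝ) 1, HasDerivAt ψ (2 / iteratedDeriv 2 p (ψ s)) s
  mem : ∀ s ∈ Set.Icc (0 : ℝ) 1, ψ s ∈ Set.Icc u₀ u₁
  left : ψ 0 = u₀
  right : ψ 1 = u₁

theorem IsConvexProfile.exists_isSaddle {p : ℝ → ℝ} {u₀ u₁ δ m : ℝ}
    (h : IsConvexProfile p u₀ u₁ δ m) : ∃ ψ, IsSaddle p u₀ u₁ δ ψ := by
  obtain ⟨ψ, h1, h2, h3, h4, h5, h6, h7⟩ := h.exists_saddle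
  exact ⟨ψ, ⟨h1, h2, h3, h4, h5, h6, h7⟩⟩

/-- The Legendre transform of `p` at `2 s`. -/
noncomputable def legendre (p ψ : ℝ → ℝ) (s : ℝ) : ℝ := 2 * s * ψ s - p (ψ s)

/-! ### Sums over the grid along the saddle -/

namespace IsSaddle

variable {p : ℝ → ℝ} {u₀ u₁ δ m : ℝ} {ψ : ℝ → ℝ}

theorem deriv_pos (hψ : IsSaddle p u₀ u₁ δ ψ) (h : IsConvexProfile p u₀ u₁ δ m) (s : ℝ) :
    0 < iteratedDeriv 2 p (ψ s) := h.m_pos.trans_le (h.strict _ (hψ.mem_enlarged s))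

theorem continuous_comp (hψ : IsSaddle p u₀ u₁ δ ψ) (h : IsConvexProfile p u₀ u₁ δ m) (k : ℕ) :
    Continuous fun s => iteratedDeriv k p (ψ s) := (h.continuous k).comp hψ.continuous

theorem hasDerivAt_comp (hψ : IsSaddle p u₀ u₁ δ ψ) (h : IsConvexProfile p u₀ u₁ δ m) (k : ℕ)
    {s : ℝ} (hs : s ∈ Set.Icc (0 : ℝ) 1) :
    HasDerivAt (fun s => iteratedDeriv k p (ψ s))
      (iteratedDeriv (k + 1) p (ψ s) * (2 / iteratedDeriv 2 p (ψ s))) s :=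
  (h.hasDerivAt k (ψ s)).comp s (hψ.hasDerivAt s hs)

theorem continuous_legendre (hψ : IsSaddle p u₀ u₁ δ ψ) (h : IsConvexProfile p u₀ u₁ δ m) :
    Continuous (legendre p ψ) := by
  have h1 := hψ.continuous
  have h2 : Continuous fun s => p (ψ s) := by simpa using hψ.continuous_comp h 0
  exact (by fun_prop : Continuous fun s => 2 * s * ψ s).sub h2

/-- Envelope theorem: `ψ s` is a critical point of `2 s u - p u`, so the terms with `ψ'` cancel. -/
theorem hasDerivAt_legendre (hψ : IsSaddle p u₀ u₁ δ ψ) (h : IsConvexProfile p u₀ u₁ δ m)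
    {s : ℝ} (hs : s ∈ Set.Icc (0 : ℝ) 1) : HasDerivAt (legendre p ψ) (2 * ψ s) s := by
  have h1 := hψ.hasDerivAt s hs
  have h2 := (h.hasDerivAt_self (ψ s)).comp s h1
  have h3 := (((hasDerivAt_id s).const_mul 2).mul h1).sub h2
  refine h3.congr_deriv ?_
  rw [hψ.deriv_eq s hs]
  simp only [id]
  ring

theorem legendre_one_sub_legendre_zero (hψ : IsSaddle p u₀ u₁ δ ψ)
    (h : IsConvexProfile p u₀ u₁ δ m) :
    legendre p ψ 1 - legendre p ψ 0 = 2 * ∫ s in (0 : ℝ)..1, ψ s := by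
  rw [← intervalIntegral.integral_const_mul]
  refine (intervalIntegral.integral_eq_sub_of_hasDerivAt (fun s hs => ?_) ?_).symm
  · rw [Set.uIcc_of_le zero_le_one] at hs
    exact hψ.hasDerivAt_legendre h hs
  · exact (hψ.continuous.const_mul 2).intervalIntegrable _ _

/-- This sum is later multiplied by `c N`, so it is needed up to `O(N⁻²)`, hence with the first
Euler–Maclaurin correction. The sums of `log p''` and of `laplaceCoeff` carry the factors `1/2` and
`(c N)⁻¹` and need one and two orders less. -/
theorem exists_legendre_sum (hψ : IsSaddle p u₀ u₁ δ ψ) (h : IsConvexProfile p u₀ u₁ δ m) :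
    ∃ K, ∀ N : ℕ, 0 < N → |∑ k ∈ Finset.range N, legendre p ψ (((k : ℝ) + 1) / N)
      - (N * (∫ s in (0 : ℝ)..1, legendre p ψ s) + (∫ s in (0 : ℝ)..1, ψ s)
        + (u₁ - u₀) / (6 * N))| ≤ K / N ^ 2 := by
  have hpos := hψ.deriv_pos h
  have hc2 := hψ.continuous_comp h 2
  have hc3 := hψ.continuous_comp h 3
  have hcg : Continuous fun s => -8 * iteratedDeriv 3 p (ψ s) / iteratedDeriv 2 p (ψ s) ^ 3 :=
    (hc3.const_mul (-8)).div (hc2.pow 3) fun s => (pow_pos (hpos s) 3).ne'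
  obtain ⟨K, hK⟩ := isCompact_Icc.exists_bound_of_continuousOn
    (hcg.continuousOn (s := Set.Icc (0 : ℝ) 1))
  refine ⟨2 * K, fun N hN => ?_⟩
  -- The chain of derivatives follows from `L' = 2 ψ` and `ψ' = 2 / p''(ψ)`; entry `0` is the
  -- primitive, so the summand is entry `1`.
  let g : ℕ → ℝ → ℝ := fun k => match k with
    | 0 => fun x => ∫ s in (0 : ℝ)..x, legendre p ψ s
    | 1 => legendre p ψ
    | 2 => fun s => 2 * ψ s
    | 3 => fun s => 4 / iteratedDeriv 2 p (ψ s)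
    | _ => fun s => -8 * iteratedDeriv 3 p (ψ s) / iteratedDeriv 2 p (ψ s) ^ 3
  have hg : ∀ k < 4, ∀ x ∈ Set.Icc (0 : ℝ) 1, HasDerivAt (g k) (g (k + 1) x) x := by
    intro k hk x hx
    interval_cases k
    · exact (hψ.continuous_legendre h).integral_hasStrictDerivAt 0 x |>.hasDerivAt
    · exact hψ.hasDerivAt_legendre h hx
    · refine ((hψ.hasDerivAt x hx).const_mul 2).congr_deriv ?_
      simp only [g]; ring
    · refine ((hasDerivAt_const x (4 : ℝ)).div (hψ.hasDerivAt_comp h 2 hx)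
        (hpos x).ne').congr_deriv ?_
      have := (hpos x).ne'
      simp only [g]; field_simp; ring
  have key := abs_eulerMaclaurin_sum_sub_le hg hK hN
  refine le_trans (le_of_eq ?_) key
  congr 2
  simp only [g, intervalIntegral.integral_same, hψ.legendre_one_sub_legendre_zero h, hψ.left,
    hψ.right]
  have hN' : (N : ℝ) ≠ 0 := by positivity
  field_simp
  ring

theorem exists_log_deriv_sum (hψ : IsSaddle p u₀ u₁ δ ψ) (h : IsConvexProfile p u₀ u₁ δ m) :
    ∃ K, ∀ N : ℕ, 0 < N →
      |∑ k ∈ Finset.range N, Real.log (iteratedDeriv 2 p (ψ (((k : ℝ) + 1) / N)))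
      - (N * (∫ s in (0 : ℝ)..1, Real.log (iteratedDeriv 2 p (ψ s)))
        + (Real.log (iteratedDeriv 2 p u₁) - Real.log (iteratedDeriv 2 p u₀)) / 2)| ≤ K / N := by
  have hpos := hψ.deriv_pos h
  have hc2 := hψ.continuous_comp h 2
  have hc3 := hψ.continuous_comp h 3
  have hc4 := hψ.continuous_comp h 4
  have hcg : Continuous fun s => 4 * iteratedDeriv 4 p (ψ s) / iteratedDeriv 2 p (ψ s) ^ 3
      - 8 * iteratedDeriv 3 p (ψ s) ^ 2 / iteratedDeriv 2 p (ψ s) ^ 4 :=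
    ((hc4.const_mul 4).div (hc2.pow 3) fun s => (pow_pos (hpos s) 3).ne').sub
      (((hc3.pow 2).const_mul 8).div (hc2.pow 4) fun s => (pow_pos (hpos s) 4).ne')
  obtain ⟨K, hK⟩ := isCompact_Icc.exists_bound_of_continuousOn
    (hcg.continuousOn (s := Set.Icc (0 : ℝ) 1))
  refine ⟨2 * K, fun N hN => ?_⟩
  let g : ℕ → ℝ → ℝ := fun k => match k with
    | 0 => fun x => ∫ s in (0 : ℝ)..x, Real.log (iteratedDeriv 2 p (ψ s))
    | 1 => fun s => Real.log (iteratedDeriv 2 p (ψ s))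
    | 2 => fun s => 2 * iteratedDeriv 3 p (ψ s) / iteratedDeriv 2 p (ψ s) ^ 2
    | _ => fun s => 4 * iteratedDeriv 4 p (ψ s) / iteratedDeriv 2 p (ψ s) ^ 3
      - 8 * iteratedDeriv 3 p (ψ s) ^ 2 / iteratedDeriv 2 p (ψ s) ^ 4
  have hg : ∀ k < 3, ∀ x ∈ Set.Icc (0 : ℝ) 1, HasDerivAt (g k) (g (k + 1) x) x := by
    intro k hk x hx
    have hx0 := (hpos x).ne'
    interval_cases k
    · exact (hc2.log fun s => (hpos s).ne').integral_hasStrictDerivAt 0 x |>.hasDerivAt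
    · refine ((hψ.hasDerivAt_comp h 2 hx).log hx0).congr_deriv ?_
      simp only [g]; field_simp
    · refine (((hψ.hasDerivAt_comp h 3 hx).const_mul 2).div
        ((hψ.hasDerivAt_comp h 2 hx).fun_pow 2) (pow_ne_zero 2 hx0)).congr_deriv ?_
      simp only [g]; push_cast; field_simp; ring
  have key := abs_trapezoid_sum_sub_le hg hK hN
  refine le_trans (le_of_eq ?_) key
  congr 2
  simp only [g, intervalIntegral.integral_same, hψ.left, hψ.right]
  ring

theorem exists_laplaceCoeff_sum (hψ : IsSaddle p u₀ u₁ δ ψ) (h : IsConvexProfile p u₀ u₁ δ m) :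
    ∃ K, ∀ N : ℕ, 0 < N →
      |∑ k ∈ Finset.range N, laplaceCoeff p (ψ (((k : ℝ) + 1) / N))
      - N * (∫ s in (0 : ℝ)..1, laplaceCoeff p (ψ s))| ≤ K := by
  have hpos := hψ.deriv_pos h
  have hc2 := hψ.continuous_comp h 2
  have hc3 := hψ.continuous_comp h 3
  have hc4 := hψ.continuous_comp h 4
  have hc5 := hψ.continuous_comp h 5
  let G : ℝ → ℝ := fun s =>
    5 * iteratedDeriv 3 p (ψ s) * iteratedDeriv 4 p (ψ s) / (6 * iteratedDeriv 2 p (ψ s) ^ 4)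
      - 5 * iteratedDeriv 3 p (ψ s) ^ 3 / (4 * iteratedDeriv 2 p (ψ s) ^ 5)
      - iteratedDeriv 5 p (ψ s) / (4 * iteratedDeriv 2 p (ψ s) ^ 3)
      + iteratedDeriv 3 p (ψ s) * iteratedDeriv 4 p (ψ s) / (2 * iteratedDeriv 2 p (ψ s) ^ 4)
  have hcg : Continuous G := by
    refine ((Continuous.sub (Continuous.div (by fun_prop) (by fun_prop) ?_)
      (Continuous.div (by fun_prop) (by fun_prop) ?_)).sub
      (Continuous.div (by fun_prop) (by fun_prop) ?_)).add
      (Continuous.div (by fun_prop) (by fun_prop) ?_)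
    all_goals intro s; have := hpos s; positivity
  have hcB : Continuous fun s => laplaceCoeff p (ψ s) :=
    h.continuousOn_laplaceCoeff.comp_continuous hψ.continuous hψ.mem_enlarged
  obtain ⟨K, hK⟩ := isCompact_Icc.exists_bound_of_continuousOn
    (hcg.continuousOn (s := Set.Icc (0 : ℝ) 1))
  refine ⟨2 * K, fun N hN => ?_⟩
  let g : ℕ → ℝ → ℝ := fun k => match k with
    | 0 => fun x => ∫ s in (0 : ℝ)..x, laplaceCoeff p (ψ s)
    | 1 => fun s => laplaceCoeff p (ψ s)
    | _ => G
  have hg : ∀ k < 2, ∀ x ∈ Set.Icc (0 : ℝ) 1, HasDerivAt (g k) (g (k + 1) x) x := by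
    intro k hk x hx
    have hx0 := (hpos x).ne'
    interval_cases k
    · exact hcB.integral_hasStrictDerivAt 0 x |>.hasDerivAt
    · refine (((((hψ.hasDerivAt_comp h 3 hx).fun_pow 2).const_mul 5).div
        (((hψ.hasDerivAt_comp h 2 hx).fun_pow 3).const_mul 24) (by positivity)).sub
        ((hψ.hasDerivAt_comp h 4 hx).div
        (((hψ.hasDerivAt_comp h 2 hx).fun_pow 2).const_mul 8) (by positivity))).congr_deriv ?_
      simp only [g, G]; push_cast; field_simp; ring
  have key := abs_riemann_sum_sub_le hg hK hN
  refine le_trans (le_of_eq ?_) key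
  congr 2
  simp only [g, intervalIntegral.integral_same]
  ring

/-- The parameter is `c = 1` for the normal matrix ensemble and `c = 2` for the symplectic one; the
nodes are the same. -/
theorem sum_log_radialMoment_isBigO (hψ : IsSaddle p u₀ u₁ δ ψ)
    (h : IsConvexProfile p u₀ u₁ δ m) {c : ℝ} (hc : 1 ≤ c) :
    (fun N : ℕ => ∑ k ∈ Finset.range N, Real.log (radialMoment p (c * N) (((k : ℝ) + 1) / N))
      - (N * Real.log 2 + c * N ^ 2 * (∫ s in (0 : ℝ)..1, legendre p ψ s)
        + c * N * (∫ s in (0 : ℝ)..1, ψ s) + c / 6 * (u₁ - u₀)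
        + N / 2 * Real.log (2 * Real.pi / (c * N))
        - (N * (∫ s in (0 : ℝ)..1, Real.log (iteratedDeriv 2 p (ψ s)))
          + (Real.log (iteratedDeriv 2 p u₁) - Real.log (iteratedDeriv 2 p u₀)) / 2) / 2
        + (∫ s in (0 : ℝ)..1, laplaceCoeff p (ψ s)) / c))
    =O[atTop] fun N : ℕ => ((N : ℝ))⁻¹ := by
  obtain ⟨C, M₀, hM₀, hC⟩ := h.exists_log_radialMoment
  obtain ⟨K₁, hK₁⟩ := hψ.exists_legendre_sum h
  obtain ⟨K₂, hK₂⟩ := hψ.exists_log_deriv_sum h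
  obtain ⟨K₃, hK₃⟩ := hψ.exists_laplaceCoeff_sum h
  have hc0 : 0 < c := by linarith
  refine IsBigO.of_bound (C / c ^ 2 + c * K₁ + K₂ / 2 + K₃ / c) ?_
  filter_upwards [eventually_ge_atTop (max 1 ⌈M₀⌉₊)] with N hN
  have hN0 : 0 < N := lt_of_lt_of_le one_pos ((le_max_left _ _).trans hN)
  have hNM : M₀ ≤ N := (Nat.le_ceil M₀).trans (by exact_mod_cast (le_max_right _ _).trans hN)
  have hN' : (0 : ℝ) < N := by exact_mod_cast hN0
  have hcN : M₀ ≤ c * N := hNM.trans (le_mul_of_one_le_left hN'.le hc)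
  have hsum := abs_sum_le_of_abs_le (N := N) (B := C / (c * N) ^ 2) (e := fun k =>
    Real.log (radialMoment p (c * N) (((k : ℝ) + 1) / N)) -
      (Real.log 2 + c * N * legendre p ψ (((k : ℝ) + 1) / N)
        + Real.log (2 * Real.pi / (c * N)) / 2
        - 1 / 2 * Real.log (iteratedDeriv 2 p (ψ (((k : ℝ) + 1) / N)))
        + (c * N)⁻¹ * laplaceCoeff p (ψ (((k : ℝ) + 1) / N)))) fun k hk => by
    have hs := (grid_mem hk).2
    refine le_trans (le_of_eq ?_) (hC (c * N) hcN _ _ (hψ.mem _ hs) (hψ.deriv_eq _ hs))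
    rw [legendre]
    congr 1
    ring
  have e1 := hK₁ N hN0
  have e2 := hK₂ N hN0
  have e3 := hK₃ N hN0
  simp only [Finset.sum_sub_distrib, Finset.sum_add_distrib, ← Finset.mul_sum, Finset.sum_const,
    Finset.card_range, nsmul_eq_mul] at hsum
  set S₀ := ∑ k ∈ Finset.range N, Real.log (radialMoment p (c * N) (((k : ℝ) + 1) / N))
  set S₁ := ∑ k ∈ Finset.range N, legendre p ψ (((k : ℝ) + 1) / N)
  set S₂ := ∑ k ∈ Finset.range N, Real.log (iteratedDeriv 2 p (ψ (((k : ℝ) + 1) / N)))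
  set S₃ := ∑ k ∈ Finset.range N, laplaceCoeff p (ψ (((k : ℝ) + 1) / N))
  set I₁ := ∫ s in (0 : ℝ)..1, legendre p ψ s
  set I₀ := ∫ s in (0 : ℝ)..1, ψ s
  set I₂ := ∫ s in (0 : ℝ)..1, Real.log (iteratedDeriv 2 p (ψ s))
  set I₃ := ∫ s in (0 : ℝ)..1, laplaceCoeff p (ψ s)
  set J := Real.log (iteratedDeriv 2 p u₁) - Real.log (iteratedDeriv 2 p u₀)
  set T := Real.log (2 * Real.pi / (c * N))
  rw [Real.norm_eq_abs, Real.norm_eq_abs, abs_of_pos (inv_pos.2 hN')]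
  have split : S₀ - (N * Real.log 2 + c * N ^ 2 * I₁ + c * N * I₀ + c / 6 * (u₁ - u₀) + N / 2 * T
        - (N * I₂ + J / 2) / 2 + I₃ / c) =
      (S₀ - (N * Real.log 2 + c * N * S₁ + N * (T / 2) - 1 / 2 * S₂ + (c * N)⁻¹ * S₃))
      + c * N * (S₁ - (N * I₁ + I₀ + (u₁ - u₀) / (6 * N)))
      - 1 / 2 * (S₂ - (N * I₂ + J / 2)) + (c * N)⁻¹ * (S₃ - N * I₃) := by
    field_simp
    ring
  rw [split]
  have b0 : (N : ℝ) * (C / (c * N) ^ 2) = C / c ^ 2 * (N : ℝ)⁻¹ := by field_simp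
  have b1 : |c * N * (S₁ - (N * I₁ + I₀ + (u₁ - u₀) / (6 * N)))| ≤ c * K₁ * (N : ℝ)⁻¹ := by
    rw [abs_mul, abs_of_pos (by positivity : 0 < c * N)]
    calc _ ≤ c * N * (K₁ / N ^ 2) := by gcongr
      _ = _ := by field_simp
  have b2 : |1 / 2 * (S₂ - (N * I₂ + J / 2))| ≤ K₂ / 2 * (N : ℝ)⁻¹ := by
    rw [abs_mul, abs_of_pos (by norm_num : (0:ℝ) < 1 / 2)]
    calc _ ≤ 1 / 2 * (K₂ / N) := by gcongr
      _ = _ := by field_simp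
  have b3 : |(c * N)⁻¹ * (S₃ - N * I₃)| ≤ K₃ / c * (N : ℝ)⁻¹ := by
    rw [abs_mul, abs_of_pos (by positivity : 0 < (c * N)⁻¹)]
    calc _ ≤ (c * N)⁻¹ * K₃ := by gcongr
      _ = _ := by field_simp
  rw [b0] at hsum
  refine (abs_add_le _ _).trans ?_
  refine (add_le_add_left (abs_sub _ _) _).trans ?_
  refine (add_le_add_left (add_le_add_left (abs_add_le _ _) _) _).trans ?_
  linarith

end IsSaddle

/-! ### Integrals along the saddle in the variable `u` -/

namespace IsSaddle

variable {p : ℝ → ℝ} {u₀ u₁ δ m : ℝ} {ψ : ℝ → ℝ}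

/-- Substitution `u = ψ s`, `ds = p''(u) / 2 du`: the uniform law on `[0, 1]` becomes the density
`p'' / 2` on `[u₀, u₁]`. -/
theorem integral_comp (hψ : IsSaddle p u₀ u₁ δ ψ) (h : IsConvexProfile p u₀ u₁ δ m)
    {f : ℝ → ℝ} (hf : ContinuousOn f (Set.Icc (u₀ - δ) (u₁ + δ))) :
    ∫ s in (0 : ℝ)..1, f (ψ s) = ∫ u in u₀..u₁, f u * iteratedDeriv 2 p u / 2 := by
  have hpos := hψ.deriv_pos h
  have hc2 := h.continuous 2
  have key := intervalIntegral.integral_comp_mul_deriv' (a := 0) (b := 1) (f := ψ)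
    (f' := fun s => 2 / iteratedDeriv 2 p (ψ s)) (g := fun u => f u * iteratedDeriv 2 p u / 2)
    (fun s hs => hψ.hasDerivAt s (by rwa [Set.uIcc_of_le zero_le_one] at hs))
    (continuous_const.div (hψ.continuous_comp h 2) fun s => (hpos s).ne').continuousOn
    (ContinuousOn.mono (by fun_prop) (by
      rintro _ ⟨s, _, rfl⟩
      exact hψ.mem_enlarged s))
  rw [hψ.left, hψ.right] at key
  rw [← key]
  refine intervalIntegral.integral_congr fun s _ => ?_
  have := (hpos s).ne'
  simp only [Function.comp]
  field_simp

/-- Put `R = p''' / p''`, so that `R' = p'''' / p'' - R²`. The integrand `laplaceCoeff · p'' / 2`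
equals `(5/48) R² - (1/16) p'''' / p'' = -(1/16) R' + (1/24) R²`. -/
theorem integral_laplaceCoeff (hψ : IsSaddle p u₀ u₁ δ ψ) (h : IsConvexProfile p u₀ u₁ δ m) :
    ∫ s in (0 : ℝ)..1, laplaceCoeff p (ψ s) =
      -(1 / 16) * (iteratedDeriv 3 p u₁ / iteratedDeriv 2 p u₁
        - iteratedDeriv 3 p u₀ / iteratedDeriv 2 p u₀)
      + (1 / 24) * ∫ u in u₀..u₁, (iteratedDeriv 3 p u / iteratedDeriv 2 p u) ^ 2 := by
  have hpos : ∀ u ∈ Set.uIcc u₀ u₁, 0 < iteratedDeriv 2 p u := fun u hu => by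
    rw [Set.uIcc_of_le h.lt.le] at hu
    exact h.m_pos.trans_le (h.strict u (h.mem_enlarged hu))
  rw [hψ.integral_comp h h.continuousOn_laplaceCoeff]
  have hc2 := h.continuous 2
  have hc3 := h.continuous 3
  have hc4 := h.continuous 4
  have hR : ContinuousOn (fun u => iteratedDeriv 3 p u / iteratedDeriv 2 p u) (Set.uIcc u₀ u₁) :=
    hc3.continuousOn.div hc2.continuousOn fun u hu => (hpos u hu).ne'
  have hR' : ContinuousOn (fun u => iteratedDeriv 4 p u / iteratedDeriv 2 p u
      - (iteratedDeriv 3 p u / iteratedDeriv 2 p u) ^ 2) (Set.uIcc u₀ u₁) :=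
    (hc4.continuousOn.div hc2.continuousOn fun u hu => (hpos u hu).ne').sub (hR.pow 2)
  have hftc := intervalIntegral.integral_eq_sub_of_hasDerivAt (a := u₀) (b := u₁)
    (f := fun u => iteratedDeriv 3 p u / iteratedDeriv 2 p u)
    (f' := fun u => iteratedDeriv 4 p u / iteratedDeriv 2 p u
      - (iteratedDeriv 3 p u / iteratedDeriv 2 p u) ^ 2) (fun u hu => by
        have := (hpos u hu).ne'
        refine ((h.hasDerivAt 3 u).div (h.hasDerivAt 2 u) this).congr_deriv ?_
        field_simp) hR'.intervalIntegrable
  have hR2 : IntervalIntegrable (fun u => (iteratedDeriv 3 p u / iteratedDeriv 2 p u) ^ 2)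
      volume u₀ u₁ := (hR.pow 2).intervalIntegrable
  rw [← hftc, ← intervalIntegral.integral_const_mul, ← intervalIntegral.integral_const_mul,
    ← intervalIntegral.integral_add (hR'.intervalIntegrable.const_mul _)
      (hR2.const_mul _)]
  refine intervalIntegral.integral_congr fun u hu => ?_
  have := (hpos u hu).ne'
  simp only [laplaceCoeff]
  field_simp
  ring

end IsSaddle

/-! ### Radial functions in the logarithmic variable -/

theorem iteratedFDeriv_two_diag {Q : ℂ → ℝ} {z v : ℂ} (hQ : ContDiffAt ℝ 2 Q z) {f f' : ℝ → ℝ}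
    {f'' : ℝ} (hf : ∀ᶠ t : ℝ in 𝓝 0, Q (z + t • v) = f t)
    (hf' : ∀ᶠ t : ℝ in 𝓝 0, HasDerivAt f (f' t) t) (hf'' : HasDerivAt f' f'' 0) :
    iteratedFDeriv ℝ 2 Q z ![v, v] = f'' := by
  have hline : ∀ t : ℝ, HasDerivAt (fun t : ℝ => z + t • v) v t := fun t => by
    simpa using ((hasDerivAt_id t).smul_const v).const_add z
  have hcont : Tendsto (fun t : ℝ => z + t • v) (𝓝 0) (𝓝 z) := by
    have := (hline 0).continuousAt.tendsto
    simpa using this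
  have hd : ∀ᶠ w in 𝓝 z, DifferentiableAt ℝ Q w := by
    filter_upwards [hQ.eventually (by simp)] with w hw
    exact hw.differentiableAt (by norm_num)
  have hd' : ∀ᶠ t : ℝ in 𝓝 0, HasDerivAt (fun t : ℝ => Q (z + t • v)) (fderiv ℝ Q (z + t • v) v) t := by
    filter_upwards [hcont.eventually hd] with t ht
    exact ht.hasFDerivAt.comp_hasDerivAt t (hline t)
  have heq : ∀ᶠ t : ℝ in 𝓝 0, fderiv ℝ Q (z + t • v) v = f' t := by
    filter_upwards [hd', hf', hf.eventually_nhds] with t h1 h2 h3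
    exact h1.unique (h2.congr_of_eventuallyEq h3)
  have hfd : DifferentiableAt ℝ (fderiv ℝ Q) z :=
    (hQ.fderiv_right (m := 1) (by norm_num)).differentiableAt (by norm_num)
  have hfd' : HasFDerivAt (fderiv ℝ Q) (fderiv ℝ (fderiv ℝ Q) z) (z + (0 : ℝ) • v) := by
    simpa using hfd.hasFDerivAt
  have h1 : HasDerivAt (fun t : ℝ => fderiv ℝ Q (z + t • v)) (fderiv ℝ (fderiv ℝ Q) z v) 0 :=
    hfd'.comp_hasDerivAt (0 : ℝ) (hline 0)
  have h2 : HasDerivAt (fun t : ℝ => fderiv ℝ Q (z + t • v) v) (fderiv ℝ (fderiv ℝ Q) z v v) 0 :=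
    (ContinuousLinearMap.apply ℝ ℝ v).hasFDerivAt.comp_hasDerivAt (0 : ℝ) h1
  rw [iteratedFDeriv_two_apply]
  exact h2.unique (hf''.congr_of_eventuallyEq heq)

theorem hasDerivAt_half_log {α β t : ℝ} (h : (α + t) ^ 2 + β ^ 2 ≠ 0) :
    HasDerivAt (fun t => Real.log ((α + t) ^ 2 + β ^ 2) / 2)
      ((α + t) / ((α + t) ^ 2 + β ^ 2)) t := by
  have h1 : HasDerivAt (fun t : ℝ => (α + t) ^ 2 + β ^ 2) (2 * (α + t)) t := by
    simpa using (((hasDerivAt_id t).const_add α).fun_pow 2).add_const (β ^ 2)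
  refine ((h1.log h).div_const 2).congr_deriv ?_
  field_simp

/-- Second derivative of `p (log |z|)` at `z = α + iβ` in the real direction. Swapping `α` and `β`
gives the imaginary direction; in the sum the terms with `p'` cancel and `p'' / |z|²` remains. -/
theorem second_deriv_comp_half_log {p : ℝ → ℝ} {u₀ u₁ : ℝ → ℝ} (hp : ∀ x, HasDerivAt p (u₀ x) x)
    (hp' : ∀ x, HasDerivAt u₀ (u₁ x) x) {α β : ℝ} (h : α ^ 2 + β ^ 2 ≠ 0) :
    ∃ f' : ℝ → ℝ, (∀ᶠ t : ℝ in 𝓝 0,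
      HasDerivAt (fun t => p (Real.log ((α + t) ^ 2 + β ^ 2) / 2)) (f' t) t) ∧
      HasDerivAt f' (u₁ (Real.log (α ^ 2 + β ^ 2) / 2) * (α / (α ^ 2 + β ^ 2)) ^ 2
        + u₀ (Real.log (α ^ 2 + β ^ 2) / 2) * ((β ^ 2 - α ^ 2) / (α ^ 2 + β ^ 2) ^ 2)) 0 := by
  refine ⟨fun t => u₀ (Real.log ((α + t) ^ 2 + β ^ 2) / 2) * ((α + t) / ((α + t) ^ 2 + β ^ 2)),
    ?_, ?_⟩
  · have hc : ContinuousAt (fun t : ℝ => (α + t) ^ 2 + β ^ 2) 0 := by fun_prop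
    filter_upwards [hc.eventually_ne (by simpa using h)] with t ht
    exact (hp _).comp t (hasDerivAt_half_log ht)
  · have h0 : (α + 0) ^ 2 + β ^ 2 ≠ 0 := by simpa using h
    have h1 := (hp' _).comp 0 (hasDerivAt_half_log h0)
    have h2 : HasDerivAt (fun t : ℝ => (α + t) ^ 2 + β ^ 2) (2 * (α + 0)) 0 := by
      simpa using (((hasDerivAt_id (0 : ℝ)).const_add α).fun_pow 2).add_const (β ^ 2)
    have h3 := ((hasDerivAt_id (0 : ℝ)).const_add α).div h2 h0
    refine (h1.mul h3).congr_deriv ?_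
    simp only [Function.comp, id, add_zero, Pi.div_apply]
    congr 1
    · ring
    · congr 1
      field_simp
      ring

/-- The profile `u ↦ q (exp u)` of a radial function in the logarithmic variable. -/
noncomputable def logProfile (q : ℝ → ℝ) (u : ℝ) : ℝ := q (Real.exp u)

/-! ### Annular potentials as convex profiles -/

namespace IsAnnularPotential

variable {Q : ℂ → ℝ} {q : ℝ → ℝ} {r₀ r₁ : ℝ}

theorem contDiffAt (hQ : IsAnnularPotential Q q r₀ r₁) {z : ℂ} (hz : z ≠ 0) :
    ContDiffAt ℝ ∞ Q z :=
  hQ.smooth.contDiffAt (isOpen_compl_singleton.mem_nhds hz)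

theorem eq_logProfile (hQ : IsAnnularPotential Q q r₀ r₁) {z : ℂ} (hz : z ≠ 0) :
    Q z = logProfile q (Real.log ‖z‖) := by
  rw [hQ.radial, logProfile, Real.exp_log (norm_pos_iff.2 hz)]

theorem contDiff_logProfile (hQ : IsAnnularPotential Q q r₀ r₁) : ContDiff ℝ ∞ (logProfile q) := by
  rw [contDiff_iff_contDiffAt]
  intro u
  have h1 : logProfile q = fun u => Q ((Real.exp u : ℝ) : ℂ) := by
    funext u
    rw [hQ.radial, logProfile, Complex.norm_real, Real.norm_eq_abs, Real.abs_exp]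
  rw [h1]
  have h2 : ContDiffAt ℝ ∞ (fun u : ℝ => ((Real.exp u : ℝ) : ℂ)) u :=
    (Complex.ofRealCLM.contDiff.comp Real.contDiff_exp).contDiffAt
  exact ContDiffAt.comp u (hQ.contDiffAt (by exact_mod_cast (Real.exp_pos u).ne')) h2

theorem hasDerivAt_logProfile (hQ : IsAnnularPotential Q q r₀ r₁) (k : ℕ) (x : ℝ) :
    HasDerivAt (iteratedDeriv k (logProfile q)) (iteratedDeriv (k + 1) (logProfile q) x) x := by
  rw [iteratedDeriv_succ]
  exact ((hQ.contDiff_logProfile.differentiable_iteratedDeriv k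
    (mod_cast ENat.natCast_lt_top k)) x).hasDerivAt

theorem mul_deriv_eq (hQ : IsAnnularPotential Q q r₀ r₁) {r : ℝ} (hr : 0 < r) :
    r * deriv q r = iteratedDeriv 1 (logProfile q) (Real.log r) := by
  have h1 := (hQ.hasDerivAt_logProfile 0 (Real.log r)).comp r (Real.hasDerivAt_log hr.ne')
  rw [iteratedDeriv_zero] at h1
  have h2 : q =ᶠ[𝓝 r] logProfile q ∘ Real.log := by
    filter_upwards [lt_mem_nhds hr] with x hx
    simp [logProfile, Real.exp_log hx]
  rw [(h1.congr_of_eventuallyEq h2).deriv, zero_add]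
  field_simp

theorem quarterLaplacian_eq (hQ : IsAnnularPotential Q q r₀ r₁) {z : ℂ} (hz : z ≠ 0) :
    quarterLaplacian Q z = iteratedDeriv 2 (logProfile q) (Real.log ‖z‖) / (4 * ‖z‖ ^ 2) := by
  have hn : ‖z‖ ^ 2 = z.re ^ 2 + z.im ^ 2 := by
    rw [Complex.sq_norm, Complex.normSq_apply]; ring
  have hne : z.re ^ 2 + z.im ^ 2 ≠ 0 := by
    rw [← hn]; have := norm_pos_iff.2 hz; positivity
  have hlog : ∀ w : ℂ, Real.log ‖w‖ = Real.log (w.re ^ 2 + w.im ^ 2) / 2 := fun w => by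
    have : w.re ^ 2 + w.im ^ 2 = ‖w‖ ^ 2 := by
      rw [Complex.sq_norm, Complex.normSq_apply]; ring
    rw [this, Real.log_pow]
    push_cast
    ring
  have hp := hQ.hasDerivAt_logProfile 0
  rw [iteratedDeriv_zero] at hp
  have hp' := hQ.hasDerivAt_logProfile 1
  have hev : ∀ v : ℂ, ∀ᶠ t : ℝ in 𝓝 0, z + t • v ≠ 0 := fun v => by
    have hc : ContinuousAt (fun t : ℝ => z + t • v) 0 := by fun_prop
    exact hc.eventually_ne (by simpa using hz)
  have hQ2 : ContDiffAt ℝ 2 Q z := mod_cast contDiffAt_infty.1 (hQ.contDiffAt hz) 2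
  obtain ⟨f', hf', hf''⟩ := second_deriv_comp_half_log hp hp' hne
  obtain ⟨g', hg', hg''⟩ := second_deriv_comp_half_log hp hp' (α := z.im) (β := z.re)
    (by rwa [add_comm])
  have d1 := iteratedFDeriv_two_diag (v := 1) hQ2 (by
    filter_upwards [hev 1] with t ht
    rw [hQ.eq_logProfile ht, hlog]
    simp) hf' hf''
  have d2 := iteratedFDeriv_two_diag (v := Complex.I) hQ2 (by
    filter_upwards [hev Complex.I] with t ht
    rw [hQ.eq_logProfile ht, hlog, add_comm (_ ^ 2)]
    simp) hg' hg''
  rw [quarterLaplacian, InnerProductSpace.laplacian_eq_iteratedFDeriv_complexPlane]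
  simp only
  rw [d1, d2, add_comm (z.im ^ 2), hlog, hn]
  field_simp
  ring

theorem radialLaplacian_eq (hQ : IsAnnularPotential Q q r₀ r₁) {r : ℝ} (hr : 0 < r) :
    radialLaplacian Q r = iteratedDeriv 2 (logProfile q) (Real.log r) / (4 * r ^ 2) := by
  rw [radialLaplacian, hQ.quarterLaplacian_eq (by exact_mod_cast hr.ne'), Complex.norm_real,
    Real.norm_eq_abs, abs_of_pos hr]

theorem outer_radius_pos (hQ : IsAnnularPotential Q q r₀ r₁) : 0 < r₁ := by
  obtain ⟨h0, h2⟩ := hQ.outer_radius.1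
  refine lt_of_le_of_ne h0 fun h => ?_
  rw [← h, zero_mul] at h2
  norm_num at h2

theorem exists_isConvexProfile (hQ : IsAnnularPotential Q q r₀ r₁) :
    ∃ δ m, IsConvexProfile (logProfile q) (Real.log r₀) (Real.log r₁) δ m := by
  set p := logProfile q with hp
  have hr₀ := hQ.inner_radius_pos
  have hr₁ := hQ.outer_radius_pos
  have hconv : ∀ u, 0 ≤ iteratedDeriv 2 p u := fun u => by
    have := hQ.subharmonic ((Real.exp u : ℝ) : ℂ) (by exact_mod_cast (Real.exp_pos u).ne')
    have h2 := hQ.radialLaplacian_eq (Real.exp_pos u)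
    rw [radialLaplacian] at h2
    rw [h2, Real.log_exp] at this
    have h3 := Real.exp_pos u
    by_contra! hneg
    have := div_neg_of_neg_of_pos hneg (by positivity : 0 < 4 * Real.exp u ^ 2)
    linarith
  have hleft : iteratedDeriv 1 p (Real.log r₀) = 0 := by
    rw [hp, ← hQ.mul_deriv_eq hr₀]; exact hQ.inner_radius.1.2
  have hright : iteratedDeriv 1 p (Real.log r₁) = 2 := by
    rw [hp, ← hQ.mul_deriv_eq hr₁]; exact hQ.outer_radius.1.2
  have hmono : Monotone (iteratedDeriv 1 p) :=
    monotone_of_deriv_nonneg (fun x => (hQ.hasDerivAt_logProfile 1 x).differentiableAt) fun x => by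
      rw [(hQ.hasDerivAt_logProfile 1 x).deriv]; exact hconv x
  have hlt : Real.log r₀ < Real.log r₁ := by
    by_contra! hle
    have := hmono hle
    linarith
  have hcont : Continuous (iteratedDeriv 2 p) :=
    continuous_iff_continuousAt.2 fun x => (hQ.hasDerivAt_logProfile 2 x).continuousAt
  have hpos : Set.Icc (Real.log r₀) (Real.log r₁) ⊆ {u | 0 < iteratedDeriv 2 p u} := by
    intro u hu
    have hmem : ((Real.exp u : ℝ) : ℂ) ∈ annulus r₀ r₁ := by
      simp only [annulus, Set.mem_ofPred_eq, Complex.norm_real, Real.norm_eq_abs, Real.abs_exp]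
      exact ⟨(Real.log_le_iff_le_exp hr₀).1 hu.1, (Real.le_log_iff_exp_le hr₁).1 hu.2⟩
    have h1 := hQ.strictly_subharmonic.self_of_nhdsSet _ hmem
    have h2 := hQ.radialLaplacian_eq (Real.exp_pos u)
    rw [radialLaplacian, Real.log_exp] at h2
    rw [h2] at h1
    have h3 := Real.exp_pos u
    rw [Set.mem_ofPred_eq]
    by_contra! hneg
    have := div_nonpos_of_nonpos_of_nonneg hneg (by positivity : 0 ≤ 4 * Real.exp u ^ 2)
    linarith
  -- Positivity of `p''` on the compact interval spreads to a neighbourhood. Half its width gives a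
  -- closed interval, on which `p''` attains the positive minimum used as `m`.
  obtain ⟨ε, hε, hsub⟩ := isCompact_Icc.exists_thickening_subset_open
    (isOpen_lt continuous_const hcont) hpos
  have hsub' : Set.Icc (Real.log r₀ - ε / 2) (Real.log r₁ + ε / 2) ⊆
      {u | 0 < iteratedDeriv 2 p u} := by
    intro u hu
    refine hsub (Metric.mem_thickening_iff.2 ⟨max (Real.log r₀) (min u (Real.log r₁)),
      ⟨le_max_left _ _, max_le hlt.le (min_le_right _ _)⟩, ?_⟩)
    rw [Real.dist_eq]
    rcases le_total u (Real.log r₀) with h1 | h1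
    · rw [min_eq_left (h1.trans hlt.le), max_eq_left h1, abs_lt]
      constructor <;> linarith [hu.1]
    · rcases le_total u (Real.log r₁) with h2 | h2
      · rw [min_eq_left h2, max_eq_right h1, sub_self, abs_zero]; exact hε
      · rw [min_eq_right h2, max_eq_right hlt.le, abs_lt]
        constructor <;> linarith [hu.2]
  obtain ⟨x, hx, hxmin⟩ := isCompact_Icc.exists_isMinOn
    (Set.nonempty_Icc.2 (by linarith : Real.log r₀ - ε / 2 ≤ Real.log r₁ + ε / 2))
    hcont.continuousOn
  exact ⟨ε / 2, iteratedDeriv 2 p x, hQ.contDiff_logProfile, half_pos hε, hsub' hx, hlt, hleft,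
    hright, hconv, fun u hu => hxmin hu⟩

end IsAnnularPotential

/-! ### The functional of the annulus in the logarithmic variable -/

namespace IsAnnularPotential

variable {Q : ℂ → ℝ} {q : ℝ → ℝ} {r₀ r₁ δ m : ℝ} {ψ : ℝ → ℝ}

theorem radialLaplacian_pos (hQ : IsAnnularPotential Q q r₀ r₁) {r : ℝ} (hr : r ∈ Set.Icc r₀ r₁) :
    0 < radialLaplacian Q r := by
  have hmem : (r : ℂ) ∈ annulus r₀ r₁ := by
    simpa [annulus, abs_of_pos (hQ.inner_radius_pos.trans_le hr.1)] using hr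
  exact hQ.strictly_subharmonic.self_of_nhdsSet _ hmem

theorem log_iteratedDeriv_two (hQ : IsAnnularPotential Q q r₀ r₁) {u : ℝ}
    (hu : 0 < iteratedDeriv 2 (logProfile q) u) :
    Real.log (iteratedDeriv 2 (logProfile q) u) =
      Real.log 4 + 2 * u + Real.log (radialLaplacian Q (Real.exp u)) := by
  have h := hQ.radialLaplacian_eq (Real.exp_pos u)
  rw [Real.log_exp] at h
  rw [h, Real.log_div hu.ne' (by positivity), Real.log_mul (by norm_num) (by positivity),
    Real.log_pow, Real.log_exp]
  push_cast
  ring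

theorem hasDerivAt_radialLaplacian (hQ : IsAnnularPotential Q q r₀ r₁) {r : ℝ} (hr : 0 < r) :
    HasDerivAt (radialLaplacian Q) ((iteratedDeriv 3 (logProfile q) (Real.log r)
      - 2 * iteratedDeriv 2 (logProfile q) (Real.log r)) / (4 * r ^ 3)) r := by
  have h1 := (hQ.hasDerivAt_logProfile 2 (Real.log r)).comp r (Real.hasDerivAt_log hr.ne')
  have h2 : HasDerivAt (fun r : ℝ => 4 * r ^ 2) (4 * (2 * r)) r := by
    simpa using (hasDerivAt_pow 2 r).const_mul 4
  have h3 := h1.div h2 (by positivity)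
  have h4 : radialLaplacian Q =ᶠ[𝓝 r]
      (iteratedDeriv 2 (logProfile q) ∘ Real.log) / fun r => 4 * r ^ 2 := by
    filter_upwards [lt_mem_nhds hr] with x hx
    rw [hQ.radialLaplacian_eq hx]
    rfl
  refine (h3.congr_of_eventuallyEq h4).congr_deriv ?_
  simp only [Function.comp]
  field_simp

/-- This is `r ∂_r = ∂_u` applied to `log ΔQ = log p'' - 2 u - log 4`. -/
theorem mul_deriv_div_radialLaplacian (hQ : IsAnnularPotential Q q r₀ r₁) {r : ℝ} (hr : 0 < r)
    (hpos : 0 < radialLaplacian Q r) :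
    r * (deriv (radialLaplacian Q) r / radialLaplacian Q r) =
      iteratedDeriv 3 (logProfile q) (Real.log r) / iteratedDeriv 2 (logProfile q) (Real.log r)
        - 2 := by
  rw [(hQ.hasDerivAt_radialLaplacian hr).deriv]
  have h := hQ.radialLaplacian_eq hr
  have hne : iteratedDeriv 2 (logProfile q) (Real.log r) ≠ 0 := fun h0 => by
    rw [h0, zero_div] at h; exact hpos.ne' h
  rw [h]
  field_simp

theorem log_iteratedDeriv_two_sub (hQ : IsAnnularPotential Q q r₀ r₁)
    (h : IsConvexProfile (logProfile q) (Real.log r₀) (Real.log r₁) δ m) :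
    Real.log (iteratedDeriv 2 (logProfile q) (Real.log r₁))
      - Real.log (iteratedDeriv 2 (logProfile q) (Real.log r₀)) =
    2 * (Real.log r₁ - Real.log r₀)
      + (Real.log (radialLaplacian Q r₁) - Real.log (radialLaplacian Q r₀)) := by
  have hpos : ∀ u ∈ Set.Icc (Real.log r₀) (Real.log r₁), 0 < iteratedDeriv 2 (logProfile q) u :=
    fun u hu => h.m_pos.trans_le (h.strict u (h.mem_enlarged hu))
  rw [hQ.log_iteratedDeriv_two (hpos _ (Set.left_mem_Icc.2 h.lt.le)),
    hQ.log_iteratedDeriv_two (hpos _ (Set.right_mem_Icc.2 h.lt.le)),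
    Real.exp_log hQ.inner_radius_pos, Real.exp_log hQ.outer_radius_pos]
  ring

/-- In the variable `u` the integrand is `(R - 2)² = R² - 4 R + 4`, where `R = p''' / p''` has the
primitive `log p''`. -/
theorem integral_sq_logDeriv (hQ : IsAnnularPotential Q q r₀ r₁)
    (h : IsConvexProfile (logProfile q) (Real.log r₀) (Real.log r₁) δ m) :
    ∫ r in r₀..r₁, (deriv (radialLaplacian Q) r / radialLaplacian Q r) ^ 2 * r =
      (∫ u in Real.log r₀..Real.log r₁, (iteratedDeriv 3 (logProfile q) u
        / iteratedDeriv 2 (logProfile q) u) ^ 2)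
      - 4 * (Real.log (iteratedDeriv 2 (logProfile q) (Real.log r₁))
        - Real.log (iteratedDeriv 2 (logProfile q) (Real.log r₀)))
      + 4 * (Real.log r₁ - Real.log r₀) := by
  have hr₀ := hQ.inner_radius_pos
  have hr₁ := hQ.outer_radius_pos
  have hle : r₀ ≤ r₁ := (Real.log_le_log_iff hr₀ hr₁).1 h.lt.le
  set p := logProfile q with hp
  set u₀ := Real.log r₀ with hu₀
  set u₁ := Real.log r₁ with hu₁
  set R : ℝ → ℝ := fun u => iteratedDeriv 3 p u / iteratedDeriv 2 p u with hR
  have hpos : ∀ u ∈ Set.Icc u₀ u₁, 0 < iteratedDeriv 2 p u :=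
    fun u hu => h.m_pos.trans_le (h.strict u (h.mem_enlarged hu))
  have hRc : ContinuousOn R (Set.Icc u₀ u₁) :=
    (h.continuous 3).continuousOn.div (h.continuous 2).continuousOn fun u hu => (hpos u hu).ne'
  have hlog : ∀ r ∈ Set.Icc r₀ r₁, Real.log r ∈ Set.Icc u₀ u₁ := fun r hr =>
    ⟨Real.log_le_log hr₀ hr.1, Real.log_le_log (hr₀.trans_le hr.1) hr.2⟩
  have step1 : ∫ r in r₀..r₁, (deriv (radialLaplacian Q) r / radialLaplacian Q r) ^ 2 * r =
      ∫ r in r₀..r₁, ((fun u => (R u - 2) ^ 2) ∘ Real.log) r * r⁻¹ := by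
    refine intervalIntegral.integral_congr fun r hr => ?_
    rw [Set.uIcc_of_le hle] at hr
    have hr' : 0 < r := hr₀.trans_le hr.1
    have := hQ.mul_deriv_div_radialLaplacian hr' (hQ.radialLaplacian_pos hr)
    simp only [Function.comp, hR, ← hp] at this ⊢
    rw [← this]
    field_simp
  have hRc' : ContinuousOn R (Set.uIcc u₀ u₁) := by rwa [Set.uIcc_of_le h.lt.le]
  have hG : ContinuousOn (fun u => (R u - 2) ^ 2) (Real.log '' Set.uIcc r₀ r₁) := by
    refine ContinuousOn.fun_pow ((hRc.sub continuousOn_const).mono ?_) 2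
    rintro _ ⟨r, hr, rfl⟩
    rw [Set.uIcc_of_le hle] at hr
    exact hlog r hr
  rw [step1, intervalIntegral.integral_comp_mul_deriv' (f := Real.log) (f' := fun r => r⁻¹)
    (fun r hr => Real.hasDerivAt_log (by
      rw [Set.uIcc_of_le hle] at hr; exact (hr₀.trans_le hr.1).ne'))
    (continuousOn_inv₀.mono fun r hr => by
      rw [Set.uIcc_of_le hle] at hr; exact (hr₀.trans_le hr.1).ne')
    hG]
  have hftc : ∫ u in u₀..u₁, R u = Real.log (iteratedDeriv 2 p u₁) - Real.log (iteratedDeriv 2 p u₀) :=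
    intervalIntegral.integral_eq_sub_of_hasDerivAt (fun u hu => by
      rw [Set.uIcc_of_le h.lt.le] at hu
      exact (h.hasDerivAt 2 u).log (hpos u hu).ne') hRc'.intervalIntegrable
  have hi1 : IntervalIntegrable R volume u₀ u₁ := hRc'.intervalIntegrable
  have hi2 : IntervalIntegrable (fun u => R u ^ 2) volume u₀ u₁ := (hRc'.pow 2).intervalIntegrable
  have e : ∀ u, (R u - 2) ^ 2 = R u ^ 2 - 4 * R u + 4 := fun u => by ring
  simp only [e]
  rw [intervalIntegral.integral_add (hi2.sub (hi1.const_mul 4)) intervalIntegrable_const,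
    intervalIntegral.integral_sub hi2 (hi1.const_mul 4), intervalIntegral.integral_const_mul, hftc,
    intervalIntegral.integral_const, smul_eq_mul]
  ring

/-- The constant produced by the radial asymptotics, in terms of the functional of the annulus. -/
theorem laplace_constant_eq (hQ : IsAnnularPotential Q q r₀ r₁)
    (h : IsConvexProfile (logProfile q) (Real.log r₀) (Real.log r₁) δ m)
    (hψ : IsSaddle (logProfile q) (Real.log r₀) (Real.log r₁) δ ψ) :
    ∫ s in (0 : ℝ)..1, laplaceCoeff (logProfile q) (ψ s) =
      annulusFunctional Q r₀ r₁ + (1 / 3) * (Real.log r₁ - Real.log r₀)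
        + (1 / 4) * (Real.log (radialLaplacian Q r₁) - Real.log (radialLaplacian Q r₀)) := by
  have hr₀ := hQ.inner_radius_pos
  have hr₁ := hQ.outer_radius_pos
  have hle : r₀ ≤ r₁ := (Real.log_le_log_iff hr₀ hr₁).1 h.lt.le
  have hD₀ := hQ.radialLaplacian_pos (Set.left_mem_Icc.2 hle)
  have hD₁ := hQ.radialLaplacian_pos (Set.right_mem_Icc.2 hle)
  rw [hψ.integral_laplaceCoeff h, annulusFunctional, hQ.integral_sq_logDeriv h,
    hQ.log_iteratedDeriv_two_sub h, hQ.mul_deriv_div_radialLaplacian hr₀ hD₀,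
    hQ.mul_deriv_div_radialLaplacian hr₁ hD₁, Real.log_div (by positivity) (by positivity),
    Real.log_mul (by positivity) hD₀.ne', Real.log_mul (by positivity) hD₁.ne', Real.log_pow,
    Real.log_pow]
  push_cast
  ring

theorem integral_log_iteratedDeriv_two (hQ : IsAnnularPotential Q q r₀ r₁)
    (h : IsConvexProfile (logProfile q) (Real.log r₀) (Real.log r₁) δ m)
    (hψ : IsSaddle (logProfile q) (Real.log r₀) (Real.log r₁) δ ψ) :
    ∫ s in (0 : ℝ)..1, Real.log (iteratedDeriv 2 (logProfile q) (ψ s)) =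
      Real.log 4 + 2 * (∫ s in (0 : ℝ)..1, ψ s)
        + ∫ s in (0 : ℝ)..1, Real.log (radialLaplacian Q (Real.exp (ψ s))) := by
  have hpos := hψ.deriv_pos h
  have hi : IntervalIntegrable (fun s => Real.log (iteratedDeriv 2 (logProfile q) (ψ s)))
      volume 0 1 :=
    ((hψ.continuous_comp h 2).log fun s => (hpos s).ne').intervalIntegrable 0 1
  have hi2 : IntervalIntegrable (fun s => Real.log 4 + 2 * ψ s) volume 0 1 :=
    (continuous_const.add (hψ.continuous.const_mul 2)).intervalIntegrable 0 1
  have e : ∀ s, Real.log (radialLaplacian Q (Real.exp (ψ s))) =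
      Real.log (iteratedDeriv 2 (logProfile q) (ψ s)) - (Real.log 4 + 2 * ψ s) := fun s => by
    rw [hQ.log_iteratedDeriv_two (hpos s)]; ring
  simp only [e]
  rw [intervalIntegral.integral_sub hi hi2, intervalIntegral.integral_add intervalIntegrable_const
    ((hψ.continuous.const_mul 2).intervalIntegrable 0 1), intervalIntegral.integral_const,
    intervalIntegral.integral_const_mul]
  simp

end IsAnnularPotential

/-! ### Radial integrals against the area measure -/

instance : SigmaFinite areaMeasure := SMul.sigmaFinite (μ := (volume : Measure ℂ)) _

theorem integral_exp_substitution (f : ℝ → ℝ) :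
    ∫ y in Set.Ioi (0 : ℝ), f y = ∫ u, Real.exp u * f (Real.exp u) := by
  have := integral_image_eq_integral_abs_deriv_smul MeasurableSet.univ
    (fun x _ => (Real.hasDerivAt_exp x).hasDerivWithinAt) Real.exp_injective.injOn f
  rw [Set.image_univ, Real.range_exp] at this
  simpa using this

theorem integrableOn_exp_substitution (f : ℝ → ℝ) :
    IntegrableOn f (Set.Ioi 0) ↔ Integrable fun u => Real.exp u * f (Real.exp u) := by
  have := integrableOn_image_iff_integrableOn_abs_deriv_smul MeasurableSet.univ
    (fun x _ => (Real.hasDerivAt_exp x).hasDerivWithinAt) Real.exp_injective.injOn f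
  rw [Set.image_univ, Real.range_exp] at this
  simpa using this

theorem integral_area_radial (f : ℝ → ℝ) :
    ∫ z, f ‖z‖ ∂areaMeasure = 2 * ∫ u, Real.exp (2 * u) * f (Real.exp u) := by
  rw [areaMeasure, integral_smul_measure, integral_fun_norm_addHaar, Complex.finrank_real_complex,
    Measure.real, Complex.volume_ball, integral_exp_substitution]
  have : ∀ u, Real.exp u * (Real.exp u ^ (2 - 1) • f (Real.exp u)) =
      Real.exp (2 * u) * f (Real.exp u) := fun u => by
    rw [two_mul, Real.exp_add]; simp; ring
  simp only [this]
  have hpi := Real.pi_ne_zero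
  simp [Real.pi_nonneg, ENNReal.toReal_ofReal]
  field_simp

theorem integrable_area_radial {f : ℝ → ℝ}
    (hf : Integrable fun u => Real.exp (2 * u) * f (Real.exp u)) :
    Integrable (fun z : ℂ => f ‖z‖) areaMeasure := by
  refine Integrable.smul_measure ?_ ENNReal.ofReal_ne_top
  rw [integrable_fun_norm_addHaar (volume : Measure ℂ) (f := f), Complex.finrank_real_complex,
    integrableOn_exp_substitution]
  refine hf.congr (ae_of_all _ fun u => ?_)
  simp only
  rw [two_mul, Real.exp_add]; simp; ring

theorem integral_area_rotate {c : ℂ} (hc : ‖c‖ = 1) (f : ℂ → ℂ) :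
    ∫ z, f (c * z) ∂areaMeasure = ∫ z, f z ∂areaMeasure := by
  rw [areaMeasure, integral_smul_measure, integral_smul_measure]
  congr 1
  have h := (rotation (⟨c, by simpa [Submonoid.unitSphere] using hc⟩ : Circle)).measurePreserving
  exact h.integral_comp
    (rotation (⟨c, by simpa [Submonoid.unitSphere] using hc⟩ : Circle)).toHomeomorph.measurableEmbedding f

/-- Rotation by the angle `π / (a - b)` preserves the measure and changes the sign of the integrand.
-/
theorem integral_area_monomial_eq_zero (g : ℝ → ℂ) {a b : ℕ} (hab : a ≠ b) :
    ∫ z, z ^ a * (starRingEnd ℂ) z ^ b * g ‖z‖ ∂areaMeasure = 0 := by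
  set θ : ℝ := Real.pi / ((a : ℝ) - b) with hθ
  have hd : (a : ℝ) - b ≠ 0 := sub_ne_zero.2 (by exact_mod_cast hab)
  set c : ℂ := Complex.exp (θ * Complex.I) with hc
  have hc1 : ‖c‖ = 1 := Complex.norm_exp_ofReal_mul_I θ
  have hcc : c ^ a * (starRingEnd ℂ) c ^ b = -1 := by
    rw [hc, ← Complex.exp_conj, ← Complex.exp_nat_mul, ← Complex.exp_nat_mul, ← Complex.exp_add]
    have : (a : ℂ) * (θ * Complex.I) + b * (starRingEnd ℂ) (θ * Complex.I) = Real.pi * Complex.I := by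
      rw [map_mul, Complex.conj_ofReal, Complex.conj_I, hθ]
      have hd' : (a : ℂ) - b ≠ 0 := by exact_mod_cast hd
      push_cast
      field_simp
      ring
    rw [this, Complex.exp_pi_mul_I]
  have h := integral_area_rotate hc1 (fun z => z ^ a * (starRingEnd ℂ) z ^ b * g ‖z‖)
  have e : ∀ z : ℂ, (c * z) ^ a * (starRingEnd ℂ) (c * z) ^ b * g ‖c * z‖ =
      -1 * (z ^ a * (starRingEnd ℂ) z ^ b * g ‖z‖) := fun z => by
    rw [norm_mul, hc1, one_mul, map_mul, mul_pow, mul_pow, ← hcc]; ring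
  simp only [e] at h
  rw [integral_const_mul] at h
  have h2 : (2 : ℂ) * ∫ z, z ^ a * (starRingEnd ℂ) z ^ b * g ‖z‖ ∂areaMeasure = 0 := by
    linear_combination -h
  exact (mul_eq_zero.1 h2).resolve_left two_ne_zero

/-- The mixed moment `∫ z ^ a conj z ^ b exp (-M Q) dA`. -/
noncomputable def mixedMoment (Q : ℂ → ℝ) (M : ℝ) (a b : ℕ) : ℂ :=
  ∫ z, z ^ a * (starRingEnd ℂ) z ^ b * (Real.exp (-(M * Q z)) : ℝ) ∂areaMeasure

/-! ### Moments of an annular potential -/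

namespace IsAnnularPotential

variable {Q : ℂ → ℝ} {q : ℝ → ℝ} {r₀ r₁ δ m : ℝ} {ψ : ℝ → ℝ}

theorem measurable (hQ : IsAnnularPotential Q q r₀ r₁) : Measurable Q := by
  have h := hQ.contDiff_logProfile.continuous.measurable
  have h2 : Measurable fun z : ℂ => if z = 0 then Q 0 else logProfile q (Real.log ‖z‖) :=
    Measurable.ite (measurableSet_singleton 0) measurable_const
      (h.comp (Real.measurable_log.comp measurable_norm))
  have e : Q = fun z : ℂ => if z = 0 then Q 0 else logProfile q (Real.log ‖z‖) := by
    funext z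
    split_ifs with hz
    · rw [hz]
    · rw [hQ.eq_logProfile hz]
  rw [e]
  exact h2

/-- Up to the angular factor this is a radial moment at `s = (a + b + 2) / (2 M)`; the hypothesis
says exactly that `s ≤ 1`, so that a saddle exists. The `2` comes from `r dr = exp (2 u) du`. -/
theorem integrable_moment (hQ : IsAnnularPotential Q q r₀ r₁)
    (h : IsConvexProfile (logProfile q) (Real.log r₀) (Real.log r₁) δ m)
    (hψ : IsSaddle (logProfile q) (Real.log r₀) (Real.log r₁) δ ψ) {M : ℝ} (hM : 1 ≤ M) {a b : ℕ}
    (hab : (a : ℝ) + b + 2 ≤ 2 * M) :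
    Integrable (fun z : ℂ => z ^ a * (starRingEnd ℂ) z ^ b * (Real.exp (-(M * Q z)) : ℝ))
      areaMeasure := by
  have hM0 : 0 < M := by linarith
  set s : ℝ := ((a : ℝ) + b + 2) / (2 * M) with hs
  have hs01 : s ∈ Set.Icc (0 : ℝ) 1 := ⟨by positivity, by rw [hs, div_le_one (by positivity)]; exact hab⟩
  have h1 := h.integrable_radialMoment (hψ.mem s hs01) (hψ.deriv_eq s hs01) hM
  have h2 : Integrable (fun z : ℂ => ‖z‖ ^ (a + b) * Real.exp (-(M * q ‖z‖))) areaMeasure := by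
    refine integrable_area_radial (f := fun r => r ^ (a + b) * Real.exp (-(M * q r))) ?_
    refine h1.congr (ae_of_all _ fun u => ?_)
    simp only
    rw [← Real.exp_nat_mul, ← Real.exp_add, ← Real.exp_add, logProfile, hs]
    congr 1
    push_cast
    field_simp
    ring
  refine h2.mono' ?_ (ae_of_all _ fun z => ?_)
  · have := hQ.measurable
    refine Measurable.aestronglyMeasurable ?_
    fun_prop
  · rw [norm_mul, norm_mul, norm_pow, norm_pow, RCLike.norm_conj, Complex.norm_real,
      Real.norm_eq_abs, Real.abs_exp, hQ.radial z, pow_add]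

theorem mixedMoment_of_ne (hQ : IsAnnularPotential Q q r₀ r₁) (M : ℝ) {a b : ℕ} (hab : a ≠ b) :
    mixedMoment Q M a b = 0 := by
  have := integral_area_monomial_eq_zero (fun r => ((Real.exp (-(M * q r)) : ℝ) : ℂ)) hab
  simpa only [mixedMoment, hQ.radial] using this

theorem mixedMoment_self (hQ : IsAnnularPotential Q q r₀ r₁) {M : ℝ} (hM : M ≠ 0) (a : ℕ) :
    mixedMoment Q M a a = (radialMoment (logProfile q) M (((a : ℝ) + 1) / M) : ℝ) := by
  have e : ∀ z : ℂ, z ^ a * (starRingEnd ℂ) z ^ a * (Real.exp (-(M * Q z)) : ℝ) =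
      ((‖z‖ ^ (2 * a) * Real.exp (-(M * q ‖z‖)) : ℝ) : ℂ) := fun z => by
    rw [← mul_pow, Complex.mul_conj, Complex.normSq_eq_norm_sq, hQ.radial z]
    push_cast
    rw [pow_mul]
  simp only [mixedMoment, e]
  rw [integral_complex_ofReal, integral_area_radial (fun r => r ^ (2 * a) * Real.exp (-(M * q r))),
    radialMoment]
  congr 3
  funext u
  rw [← Real.exp_nat_mul, ← Real.exp_add, ← Real.exp_add, logProfile]
  congr 1
  push_cast
  field_simp
  ring

end IsAnnularPotential

/-! ### The partition function of the random normal matrix ensemble -/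

theorem prod_Iio_eq_prod_Ioi {N : ℕ} {M : Type*} [CommMonoid M] (f : Fin N → Fin N → M) :
    ∏ j, ∏ k ∈ Finset.Iio j, f j k = ∏ i, ∏ j ∈ Finset.Ioi i, f j i := by
  refine Finset.prod_comm' fun x y => ?_
  simp

theorem det_vandermonde_eq_sum {N : ℕ} (v : Fin N → ℂ) :
    ∏ i, ∏ j ∈ Finset.Ioi i, (v j - v i) =
      ∑ σ : Equiv.Perm (Fin N), ((Equiv.Perm.sign σ : ℤ) : ℂ) * ∏ i, v i ^ (σ i : ℕ) := by
  rw [← Matrix.det_vandermonde, ← Matrix.det_transpose, Matrix.det_apply']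
  rfl

namespace IsAnnularPotential

variable {Q : ℂ → ℝ} {q : ℝ → ℝ} {r₀ r₁ δ m : ℝ} {ψ : ℝ → ℝ}

/-- The squared Vandermonde modulus is a double sum over permutations `σ`, `τ`. Orthogonality leaves
only `τ = σ`, and each of the `N!` surviving terms is the same product of norms. -/
theorem partitionNormal_eq (hQ : IsAnnularPotential Q q r₀ r₁)
    (h : IsConvexProfile (logProfile q) (Real.log r₀) (Real.log r₁) δ m)
    (hψ : IsSaddle (logProfile q) (Real.log r₀) (Real.log r₁) δ ψ) {N : ℕ} (hN : 0 < N) :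
    partitionNormal Q N =
      N.factorial * ∏ k : Fin N, radialMoment (logProfile q) N (((k : ℝ) + 1) / N) := by
  have hN1 : (1 : ℝ) ≤ N := by exact_mod_cast hN
  have hint : ∀ a b : Fin N, Integrable (fun z : ℂ =>
      z ^ (a : ℕ) * (starRingEnd ℂ) z ^ (b : ℕ) * (Real.exp (-((N : ℝ) * Q z)) : ℝ)) areaMeasure := by
    intro a b
    refine hQ.integrable_moment h hψ hN1 ?_
    have ha : (a : ℝ) + 1 ≤ N := by exact_mod_cast a.2
    have hb : (b : ℝ) + 1 ≤ N := by exact_mod_cast b.2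
    linarith
  have expand : ∀ z : Fin N → ℂ, (((∏ j, ∏ k ∈ Finset.Iio j, ‖z j - z k‖ ^ 2)
      * ∏ j, Real.exp (-((N : ℝ) * Q (z j))) : ℝ) : ℂ) =
      ∑ σ : Equiv.Perm (Fin N), ∑ τ : Equiv.Perm (Fin N),
        (((Equiv.Perm.sign σ : ℤ) : ℂ) * ((Equiv.Perm.sign τ : ℤ) : ℂ)) *
          ∏ i, (z i ^ (σ i : ℕ) * (starRingEnd ℂ) (z i) ^ (τ i : ℕ)
            * (Real.exp (-((N : ℝ) * Q (z i))) : ℝ)) := by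
    intro z
    have e1 : (((∏ j, ∏ k ∈ Finset.Iio j, ‖z j - z k‖ ^ 2) : ℝ) : ℂ) =
        (∏ i, ∏ j ∈ Finset.Ioi i, (z j - z i)) *
          (starRingEnd ℂ) (∏ i, ∏ j ∈ Finset.Ioi i, (z j - z i)) := by
      rw [prod_Iio_eq_prod_Ioi (fun j k => ‖z j - z k‖ ^ 2)]
      simp only [map_prod, ← Finset.prod_mul_distrib, Complex.ofReal_prod]
      refine Finset.prod_congr rfl fun i _ => Finset.prod_congr rfl fun j _ => ?_
      rw [Complex.mul_conj, Complex.normSq_eq_norm_sq]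
    rw [Complex.ofReal_mul, e1, det_vandermonde_eq_sum, map_sum, Finset.sum_mul_sum,
      Finset.sum_mul]
    refine Finset.sum_congr rfl fun σ _ => ?_
    rw [Finset.sum_mul]
    refine Finset.sum_congr rfl fun τ _ => ?_
    simp only [map_mul, map_prod, map_pow, map_intCast, Finset.prod_mul_distrib,
      Complex.ofReal_prod]
    ring
  have hC : ((partitionNormal Q N : ℝ) : ℂ) =
      ((N.factorial * ∏ k : Fin N, radialMoment (logProfile q) N (((k : ℝ) + 1) / N) : ℝ) : ℂ) := by
    rw [partitionNormal, ← integral_complex_ofReal]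
    simp only [expand]
    have hI : ∀ σ τ : Equiv.Perm (Fin N), Integrable (fun z : Fin N → ℂ =>
        (((Equiv.Perm.sign σ : ℤ) : ℂ) * ((Equiv.Perm.sign τ : ℤ) : ℂ)) *
          ∏ i, (z i ^ (σ i : ℕ) * (starRingEnd ℂ) (z i) ^ (τ i : ℕ)
            * (Real.exp (-((N : ℝ) * Q (z i))) : ℝ))) (Measure.pi fun _ => areaMeasure) := by
      intro σ τ
      exact (Integrable.fintype_prod (f := fun (i : Fin N) (w : ℂ) =>
        w ^ (σ i : ℕ) * (starRingEnd ℂ) w ^ (τ i : ℕ) * ((Real.exp (-((N : ℝ) * Q w)) : ℝ) : ℂ))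
        fun i => hint _ _).const_mul _
    rw [integral_finsetSum _ fun σ _ => integrable_finsetSum _ fun τ _ => hI σ τ]
    have hterm : ∀ σ : Equiv.Perm (Fin N), ∫ z : Fin N → ℂ, ∑ τ : Equiv.Perm (Fin N),
        (((Equiv.Perm.sign σ : ℤ) : ℂ) * ((Equiv.Perm.sign τ : ℤ) : ℂ)) *
          ∏ i, (z i ^ (σ i : ℕ) * (starRingEnd ℂ) (z i) ^ (τ i : ℕ)
            * (Real.exp (-((N : ℝ) * Q (z i))) : ℝ)) ∂(Measure.pi fun _ => areaMeasure) =
        ∏ k : Fin N, mixedMoment Q N k k := by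
      intro σ
      rw [integral_finsetSum _ fun τ _ => hI σ τ]
      have hval : ∀ τ : Equiv.Perm (Fin N), ∫ z : Fin N → ℂ,
        (((Equiv.Perm.sign σ : ℤ) : ℂ) * ((Equiv.Perm.sign τ : ℤ) : ℂ)) *
          ∏ i, (z i ^ (σ i : ℕ) * (starRingEnd ℂ) (z i) ^ (τ i : ℕ)
            * (Real.exp (-((N : ℝ) * Q (z i))) : ℝ)) ∂(Measure.pi fun _ => areaMeasure) =
          (((Equiv.Perm.sign σ : ℤ) : ℂ) * ((Equiv.Perm.sign τ : ℤ) : ℂ)) *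
            ∏ i, mixedMoment Q N (σ i) (τ i) := by
        intro τ
        rw [integral_const_mul, integral_fintype_prod_eq_prod (fun (i : Fin N) (w : ℂ) =>
          w ^ (σ i : ℕ) * (starRingEnd ℂ) w ^ (τ i : ℕ) * ((Real.exp (-((N : ℝ) * Q w)) : ℝ) : ℂ))]
        rfl
      simp only [hval]
      rw [Finset.sum_eq_single σ]
      · have hs : ((Equiv.Perm.sign σ : ℤ) : ℂ) * ((Equiv.Perm.sign σ : ℤ) : ℂ) = 1 := by
          rw [← Int.cast_mul, ← Units.val_mul, Int.units_mul_self]; simp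
        rw [hs, one_mul]
        exact Equiv.prod_comp σ (fun k : Fin N => mixedMoment Q N k k)
      · intro τ _ hτ
        obtain ⟨i, hi⟩ : ∃ i, σ i ≠ τ i := by
          by_contra! hall
          exact hτ (Equiv.ext fun i => (hall i).symm)
        rw [Finset.prod_eq_zero (Finset.mem_univ i), mul_zero]
        exact hQ.mixedMoment_of_ne _ fun he => hi (Fin.ext he)
      · intro hσ; exact absurd (Finset.mem_univ σ) hσ
    simp only [hterm]
    rw [Finset.sum_const, Finset.card_univ, Fintype.card_perm, Fintype.card_fin, nsmul_eq_mul]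
    push_cast
    congr 1
    refine Finset.prod_congr rfl fun k _ => ?_
    rw [hQ.mixedMoment_self (by positivity)]
  exact_mod_cast hC

end IsAnnularPotential

/-! ### Permutations pairing neighbouring integers -/

/-- The position of an element of the `k`-th block of length two. -/
def pairValue {N : ℕ} (i : Fin N × Fin 2) : ℕ := (i.2 : ℕ) + 2 * i.1

theorem pairValue_injective {N : ℕ} : Function.Injective (pairValue (N := N)) := by
  rintro ⟨a, x⟩ ⟨b, y⟩ h
  simp only [pairValue] at h
  have hx := x.2
  have hy := y.2
  exact Prod.ext (Fin.ext (by simp only; omega)) (Fin.ext (by simp only; omega))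

theorem eq_of_ne_of_ne_fin_two : ∀ x x' y : Fin 2, x ≠ y → x' ≠ y → x' = x := by decide

/-- Induction from below: `0` has only `1` as a neighbour, and once `2k` is matched with `2k + 1`,
the number `2k + 2` has only `2k + 3` left. Perfect matchings by neighbours are thus the matching
into blocks. -/
theorem image_block_of_adjacent {N : ℕ} {σ : Equiv.Perm (Fin N × Fin 2)}
    (hσ : ∀ j x y, x ≠ y → pairValue (σ (j, y)) = pairValue (σ (j, x)) + 1 ∨
      pairValue (σ (j, x)) = pairValue (σ (j, y)) + 1) :
    ∀ (k : ℕ) (hk : k < N) j x y, x ≠ y → σ (j, x) = (⟨k, hk⟩, 0) → σ (j, y) = (⟨k, hk⟩, 1) := by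
  intro k
  induction k with
  | zero =>
    intro hk j x y hxy hx
    refine pairValue_injective ?_
    have := hσ j x y hxy
    rw [hx] at this
    simp only [pairValue] at this ⊢
    simpa using this
  | succ k ih =>
    intro hk j x y hxy hx
    have hadj := hσ j x y hxy
    rw [hx] at hadj
    rcases hadj with h1 | h1
    · refine pairValue_injective (h1.trans ?_)
      simp [pairValue]; ring
    · have hk' : k < N := by omega
      have hy : σ (j, y) = (⟨k, hk'⟩, 1) := by
        refine pairValue_injective ?_
        simp only [pairValue] at h1 ⊢
        simp at h1 ⊢
        omega
      obtain ⟨⟨j', x'⟩, hj'⟩ := σ.surjective (⟨k, hk'⟩, 0)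
      obtain ⟨y', hy'⟩ := exists_ne x'
      have h2 := ih hk' j' x' y' hy'.symm hj'
      have h3 := σ.injective (h2.trans hy.symm)
      rw [Prod.mk.injEq] at h3
      obtain ⟨rfl, rfl⟩ := h3
      have h4 := eq_of_ne_of_ne_fin_two x x' y' hxy hy'.symm
      rw [h4, hx] at hj'
      simp at hj'

theorem block_of_adjacent {N : ℕ} {σ : Equiv.Perm (Fin N × Fin 2)}
    (hσ : ∀ j x y, x ≠ y → pairValue (σ (j, y)) = pairValue (σ (j, x)) + 1 ∨
      pairValue (σ (j, x)) = pairValue (σ (j, y)) + 1) (j : Fin N) :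
    (σ (j, 0)).1 = (σ (j, 1)).1 := by
  rcases hz : σ (j, 0) with ⟨⟨k, hk⟩, z⟩
  fin_cases z
  · rw [image_block_of_adjacent hσ k hk j 0 1 (by decide) hz]
  · obtain ⟨⟨j', x'⟩, hj'⟩ := σ.surjective (⟨k, hk⟩, 0)
    obtain ⟨y', hy'⟩ := exists_ne x'
    have h2 := image_block_of_adjacent hσ k hk j' x' y' hy'.symm hj'
    have h3 := σ.injective (h2.trans hz.symm)
    rw [Prod.mk.injEq] at h3
    obtain ⟨rfl, rfl⟩ := h3
    have h4 := eq_of_ne_of_ne_fin_two 1 x' 0 (by decide) hy'.symm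
    rw [h4] at hj'
    rw [hj']

/-- The permutation of `Fin N × Fin 2` that permutes the blocks by `π` and flips them by `ε`. -/
def blockPerm {N : ℕ} (x : Equiv.Perm (Fin N) × (Fin N → Equiv.Perm (Fin 2))) :
    Equiv.Perm (Fin N × Fin 2) :=
  Equiv.prodCongrLeft (fun _ => x.1) * Equiv.prodCongrRight x.2

theorem blockPerm_apply {N : ℕ} (x : Equiv.Perm (Fin N) × (Fin N → Equiv.Perm (Fin 2)))
    (j : Fin N) (y : Fin 2) : blockPerm x (j, y) = (x.1 j, x.2 j y) := rfl

/-- Permuting whole blocks acts in the same way on both coordinates, hence evenly; only the flips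
contribute. -/
theorem sign_blockPerm {N : ℕ} (x : Equiv.Perm (Fin N) × (Fin N → Equiv.Perm (Fin 2))) :
    Equiv.Perm.sign (blockPerm x) = ∏ j, Equiv.Perm.sign (x.2 j) := by
  rw [blockPerm, Equiv.Perm.sign_mul, Equiv.Perm.sign_prodCongrRight,
    Equiv.Perm.sign_prodCongrLeft, Fin.prod_univ_two, Int.units_mul_self, one_mul]

theorem blockPerm_injective {N : ℕ} : Function.Injective (blockPerm (N := N)) := by
  rintro ⟨π, ε⟩ ⟨π', ε'⟩ h
  have h1 : ∀ j y, (π j, ε j y) = (π' j, ε' j y) := fun j y => by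
    rw [← blockPerm_apply (π, ε), h, blockPerm_apply]
  refine Prod.ext (Equiv.ext fun j => ?_) (funext fun j => Equiv.ext fun y => ?_)
  · exact (Prod.ext_iff.1 (h1 j 0)).1
  · exact (Prod.ext_iff.1 (h1 j y)).2

theorem exists_blockPerm_eq {N : ℕ} {σ : Equiv.Perm (Fin N × Fin 2)}
    (h : ∀ j, (σ (j, 0)).1 = (σ (j, 1)).1) : ∃ x, blockPerm x = σ := by
  have h' : ∀ j y, (σ (j, y)).1 = (σ (j, 0)).1 := by
    intro j y
    fin_cases y
    · rfl
    · exact (h j).symm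
  have hπ : Function.Bijective fun j => (σ (j, 0)).1 := by
    refine Function.Surjective.bijective_of_finite fun k => ?_
    obtain ⟨⟨j, y⟩, hj⟩ := σ.surjective (k, 0)
    refine ⟨j, ?_⟩
    rw [← h' j y, hj]
  have hε : ∀ j, Function.Bijective fun y => (σ (j, y)).2 := by
    intro j
    refine Function.Injective.bijective_of_finite fun y y' hy => ?_
    have : σ (j, y) = σ (j, y') := Prod.ext ((h' j y).trans (h' j y').symm) hy
    simpa using σ.injective this
  refine ⟨(Equiv.ofBijective _ hπ, fun j => Equiv.ofBijective _ (hε j)), Equiv.ext ?_⟩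
  rintro ⟨j, y⟩
  rw [blockPerm_apply]
  exact Prod.ext (h' j y).symm rfl

/-- The signed sum over all permutations of a product over pairs, for a skew-symmetric kernel
supported on pairs of neighbouring integers. -/
theorem sum_sign_mul_prod_adjacent {N : ℕ} (S : ℕ → ℕ → ℂ) (t : ℕ → ℂ)
    (h1 : ∀ k, S (2 * k) (2 * k + 1) = t k) (h2 : ∀ k, S (2 * k + 1) (2 * k) = -t k)
    (h0 : ∀ a b, b ≠ a + 1 → a ≠ b + 1 → S a b = 0) :
    ∑ σ : Equiv.Perm (Fin N × Fin 2), ((Equiv.Perm.sign σ : ℤ) : ℂ) *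
      ∏ j, S (pairValue (σ (j, 0))) (pairValue (σ (j, 1))) =
    N.factorial * ∏ k : Fin N, (2 * t k) := by
  -- The sign of a flip cancels the skew-symmetry of the kernel, so all `N! · 2 ^ N` block
  -- permutations contribute the same product.
  have hflip : ∀ (k : Fin N) (e : Equiv.Perm (Fin 2)), ((Equiv.Perm.sign e : ℤ) : ℂ) *
      S (pairValue (k, e 0)) (pairValue (k, e 1)) = t k := by
    intro k e
    have he : e = 1 ∨ e = Equiv.swap 0 1 := by revert e; decide
    rcases he with rfl | rfl
    · simp [pairValue, add_comm 1, h1]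
    · simp [pairValue, add_comm 1, h2]
  have key : ∑ x : Equiv.Perm (Fin N) × (Fin N → Equiv.Perm (Fin 2)), ∏ k : Fin N, t k =
      ∑ σ : Equiv.Perm (Fin N × Fin 2), ((Equiv.Perm.sign σ : ℤ) : ℂ) *
      ∏ j, S (pairValue (σ (j, 0))) (pairValue (σ (j, 1))) := by
    refine Finset.sum_of_injOn blockPerm blockPerm_injective.injOn (by simp) ?_ ?_
    · intro σ _ hσ
      by_contra hne
      refine hσ ?_
      have hadj : ∀ j, pairValue (σ (j, 1)) = pairValue (σ (j, 0)) + 1 ∨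
          pairValue (σ (j, 0)) = pairValue (σ (j, 1)) + 1 := by
        intro j
        by_contra! hj
        refine hne ?_
        rw [Finset.prod_eq_zero (Finset.mem_univ j) (h0 _ _ hj.1 hj.2), mul_zero]
      obtain ⟨x, hx⟩ := exists_blockPerm_eq (block_of_adjacent (σ := σ) (by
        intro j x y hxy
        have := hadj j
        fin_cases x <;> fin_cases y <;> simp at hxy ⊢
        · exact this
        · exact this.symm))
      exact ⟨x, by simp, hx⟩
    · rintro x -
      simp only [sign_blockPerm, blockPerm_apply]
      rw [Units.coe_prod, Int.cast_prod, ← Finset.prod_mul_distrib]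
      simp only [hflip]
      exact (Equiv.prod_comp x.1 (fun k : Fin N => t k)).symm
  rw [← key, Finset.sum_const, Finset.card_univ, Fintype.card_prod, Fintype.card_perm,
    Fintype.card_fin, Fintype.card_fun, Fintype.card_perm, Fintype.card_fin, Finset.prod_mul_distrib,
    Finset.prod_const, Finset.card_univ, Fintype.card_fin, nsmul_eq_mul]
  simp [Nat.factorial, mul_assoc]

/-! ### The partition function of the planar symplectic ensemble -/

theorem prod_Ioi_pairs {N : ℕ} {M : Type*} [CommMonoid M] (f : Fin N × Fin 2 → Fin N × Fin 2 → M) :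
    ∏ i : Fin (N * 2), ∏ j ∈ Finset.Ioi i, f (finProdFinEquiv.symm i) (finProdFinEquiv.symm j) =
      (∏ a, f (a, 0) (a, 1)) * ∏ a, ∏ b ∈ Finset.Ioi a,
        (f (a, 0) (b, 0) * f (a, 0) (b, 1) * (f (a, 1) (b, 0) * f (a, 1) (b, 1))) := by
  classical
  have hlt : ∀ (a b : Fin N) (x y : Fin 2),
      finProdFinEquiv (a, x) < finProdFinEquiv (b, y) ↔ a < b ∨ (a = b ∧ x < y) := by
    intro a b x y
    rw [Fin.lt_def, finProdFinEquiv_apply_val, finProdFinEquiv_apply_val, Fin.lt_def, Fin.lt_def,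
      Fin.ext_iff]
    have hx := x.2
    have hy := y.2
    simp only
    omega
  have hIoi : ∀ {n : ℕ} (i : Fin n) (g : Fin n → M),
      ∏ j ∈ Finset.Ioi i, g j = ∏ j, if i < j then g j else 1 := by
    intro n i g
    rw [← Finset.prod_filter]
    congr 1
    ext j
    simp
  simp only [hIoi]
  rw [← Equiv.prod_comp finProdFinEquiv]
  simp only [← Equiv.prod_comp (finProdFinEquiv (m := N) (n := 2)) (fun j => ite _ _ _),
    Equiv.symm_apply_apply, Fintype.prod_prod_type, Fin.prod_univ_two, hlt, lt_self_iff_false,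
    and_false, or_false, Fin.zero_lt_one, and_true, Fin.not_lt_zero]
  rw [← Finset.prod_mul_distrib]
  refine Finset.prod_congr rfl fun a _ => ?_
  have hd : f (a, 0) (a, 1) = ∏ b, if a = b then f (a, 0) (b, 1) else 1 := by
    rw [Finset.prod_ite_eq, if_pos (Finset.mem_univ a)]
  rw [hd, ← Finset.prod_mul_distrib, ← Finset.prod_mul_distrib]
  refine Finset.prod_congr rfl fun b _ => ?_
  rcases lt_trichotomy a b with hab | hab | hab
  · simp [hab, hab.ne, mul_assoc]
  · simp [hab]
  · simp [hab.not_gt, hab.ne']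

theorem det_vandermonde_pairs_eq_sum {N : ℕ} (v : Fin N × Fin 2 → ℂ) :
    (∏ a, (v (a, 1) - v (a, 0))) * ∏ a, ∏ b ∈ Finset.Ioi a,
        ((v (b, 0) - v (a, 0)) * (v (b, 1) - v (a, 0)) *
          ((v (b, 0) - v (a, 1)) * (v (b, 1) - v (a, 1)))) =
      ∑ σ : Equiv.Perm (Fin N × Fin 2), ((Equiv.Perm.sign σ : ℤ) : ℂ) *
        ∏ j, (v (j, 0) ^ pairValue (σ (j, 0)) * v (j, 1) ^ pairValue (σ (j, 1))) := by
  rw [← prod_Ioi_pairs (fun i j => v j - v i),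
    det_vandermonde_eq_sum (fun i => v (finProdFinEquiv.symm i)),
    ← Equiv.sum_comp (finProdFinEquiv (m := N) (n := 2)).permCongr]
  refine Finset.sum_congr rfl fun σ _ => ?_
  rw [Equiv.Perm.sign_permCongr, ← Equiv.prod_comp finProdFinEquiv]
  simp only [Equiv.permCongr_apply, Equiv.symm_apply_apply, Fintype.prod_prod_type,
    Fin.prod_univ_two, finProdFinEquiv_apply_val, pairValue]

/-- The sum is the Vandermonde determinant of the `2 N` points `z_j`, `conj z_j`. The four
differences between two pairs multiply to the interaction of `z_j` and `z_k`, while the difference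
within a pair completes `z_j - conj z_j` to its squared modulus. -/
theorem symplectic_integrand_eq {N : ℕ} (z : Fin N → ℂ) :
    (((∏ j, ∏ k ∈ Finset.Iio j, ‖z j - z k‖ ^ 2 * ‖z j - (starRingEnd ℂ) (z k)‖ ^ 2) *
      ∏ j, ‖z j - (starRingEnd ℂ) (z j)‖ ^ 2 : ℝ) : ℂ) =
    (∑ σ : Equiv.Perm (Fin N × Fin 2), ((Equiv.Perm.sign σ : ℤ) : ℂ) *
        ∏ j, (z j ^ pairValue (σ (j, 0)) * (starRingEnd ℂ) (z j) ^ pairValue (σ (j, 1)))) *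
      ∏ j, (z j - (starRingEnd ℂ) (z j)) := by
  have hv := det_vandermonde_pairs_eq_sum (N := N)
    (fun i => if i.2 = 0 then z i.1 else (starRingEnd ℂ) (z i.1))
  simp only [Fin.isValue, ↓reduceIte, one_ne_zero] at hv
  rw [← hv, prod_Iio_eq_prod_Ioi (fun j k => ‖z j - z k‖ ^ 2 * ‖z j - (starRingEnd ℂ) (z k)‖ ^ 2)]
  have hsq : ∀ w : ℂ, ((‖w‖ ^ 2 : ℝ) : ℂ) = w * (starRingEnd ℂ) w := fun w => by
    rw [Complex.mul_conj, Complex.normSq_eq_norm_sq]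
  rw [Complex.ofReal_mul, mul_comm, mul_right_comm, ← Finset.prod_mul_distrib]
  simp only [Complex.ofReal_prod, Complex.ofReal_mul]
  congr 1
  · refine Finset.prod_congr rfl fun j _ => ?_
    rw [hsq, map_sub, Complex.conj_conj]
    ring
  · refine Finset.prod_congr rfl fun i _ => Finset.prod_congr rfl fun j _ => ?_
    rw [hsq, hsq, map_sub, map_sub, Complex.conj_conj]
    ring

namespace IsAnnularPotential

variable {Q : ℂ → ℝ} {q : ℝ → ℝ} {r₀ r₁ δ m : ℝ} {ψ : ℝ → ℝ}

/-- After the expansion each variable carries one pair `(a, b)` of exponents and the factor `w -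
conj w`. Orthogonality makes the resulting kernel `S` vanish unless `a` and `b` are neighbours, so
the expansion collapses to matchings into blocks. -/
theorem partitionSymplectic_eq (hQ : IsAnnularPotential Q q r₀ r₁)
    (h : IsConvexProfile (logProfile q) (Real.log r₀) (Real.log r₁) δ m)
    (hψ : IsSaddle (logProfile q) (Real.log r₀) (Real.log r₁) δ ψ) {N : ℕ} (hN : 0 < N) :
    partitionSymplectic Q N = N.factorial *
      ∏ k : Fin N, (2 * radialMoment (logProfile q) (2 * N) (((k : ℝ) + 1) / N)) := by
  have hN1 : (1 : ℝ) ≤ N := by exact_mod_cast hN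
  have hint : ∀ a b : ℕ, a + b + 2 ≤ 4 * N → Integrable (fun z : ℂ =>
      z ^ a * (starRingEnd ℂ) z ^ b * (Real.exp (-(2 * (N : ℝ) * Q z)) : ℝ)) areaMeasure := by
    intro a b hab
    refine hQ.integrable_moment h hψ (by linarith) ?_
    have : ((a + b + 2 : ℕ) : ℝ) ≤ ((4 * N : ℕ) : ℝ) := by exact_mod_cast hab
    push_cast at this
    linarith
  let S : ℕ → ℕ → ℂ := fun a b => mixedMoment Q (2 * N) (a + 1) b - mixedMoment Q (2 * N) a (b + 1)
  let F : ℕ → ℕ → ℂ → ℂ := fun a b w => (w ^ a * (starRingEnd ℂ) w ^ b) *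
    (w - (starRingEnd ℂ) w) * (Real.exp (-(2 * (N : ℝ) * Q w)) : ℝ)
  have hF : ∀ a b w, F a b w =
      w ^ (a + 1) * (starRingEnd ℂ) w ^ b * (Real.exp (-(2 * (N : ℝ) * Q w)) : ℝ) -
      w ^ a * (starRingEnd ℂ) w ^ (b + 1) * (Real.exp (-(2 * (N : ℝ) * Q w)) : ℝ) := by
    intro a b w
    simp only [F]
    ring
  -- Two distinct positions below `2 N` sum to at most `4 N - 3`. With the extra power from `w -
  -- conj w`, this is just within the range of `hint`.
  have hbound : ∀ (σ : Equiv.Perm (Fin N × Fin 2)) (j : Fin N),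
      pairValue (σ (j, 0)) + pairValue (σ (j, 1)) + 3 ≤ 4 * N := by
    intro σ j
    have hlt : ∀ i : Fin N × Fin 2, pairValue i < 2 * N := by
      rintro ⟨a, x⟩
      have := a.2
      have := x.2
      simp only [pairValue]
      omega
    have hne : pairValue (σ (j, 0)) ≠ pairValue (σ (j, 1)) := fun he => by
      simpa using σ.injective (pairValue_injective he)
    have := hlt (σ (j, 0))
    have := hlt (σ (j, 1))
    omega
  have hFint : ∀ (σ : Equiv.Perm (Fin N × Fin 2)) (j : Fin N),
      Integrable (F (pairValue (σ (j, 0))) (pairValue (σ (j, 1)))) areaMeasure ∧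
      ∫ w, F (pairValue (σ (j, 0))) (pairValue (σ (j, 1))) w ∂areaMeasure =
        S (pairValue (σ (j, 0))) (pairValue (σ (j, 1))) := by
    intro σ j
    have hb := hbound σ j
    have i1 := hint (pairValue (σ (j, 0)) + 1) (pairValue (σ (j, 1))) (by omega)
    have i2 := hint (pairValue (σ (j, 0))) (pairValue (σ (j, 1)) + 1) (by omega)
    refine ⟨(i1.sub i2).congr (ae_of_all _ fun w => (hF _ _ w).symm), ?_⟩
    simp only [hF]
    rw [integral_sub i1 i2]
    rfl
  have expand : ∀ z : Fin N → ℂ, (((∏ j, ∏ k ∈ Finset.Iio j,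
        ‖z j - z k‖ ^ 2 * ‖z j - (starRingEnd ℂ) (z k)‖ ^ 2) *
      ∏ j, ‖z j - (starRingEnd ℂ) (z j)‖ ^ 2 * Real.exp (-(2 * (N : ℝ) * Q (z j))) : ℝ) : ℂ) =
      ∑ σ : Equiv.Perm (Fin N × Fin 2), ((Equiv.Perm.sign σ : ℤ) : ℂ) *
        ∏ j, F (pairValue (σ (j, 0))) (pairValue (σ (j, 1))) (z j) := by
    intro z
    rw [Finset.prod_mul_distrib, ← mul_assoc, Complex.ofReal_mul, symplectic_integrand_eq,
      Finset.sum_mul, Finset.sum_mul]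
    refine Finset.sum_congr rfl fun σ _ => ?_
    simp only [F, Finset.prod_mul_distrib, Complex.ofReal_prod]
    ring
  have hC : ((partitionSymplectic Q N : ℝ) : ℂ) = ((N.factorial *
      ∏ k : Fin N, (2 * radialMoment (logProfile q) (2 * N) (((k : ℝ) + 1) / N)) : ℝ) : ℂ) := by
    rw [partitionSymplectic, ← integral_complex_ofReal]
    simp only [expand]
    rw [integral_finsetSum _ fun σ _ => (Integrable.fintype_prod fun j => (hFint σ j).1).const_mul _]
    have hval : ∀ σ : Equiv.Perm (Fin N × Fin 2), ∫ z : Fin N → ℂ,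
        ((Equiv.Perm.sign σ : ℤ) : ℂ) *
          ∏ j, F (pairValue (σ (j, 0))) (pairValue (σ (j, 1))) (z j)
          ∂(Measure.pi fun _ => areaMeasure) = ((Equiv.Perm.sign σ : ℤ) : ℂ) *
          ∏ j, S (pairValue (σ (j, 0))) (pairValue (σ (j, 1))) := by
      intro σ
      rw [integral_const_mul, integral_fintype_prod_eq_prod (fun (j : Fin N) (w : ℂ) =>
        F (pairValue (σ (j, 0))) (pairValue (σ (j, 1))) w)]
      simp only [(hFint σ _).2]
    simp only [hval]
    rw [sum_sign_mul_prod_adjacent S (fun k => mixedMoment Q (2 * N) (2 * k + 1) (2 * k + 1))]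
    · push_cast
      congr 1
      refine Finset.prod_congr rfl fun k _ => ?_
      rw [hQ.mixedMoment_self (by positivity)]
      congr 3
      push_cast
      field_simp
      ring
    · intro k
      simp only [S]
      rw [hQ.mixedMoment_of_ne _ (by omega : 2 * k ≠ 2 * k + 1 + 1), sub_zero]
    · intro k
      simp only [S]
      rw [hQ.mixedMoment_of_ne _ (by omega : 2 * k + 1 + 1 ≠ 2 * k), zero_sub]
    · intro a b h1 h2
      simp only [S]
      rw [hQ.mixedMoment_of_ne _ (by omega : a + 1 ≠ b), hQ.mixedMoment_of_ne _ h2, sub_zero]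
  exact_mod_cast hC

end IsAnnularPotential

/-! ### Expectations in terms of distribution functions -/

section Distribution

variable {Ω : Type*} [MeasurableSpace Ω] {P : Measure Ω}

/-- The difference of the distribution functions of the point mass at `c` and the one at `x`,
weighted by `g'`. -/
noncomputable def stepKernel (g' : ℝ → ℝ) (c x t : ℝ) : ℝ :=
  ((if c ≤ t then 1 else 0) - (if x ≤ t then 1 else 0)) * g' t

theorem stepKernel_of_le {g' : ℝ → ℝ} {c x : ℝ} (h : c ≤ x) :
    stepKernel g' c x = (Set.Ico c x).indicator g' := by
  funext t
  by_cases h1 : c ≤ t <;> by_cases h2 : x ≤ t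
  · simp [stepKernel, h1, h2, Set.indicator, not_lt.2 h2]
  · simp [stepKernel, h1, h2, Set.indicator, not_le.1 h2]
  · exact absurd (h.trans h2) h1
  · simp [stepKernel, h1, h2, Set.indicator]

theorem stepKernel_of_ge {g' : ℝ → ℝ} {c x : ℝ} (h : x ≤ c) :
    stepKernel g' c x = fun t => -(Set.Ico x c).indicator g' t := by
  funext t
  by_cases h1 : c ≤ t <;> by_cases h2 : x ≤ t
  · simp [stepKernel, h1, h2, Set.indicator, not_lt.2 h1]
  · exact absurd (h.trans h1) h2
  · simp [stepKernel, h1, h2, Set.indicator, not_le.1 h1]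
  · simp [stepKernel, h1, h2, Set.indicator]

theorem integrable_stepKernel {g' : ℝ → ℝ} (hg' : Continuous g') (c x : ℝ) :
    Integrable (stepKernel g' c x) := by
  have hI : ∀ a b : ℝ, Integrable ((Set.Ico a b).indicator g') := fun a b =>
    (integrable_indicator_iff measurableSet_Ico).2
      ((hg'.continuousOn.integrableOn_Icc (a := a) (b := b)).mono_set Set.Ico_subset_Icc_self)
  rcases le_total c x with h | h
  · rw [stepKernel_of_le h]; exact hI _ _
  · rw [stepKernel_of_ge h]; exact (hI _ _).neg

theorem integral_stepKernel {g' : ℝ → ℝ} (c x : ℝ) :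
    ∫ t, stepKernel g' c x t = ∫ t in c..x, g' t := by
  rcases le_total c x with h | h
  · rw [stepKernel_of_le h, integral_indicator measurableSet_Ico, intervalIntegral.integral_of_le h,
      integral_Ico_eq_integral_Ioc]
  · rw [stepKernel_of_ge h, integral_neg, integral_indicator measurableSet_Ico,
      intervalIntegral.integral_of_ge h, integral_Ico_eq_integral_Ioc]

theorem integral_abs_stepKernel {g' : ℝ → ℝ} (c x : ℝ) :
    ∫ t, |stepKernel g' c x t| = |∫ t in c..x, abs (g' t)| := by
  have hnn : ∀ a b : ℝ, 0 ≤ ∫ t in Set.Ioc a b, |g' t| := fun a b =>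
    integral_nonneg fun _ => abs_nonneg _
  have hind : ∀ a b t : ℝ, |(Set.Ico a b).indicator g' t| =
      (Set.Ico a b).indicator (fun t => |g' t|) t := fun a b t => by
    by_cases ht : t ∈ Set.Ico a b <;> simp [ht]
  rcases le_total c x with h | h
  · rw [stepKernel_of_le h]
    simp only [hind]
    rw [integral_indicator measurableSet_Ico, intervalIntegral.integral_of_le h,
      integral_Ico_eq_integral_Ioc, abs_of_nonneg (hnn _ _)]
  · rw [stepKernel_of_ge h]
    simp only [abs_neg, hind]
    rw [integral_indicator measurableSet_Ico, intervalIntegral.integral_of_ge h,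
      integral_Ico_eq_integral_Ioc, abs_neg, abs_of_nonneg (hnn _ _)]

/-- Write `g (X) - g c` as the integral of `g'` from `c` to `X` and apply Fubini. Anchoring at `c`
makes the integrand vanish suitably at both ends of the line. -/
theorem integral_comp_eq_integral_cdf [IsProbabilityMeasure P] {X : Ω → ℝ} (hX : Measurable X)
    {g g' : ℝ → ℝ} (hg : ∀ t, HasDerivAt g (g' t) t) (hg' : Continuous g') (c : ℝ)
    (hint : Integrable (fun x => |∫ t in c..X x, abs (g' t)|) P) :
    Integrable (fun t => ((if c ≤ t then 1 else 0) - P.real {x | X x ≤ t}) * g' t) ∧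
      ∫ t, ((if c ≤ t then 1 else 0) - P.real {x | X x ≤ t}) * g' t = ∫ x, (g (X x) - g c) ∂P := by
  have hmeas : Measurable fun y : Ω × ℝ => stepKernel g' c (X y.1) y.2 := by
    unfold stepKernel
    refine Measurable.mul (Measurable.sub ?_ ?_) (hg'.measurable.comp measurable_snd)
    · exact Measurable.ite (measurableSet_le measurable_const measurable_snd) measurable_const
        measurable_const
    · exact Measurable.ite (measurableSet_le (hX.comp measurable_fst) measurable_snd)
        measurable_const measurable_const
  have hI : Integrable (fun y : Ω × ℝ => stepKernel g' c (X y.1) y.2) (P.prod volume) := by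
    rw [integrable_prod_iff hmeas.aestronglyMeasurable]
    refine ⟨ae_of_all _ fun x => integrable_stepKernel hg' c (X x), ?_⟩
    simp only [Real.norm_eq_abs, integral_abs_stepKernel]
    exact hint
  have hmarg : ∀ t, ∫ x, stepKernel g' c (X x) t ∂P =
      ((if c ≤ t then 1 else 0) - P.real {x | X x ≤ t}) * g' t := by
    intro t
    have hset : MeasurableSet {x | X x ≤ t} := measurableSet_le hX measurable_const
    have e : ∀ x, (if X x ≤ t then (1 : ℝ) else 0) = {x | X x ≤ t}.indicator (fun _ => 1) x :=
      fun x => by simp [Set.indicator]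
    simp only [stepKernel, e]
    rw [integral_mul_const, integral_sub (integrable_const _)
      ((integrable_const _).indicator hset), integral_indicator hset]
    simp
  refine ⟨?_, ?_⟩
  · refine hI.integral_prod_right.congr (ae_of_all _ fun t => ?_)
    exact hmarg t
  · simp only [← hmarg]
    rw [← integral_integral_swap (f := fun x t => stepKernel g' c (X x) t) hI]
    refine integral_congr_ae (ae_of_all _ fun x => ?_)
    simp only
    rw [integral_stepKernel]
    exact intervalIntegral.integral_eq_sub_of_hasDerivAt (fun t _ => hg t)
      (hg'.intervalIntegrable _ _)

end Distribution

/-! ### The radial energy functional -/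

/-- The density of the radial energy in terms of the distribution function `F`. -/
noncomputable def energyDensity (p : ℝ → ℝ) (u₀ : ℝ) (F : ℝ → ℝ) (t : ℝ) : ℝ :=
  ((if u₀ ≤ t then 1 else 0) - F t) * iteratedDeriv 1 p t - ((if u₀ ≤ t then 1 else 0) - F t ^ 2)

namespace IsConvexProfile

variable {p : ℝ → ℝ} {u₀ u₁ δ m : ℝ}

theorem monotone_deriv (h : IsConvexProfile p u₀ u₁ δ m) : Monotone (iteratedDeriv 1 p) :=
  monotone_of_deriv_nonneg (fun x => (h.hasDerivAt 1 x).differentiableAt) fun x => by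
    rw [(h.hasDerivAt 1 x).deriv]; exact h.convex x

theorem strictMonoOn_deriv (h : IsConvexProfile p u₀ u₁ δ m) :
    StrictMonoOn (iteratedDeriv 1 p) (Set.Icc (u₀ - δ) (u₁ + δ)) :=
  strictMonoOn_of_deriv_pos (convex_Icc _ _) (h.continuous 1).continuousOn fun x hx => by
    rw [(h.hasDerivAt 1 x).deriv]
    exact h.m_pos.trans_le (h.strict x (interior_subset hx))

theorem left_le (h : IsConvexProfile p u₀ u₁ δ m) (x : ℝ) :
    m / 2 * δ * (|x - u₀| - δ) ≤ p x - p u₀ := by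
  have hu₀ : u₀ ∈ Set.Icc u₀ u₁ := Set.left_mem_Icc.2 h.lt.le
  have e : p x - p u₀ = tangentExcess p u₀ (x - u₀) := by
    rw [tangentExcess, h.deriv_left]; simp
  have hm := h.m_pos
  have hδ := h.δ_pos
  rw [e]
  rcases le_total |x - u₀| δ with h1 | h1
  · refine le_trans ?_ (h.tangentExcess_ge_sq hu₀ h1)
    have h2 : 0 ≤ m / 2 * (x - u₀) ^ 2 := by positivity
    have h3 : m / 2 * δ * (|x - u₀| - δ) ≤ 0 :=
      mul_nonpos_of_nonneg_of_nonpos (by positivity) (by linarith)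
    linarith
  · refine le_trans ?_ (h.tangentExcess_ge_abs hu₀ h1)
    gcongr
    linarith

theorem sub_left_nonneg (h : IsConvexProfile p u₀ u₁ δ m) (x : ℝ) : 0 ≤ p x - p u₀ := by
  have := nonneg_of_second_deriv_nonneg convex_univ (Set.mem_univ u₀) (f := fun x => p x - p u₀)
    (f' := iteratedDeriv 1 p) (f'' := iteratedDeriv 2 p) (by simp) h.deriv_left
    (fun x _ => (h.hasDerivAt_self x).sub_const _) (fun x _ => h.hasDerivAt 1 x)
    (fun x _ => h.convex x) x (Set.mem_univ x)
  exact this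

theorem abs_integral_abs_deriv (h : IsConvexProfile p u₀ u₁ δ m) (x : ℝ) :
    |∫ t in u₀..x, abs (iteratedDeriv 1 p t)| = p x - p u₀ := by
  have hftc : ∫ t in u₀..x, iteratedDeriv 1 p t = p x - p u₀ :=
    intervalIntegral.integral_eq_sub_of_hasDerivAt (fun t _ => h.hasDerivAt_self t)
      ((h.continuous 1).intervalIntegrable _ _)
  rcases le_total u₀ x with hx | hx
  · rw [intervalIntegral.integral_congr (g := iteratedDeriv 1 p) fun t ht => ?_, hftc,
      abs_of_nonneg (h.sub_left_nonneg x)]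
    rw [Set.uIcc_of_le hx] at ht
    refine abs_of_nonneg ?_
    rw [← h.deriv_left]
    exact h.monotone_deriv ht.1
  · rw [intervalIntegral.integral_congr (g := fun t => -iteratedDeriv 1 p t) fun t ht => ?_,
      intervalIntegral.integral_neg, hftc, abs_neg, abs_of_nonneg (h.sub_left_nonneg x)]
    rw [Set.uIcc_of_ge hx] at ht
    refine abs_of_nonpos ?_
    rw [← h.deriv_left]
    exact h.monotone_deriv ht.2

variable {Ω : Type*} [MeasurableSpace Ω] {P : Measure Ω}

/-- Away from its minimum at `u₀` the convex function `p` grows at least linearly. -/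
theorem integrable_of_comp (h : IsConvexProfile p u₀ u₁ δ m) [IsProbabilityMeasure P] {X : Ω → ℝ}
    (hX : Measurable X) (hp : Integrable (fun x => p (X x)) P) : Integrable X P := by
  have hm := h.m_pos
  have hδ := h.δ_pos
  have hc : 0 < m / 2 * δ := by positivity
  refine (((hp.sub (integrable_const (p u₀))).const_mul (m / 2 * δ)⁻¹).add
    (integrable_const (δ + |u₀|))).mono' hX.aestronglyMeasurable (ae_of_all _ fun x => ?_)
  have h1 := h.left_le (X x)
  have h2 : |X x - u₀| - δ ≤ (m / 2 * δ)⁻¹ * (p (X x) - p u₀) := by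
    rw [le_inv_mul_iff₀ hc]; exact h1
  have h3 : |X x| ≤ |X x - u₀| + |u₀| := by
    simpa using abs_add_le (X x - u₀) u₀
  simp only [Real.norm_eq_abs, Pi.add_apply, Pi.sub_apply]
  linarith

/-- The formula for distribution functions is used twice: for `p (X)`, and for the maximum of two
independent copies of `X`, whose distribution function is `F²`. -/
theorem integral_energyDensity (h : IsConvexProfile p u₀ u₁ δ m) [IsProbabilityMeasure P]
    {X : Ω → ℝ} (hX : Measurable X) (hp : Integrable (fun x => p (X x)) P) :
    Integrable (energyDensity p u₀ fun t => P.real {x | X x ≤ t}) ∧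
      ∫ t, energyDensity p u₀ (fun t => P.real {x | X x ≤ t}) t =
        ((∫ x, p (X x) ∂P) - ∫ y : Ω × Ω, max (X y.1) (X y.2) ∂(P.prod P)) - (p u₀ - u₀) := by
  have hXi := h.integrable_of_comp hX hp
  obtain ⟨i1, v1⟩ := integral_comp_eq_integral_cdf (P := P) hX h.hasDerivAt_self (h.continuous 1) u₀
    (by
      simp only [h.abs_integral_abs_deriv]
      exact hp.sub (integrable_const _))
  have hmax : Measurable fun y : Ω × Ω => max (X y.1) (X y.2) :=
    (hX.comp measurable_fst).max (hX.comp measurable_snd)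
  have hmaxi : Integrable (fun y : Ω × Ω => max (X y.1) (X y.2)) (P.prod P) :=
    (hXi.comp_fst P).sup (hXi.comp_snd P)
  obtain ⟨i2, v2⟩ := integral_comp_eq_integral_cdf (P := P.prod P) hmax (g := id)
    (g' := fun _ => 1) hasDerivAt_id continuous_const u₀ (by
      simp only [abs_one, intervalIntegral.integral_const, smul_eq_mul, mul_one]
      exact (hmaxi.sub (integrable_const _)).abs)
  have hF : ∀ t, (P.prod P).real {y : Ω × Ω | max (X y.1) (X y.2) ≤ t} =
      P.real {x | X x ≤ t} ^ 2 := by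
    intro t
    have : {y : Ω × Ω | max (X y.1) (X y.2) ≤ t} = {x | X x ≤ t} ×ˢ {x | X x ≤ t} := by
      ext y; simp
    rw [this, measureReal_prod_prod, sq]
  simp only [hF, mul_one] at i2 v2
  refine ⟨i1.sub i2, ?_⟩
  simp only [energyDensity]
  rw [integral_sub i1 i2, v1, v2, integral_sub hp (integrable_const _), id, integral_sub]
  · simp; ring
  · exact hmaxi
  · exact integrable_const _

/-- The radial energy density is minimized by the distribution function `p' / 2`, truncated to
`[0, 1]`, and grows quadratically away from it. -/
theorem energyDensity_sub_ge (h : IsConvexProfile p u₀ u₁ δ m) {F G : ℝ → ℝ} {t : ℝ}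
    (hF0 : 0 ≤ F t) (hF1 : F t ≤ 1) (hG0 : t < u₀ → G t = 0)
    (hG : u₀ ≤ t → t ≤ u₁ → G t = iteratedDeriv 1 p t / 2) (hG1 : u₁ < t → G t = 1) :
    (F t - G t) ^ 2 ≤ energyDensity p u₀ F t - energyDensity p u₀ G t := by
  -- The density is `F² - F p'` plus a term free of `F`. The linear term below is nonnegative: it
  -- vanishes on `[u₀, u₁]`, and outside `G` sits at the end of `[0, 1]` preferred by the sign of `2
  -- G - p'`.
  have key : energyDensity p u₀ F t - energyDensity p u₀ G t =
      (F t - G t) ^ 2 + (F t - G t) * (2 * G t - iteratedDeriv 1 p t) := by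
    simp only [energyDensity]; ring
  rw [key]
  refine le_add_of_nonneg_right ?_
  rcases lt_or_ge t u₀ with h1 | h1
  · rw [hG0 h1]
    have := h.monotone_deriv h1.le
    rw [h.deriv_left] at this
    exact mul_nonneg (by linarith) (by linarith)
  · rcases le_or_gt t u₁ with h2 | h2
    · rw [hG h1 h2]
      have : 2 * (iteratedDeriv 1 p t / 2) - iteratedDeriv 1 p t = 0 := by ring
      rw [this, mul_zero]
    · rw [hG1 h2]
      have := h.monotone_deriv h2.le
      rw [h.deriv_right] at this
      exact mul_nonneg_of_nonpos_of_nonpos (by linarith) (by linarith)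

end IsConvexProfile

/-- Lebesgue measure on the unit interval. -/
noncomputable def unitMeasure : Measure ℝ := volume.restrict (Set.Ioc 0 1)

instance : IsProbabilityMeasure unitMeasure := ⟨by simp [unitMeasure]⟩

theorem integral_unitMeasure (f : ℝ → ℝ) : ∫ s, f s ∂unitMeasure = ∫ s in (0 : ℝ)..1, f s := by
  rw [unitMeasure, intervalIntegral.integral_of_le zero_le_one]

theorem ae_unitMeasure : ∀ᵐ s ∂unitMeasure, s ∈ Set.Icc (0 : ℝ) 1 :=
  (ae_restrict_mem measurableSet_Ioc).mono fun _ h => Set.Ioc_subset_Icc_self h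

theorem integrable_unitMeasure {f : ℝ → ℝ} (hf : Continuous f) : Integrable f unitMeasure :=
  (hf.continuousOn.integrableOn_Icc (a := 0) (b := 1)).mono_set Set.Ioc_subset_Icc_self

/-! ### The saddle as the quantile function of `p' / 2` -/

namespace IsSaddle

variable {p : ℝ → ℝ} {u₀ u₁ δ m : ℝ} {ψ : ℝ → ℝ}

theorem le_iff (hψ : IsSaddle p u₀ u₁ δ ψ) (h : IsConvexProfile p u₀ u₁ δ m) {s t : ℝ}
    (hs : s ∈ Set.Icc (0 : ℝ) 1) (ht : t ∈ Set.Icc u₀ u₁) :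
    ψ s ≤ t ↔ s ≤ iteratedDeriv 1 p t / 2 := by
  rw [← h.strictMonoOn_deriv.le_iff_le (hψ.mem_enlarged s) (h.mem_enlarged ht),
    hψ.deriv_eq s hs, le_div_iff₀ two_pos, mul_comm]

theorem strictMonoOn (hψ : IsSaddle p u₀ u₁ δ ψ) (h : IsConvexProfile p u₀ u₁ δ m) :
    StrictMonoOn ψ (Set.Icc 0 1) := by
  intro s hs t ht hst
  rw [← h.strictMonoOn_deriv.lt_iff_lt (hψ.mem_enlarged s) (hψ.mem_enlarged t),
    hψ.deriv_eq s hs, hψ.deriv_eq t ht]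
  linarith

theorem cdf_of_lt (hψ : IsSaddle p u₀ u₁ δ ψ) {t : ℝ} (ht : t < u₀) :
    unitMeasure.real {s | ψ s ≤ t} = 0 := by
  have : unitMeasure {s | ψ s ≤ t} = 0 := by
    refine measure_mono_null (t := {s | ¬ s ∈ Set.Icc (0 : ℝ) 1}) (fun s hs hs' => ?_) ae_unitMeasure
    exact absurd ((hψ.mem s hs').1.trans hs) (not_le.2 ht)
  simp [Measure.real, this]

theorem cdf_of_gt (hψ : IsSaddle p u₀ u₁ δ ψ) {t : ℝ} (ht : u₁ < t) :
    unitMeasure.real {s | ψ s ≤ t} = 1 := by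
  have : unitMeasure {s | ψ s ≤ t} = 1 := by
    refine (prob_compl_eq_zero_iff (measurableSet_le hψ.continuous.measurable
      measurable_const)).1 ?_
    refine measure_mono_null (t := {s | ¬ s ∈ Set.Icc (0 : ℝ) 1}) (fun s hs hs' => ?_) ae_unitMeasure
    exact hs ((hψ.mem s hs').2.trans ht.le)
  simp [Measure.real, this]

theorem cdf_of_mem (hψ : IsSaddle p u₀ u₁ δ ψ) (h : IsConvexProfile p u₀ u₁ δ m) {t : ℝ}
    (ht : t ∈ Set.Icc u₀ u₁) : unitMeasure.real {s | ψ s ≤ t} = iteratedDeriv 1 p t / 2 := by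
  have h0 := h.monotone_deriv ht.1
  have h1 := h.monotone_deriv ht.2
  rw [h.deriv_left] at h0
  rw [h.deriv_right] at h1
  have e : {s | ψ s ≤ t} ∩ Set.Ioc 0 1 = Set.Ioc 0 (iteratedDeriv 1 p t / 2) := by
    ext s
    constructor
    · rintro ⟨hs, hs'⟩
      exact ⟨hs'.1, (hψ.le_iff h (Set.Ioc_subset_Icc_self hs') ht).1 hs⟩
    · rintro ⟨hs, hs'⟩
      have hs1 : s ≤ 1 := by linarith
      exact ⟨(hψ.le_iff h ⟨hs.le, hs1⟩ ht).2 hs', hs, hs1⟩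
  rw [Measure.real, unitMeasure,
    Measure.restrict_apply (measurableSet_le hψ.continuous.measurable measurable_const), e,
    Real.volume_Ioc, sub_zero, ENNReal.toReal_ofReal (by linarith)]

end IsSaddle

/-! ### Logarithmic energy and the radial part of a measure -/

section PositiveKernel

variable {Ω : Type*} [MeasurableSpace Ω] {P : Measure Ω} [IsProbabilityMeasure P]

/-- A minimum of nonnegative numbers is `∫ 1_{0 < r < c} 1_{r < c'} dr`, so the double integral
equals `∫ ‖∫ φ z r dP‖² dr`. The bound on `‖g‖² c` justifies Fubini. -/
theorem re_integral_min_kernel_nonneg {g : Ω → ℂ} {c : Ω → ℝ} (hg : Measurable g)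
    (hc : Measurable c) (hc0 : ∀ z, 0 ≤ c z) (hgc : ∀ z, ‖g z‖ ^ 2 * c z ≤ 1) :
    0 ≤ (∫ y : Ω × Ω, g y.1 * (starRingEnd ℂ) (g y.2) * ((min (c y.1) (c y.2) : ℝ) : ℂ)
      ∂(P.prod P)).re := by
  set φ : Ω → ℝ → ℂ := fun z r => if 0 < r ∧ r < c z then g z else 0 with hφ
  have hφm : Measurable fun y : Ω × ℝ => φ y.1 y.2 := by
    refine Measurable.ite ?_ (hg.comp measurable_fst) measurable_const
    exact (measurableSet_lt measurable_const measurable_snd).inter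
      (measurableSet_lt measurable_snd (hc.comp measurable_fst))
  have hprod : ∀ (z w : Ω) (r : ℝ), φ z r * (starRingEnd ℂ) (φ w r) =
      (Set.Ioo 0 (min (c z) (c w))).indicator (fun _ => g z * (starRingEnd ℂ) (g w)) r := by
    intro z w r
    simp only [hφ, Set.indicator, Set.mem_Ioo, lt_min_iff]
    by_cases h0 : 0 < r <;> by_cases h1 : r < c z <;> by_cases h2 : r < c w <;>
      simp [h0, h1, h2]
  have hmin : ∀ z w, 0 ≤ min (c z) (c w) := fun z w => le_min (hc0 z) (hc0 w)
  have hvol : ∀ z w, (volume (Set.Ioo 0 (min (c z) (c w)))).toReal = min (c z) (c w) :=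
    fun z w => by rw [Real.volume_Ioo, sub_zero, ENNReal.toReal_ofReal (hmin z w)]
  have hI : Integrable (fun y : (Ω × Ω) × ℝ => φ y.1.1 y.2 * (starRingEnd ℂ) (φ y.1.2 y.2))
      ((P.prod P).prod volume) := by
    have hm : Measurable fun y : (Ω × Ω) × ℝ => φ y.1.1 y.2 * (starRingEnd ℂ) (φ y.1.2 y.2) := by
      refine Measurable.mul ?_ (Complex.continuous_conj.measurable.comp ?_)
      · exact hφm.comp ((measurable_fst.comp measurable_fst).prodMk measurable_snd)
      · exact hφm.comp ((measurable_snd.comp measurable_fst).prodMk measurable_snd)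
    rw [integrable_prod_iff hm.aestronglyMeasurable]
    refine ⟨ae_of_all _ fun y => ?_, ?_⟩
    · simp only [hprod]
      exact (integrable_indicator_iff measurableSet_Ioo).2
        (integrableOn_const (by rw [Real.volume_Ioo]; exact ENNReal.ofReal_ne_top))
    · refine Integrable.mono' (integrable_const (1 : ℝ))
        hm.norm.aestronglyMeasurable.integral_prod_right' (ae_of_all _ fun y => ?_)
      simp only [hprod, norm_indicator_eq_indicator_norm]
      rw [integral_indicator measurableSet_Ioo, setIntegral_const, Measure.real, hvol, smul_eq_mul,
        norm_mul, norm_norm, norm_mul, Complex.norm_conj, Real.norm_of_nonneg (hmin _ _)]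
      have h1 := hgc y.1
      have h2 := hgc y.2
      have h3 : min (c y.1) (c y.2) * ‖g y.1‖ ^ 2 ≤ 1 := by
        rw [mul_comm]
        exact (mul_le_mul_of_nonneg_left (min_le_left _ _) (by positivity)).trans h1
      have h4 : min (c y.1) (c y.2) * ‖g y.2‖ ^ 2 ≤ 1 := by
        rw [mul_comm]
        exact (mul_le_mul_of_nonneg_left (min_le_right _ _) (by positivity)).trans h2
      have h5 := mul_nonneg (hmin y.1 y.2) (sq_nonneg (‖g y.1‖ - ‖g y.2‖))
      nlinarith
  have e : ∫ y : Ω × Ω, g y.1 * (starRingEnd ℂ) (g y.2) * ((min (c y.1) (c y.2) : ℝ) : ℂ)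
      ∂(P.prod P) = ∫ r, ((‖∫ z, φ z r ∂P‖ ^ 2 : ℝ) : ℂ) := by
    have h1 := integral_integral_swap
      (f := fun (y : Ω × Ω) r => φ y.1 r * (starRingEnd ℂ) (φ y.2 r)) hI
    have h2 : ∀ y : Ω × Ω, ∫ r, φ y.1 r * (starRingEnd ℂ) (φ y.2 r) =
        g y.1 * (starRingEnd ℂ) (g y.2) * ((min (c y.1) (c y.2) : ℝ) : ℂ) := by
      intro y
      simp only [hprod]
      rw [integral_indicator measurableSet_Ioo, setIntegral_const, Measure.real, hvol,
        Complex.real_smul, mul_comm]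
    have h3 : ∀ r, ∫ y : Ω × Ω, φ y.1 r * (starRingEnd ℂ) (φ y.2 r) ∂(P.prod P) =
        ((‖∫ z, φ z r ∂P‖ ^ 2 : ℝ) : ℂ) := by
      intro r
      rw [integral_prod_mul (fun z => φ z r) (fun z => (starRingEnd ℂ) (φ z r)), integral_conj,
        Complex.mul_conj, Complex.normSq_eq_norm_sq]
    simp only [h2, h3] at h1
    exact h1
  rw [e, integral_complex_ofReal, Complex.ofReal_re]
  exact integral_nonneg fun r => by positivity

end PositiveKernel

/-- The ratio of two complex numbers, normalized to lie in the closed unit disc. -/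
noncomputable def discRatio (z w : ℂ) : ℂ :=
  z * (starRingEnd ℂ) w * ((min (‖z‖ ^ 2)⁻¹ (‖w‖ ^ 2)⁻¹ : ℝ) : ℂ)

theorem measurable_discRatio : Measurable fun y : ℂ × ℂ => discRatio y.1 y.2 := by
  unfold discRatio
  refine Measurable.mul (measurable_fst.mul (Complex.continuous_conj.measurable.comp measurable_snd))
    (Complex.measurable_ofReal.comp (Measurable.min ?_ ?_))
  · exact (measurable_fst.norm.pow_const 2).inv
  · exact (measurable_snd.norm.pow_const 2).inv

theorem discRatio_swap (z w : ℂ) : discRatio w z = (starRingEnd ℂ) (discRatio z w) := by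
  simp only [discRatio, map_mul, Complex.conj_conj, Complex.conj_ofReal, min_comm]
  ring

theorem discRatio_of_le {z w : ℂ} (hz : z ≠ 0) (hw : w ≠ 0) (h : ‖w‖ ≤ ‖z‖) :
    discRatio z w = (starRingEnd ℂ) (w / z) := by
  have hw' : 0 < ‖w‖ := norm_pos_iff.2 hw
  have h1 : (‖z‖ ^ 2)⁻¹ ≤ (‖w‖ ^ 2)⁻¹ := by gcongr
  have hc : (starRingEnd ℂ) z ≠ 0 := (map_ne_zero _).2 hz
  rw [discRatio, min_eq_left h1, map_div₀, Complex.ofReal_inv, ← Complex.normSq_eq_norm_sq,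
    ← Complex.mul_conj]
  field_simp

theorem norm_discRatio_le (z w : ℂ) : ‖discRatio z w‖ ≤ 1 := by
  have key : ∀ {z w : ℂ}, z ≠ 0 → w ≠ 0 → ‖w‖ ≤ ‖z‖ → ‖discRatio z w‖ ≤ 1 := by
    intro z w hz hw h
    rw [discRatio_of_le hz hw h, Complex.norm_conj, norm_div]
    exact div_le_one_of_le₀ h (norm_nonneg _)
  by_cases hz : z = 0
  · simp [discRatio, hz]
  by_cases hw : w = 0
  · simp [discRatio, hw]
  rcases le_total ‖w‖ ‖z‖ with h | h
  · exact key hz hw h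
  · rw [discRatio_swap w z, Complex.norm_conj]
    exact key hw hz h

theorem max_norm_mul_norm_one_sub_discRatio {z w : ℂ} (hz : z ≠ 0) (hw : w ≠ 0) :
    max ‖z‖ ‖w‖ * ‖1 - discRatio z w‖ = ‖z - w‖ := by
  have key : ∀ {z w : ℂ}, z ≠ 0 → w ≠ 0 → ‖w‖ ≤ ‖z‖ →
      max ‖z‖ ‖w‖ * ‖1 - discRatio z w‖ = ‖z - w‖ := by
    intro z w hz hw h
    rw [discRatio_of_le hz hw h, max_eq_left h]
    have : (1 : ℂ) - (starRingEnd ℂ) (w / z) = (starRingEnd ℂ) (1 - w / z) := by simp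
    rw [this, Complex.norm_conj, ← norm_mul]
    congr 1
    field_simp
  rcases le_total ‖w‖ ‖z‖ with h | h
  · exact key hz hw h
  · have : (1 : ℂ) - discRatio z w = (starRingEnd ℂ) (1 - discRatio w z) := by
      rw [discRatio_swap w z]; simp
    rw [this, Complex.norm_conj, max_comm, key hw hz h, norm_sub_rev]

section Energy

variable {ν : Measure ℂ} [IsProbabilityMeasure ν]

theorem re_integral_discRatio_pow_nonneg {k : ℕ} (hk : k ≠ 0) :
    0 ≤ (∫ y : ℂ × ℂ, discRatio y.1 y.2 ^ k ∂(ν.prod ν)).re := by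
  have h := re_integral_min_kernel_nonneg (P := ν) (g := fun z => z ^ k)
    (c := fun z => ((‖z‖ ^ 2)⁻¹) ^ k) (measurable_id.pow_const k)
    (((measurable_norm.pow_const 2).inv).pow_const k) (fun z => by positivity) (fun z => by
      by_cases hz : z = 0
      · simp [hz, hk]
      · have : ‖z‖ ≠ 0 := norm_ne_zero_iff.2 hz
        rw [norm_pow, inv_pow, ← pow_mul, ← pow_mul, mul_comm k 2]
        exact (mul_inv_cancel₀ (pow_ne_zero _ this)).le)
  convert h using 3
  funext y
  have hmin : min (((‖y.1‖ ^ 2)⁻¹) ^ k) (((‖y.2‖ ^ 2)⁻¹) ^ k) =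
      (min (‖y.1‖ ^ 2)⁻¹ (‖y.2‖ ^ 2)⁻¹) ^ k := by
    rcases le_total (‖y.1‖ ^ 2)⁻¹ (‖y.2‖ ^ 2)⁻¹ with h' | h'
    · rw [min_eq_left h', min_eq_left (pow_le_pow_left₀ (by positivity) h' k)]
    · rw [min_eq_right h', min_eq_right (pow_le_pow_left₀ (by positivity) h' k)]
  rw [hmin, discRatio, mul_pow, mul_pow, map_pow, Complex.ofReal_pow]

/-- Expand `-log (1 - ρ x) = ∑ ρ ^ n x ^ n / n`; each power of the ratio has an integral with
nonnegative real part. The factor `ρ < 1` makes the series converge uniformly. -/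
theorem integral_log_norm_one_sub_mul_discRatio_nonpos {ρ : ℝ} (h0 : 0 ≤ ρ) (h1 : ρ < 1) :
    ∫ y : ℂ × ℂ, Real.log ‖1 - ρ * discRatio y.1 y.2‖ ∂(ν.prod ν) ≤ 0 := by
  set F : ℕ → ℂ × ℂ → ℂ := fun n y => (ρ * discRatio y.1 y.2) ^ n / n with hF
  have hnorm : ∀ y : ℂ × ℂ, ‖(ρ : ℂ) * discRatio y.1 y.2‖ ≤ ρ := fun y => by
    rw [norm_mul, Complex.norm_real, Real.norm_of_nonneg h0]
    exact mul_le_of_le_one_right h0 (norm_discRatio_le _ _)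
  have hsum : ∀ y, HasSum (fun n => F n y) (-Complex.log (1 - ρ * discRatio y.1 y.2)) := fun y =>
    Complex.hasSum_taylorSeries_neg_log ((hnorm y).trans_lt h1)
  have hFb : ∀ n y, ‖F n y‖ ≤ ρ ^ n := by
    intro n y
    simp only [hF, norm_div, norm_pow, Complex.norm_natCast]
    rcases Nat.eq_zero_or_pos n with rfl | hn
    · simp
    · exact (div_le_self (by positivity) (by exact_mod_cast hn)).trans
        (pow_le_pow_left₀ (norm_nonneg _) (hnorm y) n)
  have hFm : ∀ n, Measurable (F n) := fun n =>
    ((measurable_const.mul measurable_discRatio).pow_const n).div_const _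
  have hFi : ∀ n, Integrable (F n) (ν.prod ν) := fun n =>
    (integrable_const (ρ ^ n)).mono' (hFm n).aestronglyMeasurable (ae_of_all _ (hFb n))
  have hs : Summable fun n => ∫ y, ‖F n y‖ ∂(ν.prod ν) := by
    refine Summable.of_nonneg_of_le (fun n => integral_nonneg fun _ => norm_nonneg _) (fun n => ?_)
      (summable_geometric_of_lt_one h0 h1)
    calc ∫ y, ‖F n y‖ ∂(ν.prod ν) ≤ ∫ _, ρ ^ n ∂(ν.prod ν) :=
          integral_mono (hFi n).norm (integrable_const _) (hFb n)
      _ = ρ ^ n := by simp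
  have key := hasSum_integral_of_summable_integral_norm hFi hs
  have e : ∀ y : ℂ × ℂ, ∑' n, F n y = -Complex.log (1 - ρ * discRatio y.1 y.2) := fun y => (hsum y).tsum_eq
  simp only [e] at key
  have hnn : ∀ n, 0 ≤ (∫ y, F n y ∂(ν.prod ν)).re := by
    intro n
    rcases Nat.eq_zero_or_pos n with rfl | hn
    · simp [hF]
    · have : ∀ y, F n y = ((ρ ^ n / n : ℝ) : ℂ) * discRatio y.1 y.2 ^ n := fun y => by
        simp only [hF, mul_pow]; push_cast; ring
      simp only [this]
      rw [integral_const_mul, Complex.re_ofReal_mul]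
      exact mul_nonneg (by positivity) (re_integral_discRatio_pow_nonneg hn.ne')
  have hre := (Complex.hasSum_re key).nonneg hnn
  have hli : Integrable (fun y : ℂ × ℂ => -Complex.log (1 - ρ * discRatio y.1 y.2)) (ν.prod ν) := by
    have hb : ∀ y : ℂ × ℂ, ‖-Complex.log (1 - ρ * discRatio y.1 y.2)‖ ≤ ∑' n : ℕ, ρ ^ n := fun y =>
      (hsum y).norm_le_of_bounded (summable_geometric_of_lt_one h0 h1).hasSum fun n => hFb n y
    refine (integrable_const _).mono' ?_ (ae_of_all _ hb)
    exact ((measurable_const.sub (measurable_const.mul measurable_discRatio)).clog).neg.aestronglyMeasurable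
  have hr : (∫ y : ℂ × ℂ, -Complex.log (1 - ρ * discRatio y.1 y.2) ∂(ν.prod ν)).re =
      -∫ y : ℂ × ℂ, Real.log ‖1 - ρ * discRatio y.1 y.2‖ ∂(ν.prod ν) := by
    have := integral_re (𝕜 := ℂ) hli
    simp only [RCLike.re_to_complex] at this
    rw [← this, ← integral_neg]
    simp [Complex.log_re]
  rw [hr] at hre
  linarith

/-- A majorant independent of `ρ` for the limit `ρ → 1`, resting on `‖1 - x‖ ≤ 2 ‖1 - ρ x‖`. -/
theorem abs_log_norm_one_sub_mul_le {x : ℂ} (hx : ‖x‖ ≤ 1) (hx1 : x ≠ 1) {ρ : ℝ} (h0 : 0 ≤ ρ)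
    (h1 : ρ < 1) :
    |Real.log ‖1 - ρ * x‖| ≤ Real.log 2 + |Real.log ‖1 - x‖| := by
  have hρx : ‖(ρ : ℂ) * x‖ ≤ ρ := by
    rw [norm_mul, Complex.norm_real, Real.norm_of_nonneg h0]
    exact mul_le_of_le_one_right h0 hx
  have hlow : 1 - ρ ≤ ‖1 - ρ * x‖ := by
    have := norm_sub_norm_le (1 : ℂ) (ρ * x)
    rw [norm_one] at this
    linarith
  have hup : ‖1 - ρ * x‖ ≤ 2 := by
    have := norm_sub_le (1 : ℂ) (ρ * x)
    rw [norm_one] at this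
    linarith
  have hpos : 0 < ‖1 - ρ * x‖ := by linarith
  have hpos' : 0 < ‖1 - x‖ := norm_pos_iff.2 (sub_ne_zero.2 hx1.symm)
  have hcmp : ‖1 - x‖ ≤ 2 * ‖1 - ρ * x‖ := by
    have e : 1 - x = (1 - ρ * x) - ((1 - ρ : ℝ) : ℂ) * x := by push_cast; ring
    have h2 : ‖((1 - ρ : ℝ) : ℂ) * x‖ ≤ 1 - ρ := by
      rw [norm_mul, Complex.norm_real, Real.norm_of_nonneg (by linarith)]
      exact mul_le_of_le_one_right (by linarith) hx
    have h3 := norm_sub_le (1 - ρ * x) (((1 - ρ : ℝ) : ℂ) * x)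
    rw [← e] at h3
    linarith
  have l1 := Real.log_le_log hpos hup
  have l2 := Real.log_le_log hpos' hcmp
  rw [Real.log_mul two_ne_zero hpos.ne'] at l2
  rw [abs_le]
  constructor
  · have := neg_abs_le (Real.log ‖1 - x‖)
    linarith
  · have := abs_nonneg (Real.log ‖1 - x‖)
    linarith

theorem integral_log_norm_one_sub_discRatio_nonpos
    (hne : ∀ᵐ y ∂(ν.prod ν), discRatio y.1 y.2 ≠ 1)
    (hi : Integrable (fun y : ℂ × ℂ => Real.log ‖1 - discRatio y.1 y.2‖) (ν.prod ν)) :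
    ∫ y : ℂ × ℂ, Real.log ‖1 - discRatio y.1 y.2‖ ∂(ν.prod ν) ≤ 0 := by
  set ρ : ℕ → ℝ := fun n => 1 - 1 / ((n : ℝ) + 1) with hρ
  have hρ0 : ∀ n, 0 ≤ ρ n := fun n => by
    have : 1 / ((n : ℝ) + 1) ≤ 1 := by
      rw [div_le_one (by positivity)]; linarith [Nat.cast_nonneg (α := ℝ) n]
    simp only [hρ]; linarith
  have hρ1 : ∀ n, ρ n < 1 := fun n => by
    have : 0 < 1 / ((n : ℝ) + 1) := by positivity
    simp only [hρ]; linarith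
  have hρt : Tendsto ρ atTop (𝓝 1) := by
    simpa only [sub_zero] using (tendsto_one_div_add_atTop_nhds_zero_nat (𝕜 := ℝ)).const_sub 1
  have key : Tendsto
      (fun n => ∫ y : ℂ × ℂ, Real.log ‖1 - ρ n * discRatio y.1 y.2‖ ∂(ν.prod ν)) atTop
      (𝓝 (∫ y : ℂ × ℂ, Real.log ‖1 - discRatio y.1 y.2‖ ∂(ν.prod ν))) := by
    refine tendsto_integral_of_dominated_convergence
      (fun y => Real.log 2 + |Real.log ‖1 - discRatio y.1 y.2‖|) (fun n => ?_)
      ((integrable_const _).add hi.abs) (fun n => ?_) ?_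
    · exact (measurable_const.sub
        (measurable_const.mul measurable_discRatio)).norm.log.aestronglyMeasurable
    · filter_upwards [hne] with y hy
      exact abs_log_norm_one_sub_mul_le (norm_discRatio_le _ _) hy (hρ0 n) (hρ1 n)
    · filter_upwards [hne] with y hy
      have h1 : Tendsto (fun n => ‖1 - (ρ n : ℂ) * discRatio y.1 y.2‖) atTop
          (𝓝 ‖1 - discRatio y.1 y.2‖) := by
        have h2 : Tendsto (fun n => (ρ n : ℂ)) atTop (𝓝 ((1 : ℝ) : ℂ)) :=
          (Complex.continuous_ofReal.tendsto 1).comp hρt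
        simpa using (tendsto_const_nhds.sub (h2.mul_const (discRatio y.1 y.2))).norm
      exact h1.log (norm_ne_zero_iff.2 (sub_ne_zero.2 hy.symm))
  exact le_of_tendsto' key fun n =>
    integral_log_norm_one_sub_mul_discRatio_nonpos (hρ0 n) (hρ1 n)

theorem ae_prod_ne (hν : ∀ z, ν {z} = 0) : ∀ᵐ y ∂(ν.prod ν), y.1 ≠ y.2 := by
  have hm : MeasurableSet {y : ℂ × ℂ | y.1 = y.2} := measurableSet_eq_fun measurable_fst measurable_snd
  have : (ν.prod ν) {y : ℂ × ℂ | y.1 = y.2} = 0 := by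
    rw [Measure.measure_prod_null hm]
    refine ae_of_all _ fun z => ?_
    have : Prod.mk z ⁻¹' {y : ℂ × ℂ | y.1 = y.2} = {z} := by
      ext w; simp [eq_comm]
    simp only [this, Pi.zero_apply]; exact hν z
  exact measure_eq_zero_iff_ae_notMem.1 this

/-- Off a null set `log |z - w|` is the maximum of the logarithmic radii plus `log |1 - discRatio z
w|`, and the latter has nonpositive mean. The absence of atoms disposes of the diagonal and of the
origin. -/
theorem integral_log_max_norm_ge (hν : ∀ z, ν {z} = 0)
    (hlog : Integrable (fun y : ℂ × ℂ => Real.log (1 / ‖y.1 - y.2‖)) (ν.prod ν))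
    (hrad : Integrable (fun z : ℂ => Real.log ‖z‖) ν) :
    -∫ y : ℂ × ℂ, max (Real.log ‖y.1‖) (Real.log ‖y.2‖) ∂(ν.prod ν) ≤
      ∫ y : ℂ × ℂ, Real.log (1 / ‖y.1 - y.2‖) ∂(ν.prod ν) := by
  have hz : ∀ᵐ z ∂ν, z ≠ 0 := measure_eq_zero_iff_ae_notMem.1 (hν 0)
  have h1 : ∀ᵐ y ∂(ν.prod ν), y.1 ≠ 0 := Measure.quasiMeasurePreserving_fst.ae hz
  have h2 : ∀ᵐ y ∂(ν.prod ν), y.2 ≠ 0 := Measure.quasiMeasurePreserving_snd.ae hz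
  have hne : ∀ᵐ y ∂(ν.prod ν), discRatio y.1 y.2 ≠ 1 := by
    filter_upwards [h1, h2, ae_prod_ne hν] with y y1 y2 hy h
    have := max_norm_mul_norm_one_sub_discRatio y1 y2
    rw [h, sub_self, norm_zero, mul_zero, eq_comm, norm_eq_zero, sub_eq_zero] at this
    exact hy this
  have hdecomp : ∀ᵐ y ∂(ν.prod ν), Real.log ‖1 - discRatio y.1 y.2‖ =
      -Real.log (1 / ‖y.1 - y.2‖) - max (Real.log ‖y.1‖) (Real.log ‖y.2‖) := by
    filter_upwards [h1, h2, hne] with y y1 y2 hy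
    have p1 := norm_pos_iff.2 y1
    have p2 := norm_pos_iff.2 y2
    have hmax : max (Real.log ‖y.1‖) (Real.log ‖y.2‖) = Real.log (max ‖y.1‖ ‖y.2‖) := by
      rcases le_total ‖y.1‖ ‖y.2‖ with h | h
      · rw [max_eq_right h, max_eq_right (Real.log_le_log p1 h)]
      · rw [max_eq_left h, max_eq_left (Real.log_le_log p2 h)]
    rw [hmax, ← max_norm_mul_norm_one_sub_discRatio y1 y2, one_div, Real.log_inv,
      Real.log_mul (p1.trans_le (le_max_left _ _)).ne'
        (norm_ne_zero_iff.2 (sub_ne_zero.2 hy.symm))]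
    ring
  have hmaxi : Integrable (fun y : ℂ × ℂ => max (Real.log ‖y.1‖) (Real.log ‖y.2‖)) (ν.prod ν) :=
    (hrad.comp_fst ν).sup (hrad.comp_snd ν)
  have hi := (hlog.neg.sub hmaxi).congr (hdecomp.mono fun y hy => hy.symm)
  have := integral_log_norm_one_sub_discRatio_nonpos hne hi
  rw [integral_congr_ae hdecomp, integral_sub hlog.fun_neg hmaxi, integral_neg] at this
  linarith

end Energy

/-! ### Rotation invariant measures with a prescribed radial part -/

/-- Since `|f| ≤ 2 C - f`, lower bounds on the inner integrals control the absolute value. This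
suits the logarithm, which is bounded above but not below. -/
theorem integrable_prod_of_le {α β : Type*} [MeasurableSpace α] [MeasurableSpace β]
    {μ : Measure α} {ν : Measure β} [IsProbabilityMeasure μ] [IsProbabilityMeasure ν]
    {f : α × β → ℝ} (hf : Measurable f) {C : ℝ} (hle : ∀ᵐ x ∂μ, ∀ᵐ y ∂ν, f (x, y) ≤ C)
    (hint : ∀ᵐ x ∂μ, Integrable (fun y => f (x, y)) ν)
    (hge : ∀ᵐ x ∂μ, -C ≤ ∫ y, f (x, y) ∂ν) (hC : 0 ≤ C) : Integrable f (μ.prod ν) := by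
  rw [integrable_prod_iff hf.aestronglyMeasurable]
  refine ⟨hint, (integrable_const (3 * C)).mono'
    hf.norm.aestronglyMeasurable.integral_prod_right' ?_⟩
  filter_upwards [hle, hint, hge] with x h1 h2 h3
  rw [Real.norm_of_nonneg (integral_nonneg fun _ => norm_nonneg _)]
  calc ∫ y, ‖f (x, y)‖ ∂ν ≤ ∫ y, (2 * C - f (x, y)) ∂ν := by
        refine integral_mono_ae h2.norm ((integrable_const _).sub h2) ?_
        filter_upwards [h1] with y hy
        rw [Real.norm_eq_abs, abs_le']
        constructor <;> linarith
    _ = 2 * C - ∫ y, f (x, y) ∂ν := by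
        rw [integral_sub (integrable_const _) h2]; simp
    _ ≤ 3 * C := by linarith

/-- Polar coordinates with the angle measured in full turns and the radius equal to `exp (ψ s)`. -/
noncomputable def polarMap (ψ : ℝ → ℝ) (y : ℝ × ℝ) : ℂ :=
  circleMap 0 (Real.exp (ψ y.1)) (2 * Real.pi * y.2)

/-- The rotation invariant probability measure for which `log |z|` is distributed as `ψ` on the
unit interval. -/
noncomputable def circularMeasure (ψ : ℝ → ℝ) : Measure ℂ :=
  (unitMeasure.prod unitMeasure).map (polarMap ψ)

section CircularMeasure

variable {ψ : ℝ → ℝ} {B : ℝ}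

theorem continuous_polarMap (hψ : Continuous ψ) : Continuous (polarMap ψ) := by
  unfold polarMap circleMap
  fun_prop

theorem norm_polarMap (y : ℝ × ℝ) : ‖polarMap ψ y‖ = Real.exp (ψ y.1) := by
  rw [polarMap, norm_circleMap_zero, abs_of_pos (Real.exp_pos _)]

theorem log_norm_polarMap (y : ℝ × ℝ) : Real.log ‖polarMap ψ y‖ = ψ y.1 := by
  rw [norm_polarMap, Real.log_exp]

theorem isProbabilityMeasure_circularMeasure (hψ : Continuous ψ) :
    IsProbabilityMeasure (circularMeasure ψ) :=
  Measure.isProbabilityMeasure_map (continuous_polarMap hψ).aemeasurable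

theorem map_log_norm_circularMeasure (hψ : Continuous ψ) :
    (circularMeasure ψ).map (fun z => Real.log ‖z‖) = unitMeasure.map ψ := by
  rw [circularMeasure, Measure.map_map measurable_norm.log (continuous_polarMap hψ).measurable]
  have : (fun z : ℂ => Real.log ‖z‖) ∘ polarMap ψ = ψ ∘ Prod.fst := by
    funext y; exact log_norm_polarMap y
  rw [this, ← Measure.map_map hψ.measurable measurable_fst, Measure.map_fst_prod]
  simp

theorem circularMeasure_singleton (hψ : Continuous ψ) (hinj : Set.InjOn ψ (Set.Icc 0 1)) (z : ℂ) :
    circularMeasure ψ {z} = 0 := by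
  rw [circularMeasure, Measure.map_apply (continuous_polarMap hψ).measurable
    (measurableSet_singleton z)]
  have hsub : {s : ℝ | ψ s = Real.log ‖z‖ ∧ s ∈ Set.Icc (0 : ℝ) 1}.Subsingleton :=
    fun s hs t ht => hinj hs.2 ht.2 (hs.1.trans ht.1.symm)
  have h0 : ∀ᵐ s ∂unitMeasure, ψ s ≠ Real.log ‖z‖ := by
    have h1 : unitMeasure {s : ℝ | ψ s = Real.log ‖z‖ ∧ s ∈ Set.Icc (0 : ℝ) 1} = 0 :=
      le_antisymm ((Measure.restrict_apply_le _ _).trans (hsub.measure_zero volume).le) zero_le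
    filter_upwards [measure_eq_zero_iff_ae_notMem.1 h1, ae_unitMeasure] with s hs hs' h
    exact hs ⟨h, hs'⟩
  have h2 : ∀ᵐ y ∂(unitMeasure.prod unitMeasure), ψ y.1 ≠ Real.log ‖z‖ :=
    Measure.quasiMeasurePreserving_fst.ae h0
  refine measure_mono_null (fun y hy => ?_) (ae_iff.1 h2)
  simp only [Set.mem_preimage, Set.mem_singleton_iff] at hy
  simp [← hy, log_norm_polarMap]

theorem integrable_log_norm_circle_sub {R : ℝ} (w : ℂ) :
    Integrable (fun θ => Real.log ‖circleMap 0 R (2 * Real.pi * θ) - w‖) unitMeasure := by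
  have h := circleIntegrable_log_norm_sub_const (a := w) (c := 0) R
  rw [CircleIntegrable] at h
  have h2 := h.comp_mul_left (c := 2 * Real.pi)
  rw [zero_div, div_self (by positivity)] at h2
  exact (intervalIntegrable_iff_integrableOn_Ioc_of_le zero_le_one).1 h2

/-- Jensen's formula for a linear factor. -/
theorem integral_log_norm_circle_sub {a : ℝ} {w : ℂ} (hw : w ≠ 0) :
    ∫ θ, Real.log ‖circleMap 0 (Real.exp a) (2 * Real.pi * θ) - w‖ ∂unitMeasure =
      max a (Real.log ‖w‖) := by
  have h := circleAverage_log_norm_sub_const_eq_log_radius_add_posLog (a := w) (c := 0)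
    (Real.exp_pos a).ne'
  rw [Real.circleAverage_def] at h
  rw [integral_unitMeasure, intervalIntegral.integral_comp_mul_left
    (fun θ => Real.log ‖circleMap 0 (Real.exp a) θ - w‖) (by positivity), mul_zero, mul_one, h,
    Real.log_exp, zero_sub, norm_neg, Real.posLog,
    Real.log_mul (inv_pos.2 (Real.exp_pos a)).ne' (norm_ne_zero_iff.2 hw), Real.log_inv,
    Real.log_exp, ← max_add_add_left]
  simp

theorem log_le_of_le_two_mul_exp (hB0 : 0 ≤ B) {x : ℝ} (hx0 : 0 ≤ x) (hx : x ≤ 2 * Real.exp B) :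
    Real.log x ≤ Real.log 2 + B := by
  rcases hx0.eq_or_lt with h | h
  · rw [← h, Real.log_zero]
    have := Real.log_nonneg one_le_two
    linarith
  · have := Real.log_le_log h hx
    rwa [Real.log_mul two_ne_zero (Real.exp_pos B).ne', Real.log_exp] at this

theorem integrable_log_norm_sub_circularMeasure (hψ : Continuous ψ) (hB : ∀ s, |ψ s| ≤ B) {w : ℂ}
    (hw : w ≠ 0) (hwB : ‖w‖ ≤ Real.exp B) :
    Integrable (fun z => Real.log ‖z - w‖) (circularMeasure ψ) ∧
      ∫ z, Real.log ‖z - w‖ ∂(circularMeasure ψ) =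
        ∫ s, max (ψ s) (Real.log ‖w‖) ∂unitMeasure := by
  have hB0 : 0 ≤ B := (abs_nonneg _).trans (hB 0)
  have hl2 := Real.log_nonneg one_le_two
  have hm : Measurable fun z : ℂ => Real.log ‖z - w‖ := (measurable_id.sub_const w).norm.log
  have hp := (continuous_polarMap hψ).measurable
  have hint : ∀ s, ∫ θ, Real.log ‖polarMap ψ (s, θ) - w‖ ∂unitMeasure =
      max (ψ s) (Real.log ‖w‖) := fun s => by
    simp only [polarMap]
    exact integral_log_norm_circle_sub hw
  have hinti : ∀ s, Integrable (fun θ => Real.log ‖polarMap ψ (s, θ) - w‖) unitMeasure := fun s => by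
    simp only [polarMap]
    exact integrable_log_norm_circle_sub w
  have hI : Integrable (fun y => Real.log ‖polarMap ψ y - w‖) (unitMeasure.prod unitMeasure) := by
    refine integrable_prod_of_le (C := Real.log 2 + B) (hm.comp hp)
      (ae_of_all _ fun s => ae_of_all _ fun θ => ?_)
      (ae_of_all _ hinti) (ae_of_all _ fun s => ?_)
      (by positivity)
    · refine log_le_of_le_two_mul_exp hB0 (norm_nonneg _) ((norm_sub_le _ _).trans ?_)
      rw [norm_polarMap]
      have := Real.exp_le_exp.2 (abs_le.1 (hB s)).2
      simp only
      linarith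
    · simp only [hint]
      have := (abs_le.1 (hB s)).1
      have := le_max_left (ψ s) (Real.log ‖w‖)
      linarith
  constructor
  · rw [circularMeasure]
    exact (integrable_map_measure hm.aestronglyMeasurable hp.aemeasurable).2 hI
  · rw [circularMeasure, integral_map hp.aemeasurable hm.aestronglyMeasurable, integral_prod _ hI]
    simp only [hint]

theorem ae_circularMeasure (hψ : Continuous ψ) (hB : ∀ s, |ψ s| ≤ B) :
    ∀ᵐ z ∂(circularMeasure ψ), z ≠ 0 ∧ ‖z‖ ≤ Real.exp B := by
  have hm : MeasurableSet {z : ℂ | z ≠ 0 ∧ ‖z‖ ≤ Real.exp B} :=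
    (measurableSet_singleton (0 : ℂ)).compl.inter (measurableSet_le measurable_norm measurable_const)
  rw [circularMeasure, ae_map_iff (continuous_polarMap hψ).aemeasurable hm]
  refine ae_of_all _ fun y => ⟨?_, ?_⟩
  · rw [← norm_pos_iff, norm_polarMap]; exact Real.exp_pos _
  · rw [norm_polarMap]; exact Real.exp_le_exp.2 (abs_le.1 (hB _)).2

theorem integrable_log_norm_sub_circularMeasure_prod (hψ : Continuous ψ) (hB : ∀ s, |ψ s| ≤ B) :
    Integrable (fun y : ℂ × ℂ => Real.log (1 / ‖y.1 - y.2‖))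
        ((circularMeasure ψ).prod (circularMeasure ψ)) ∧
      ∫ y : ℂ × ℂ, Real.log (1 / ‖y.1 - y.2‖) ∂((circularMeasure ψ).prod (circularMeasure ψ)) =
        -∫ y : ℝ × ℝ, max (ψ y.1) (ψ y.2) ∂(unitMeasure.prod unitMeasure) := by
  have hB0 : 0 ≤ B := (abs_nonneg _).trans (hB 0)
  have hl2 := Real.log_nonneg one_le_two
  have := isProbabilityMeasure_circularMeasure hψ
  have hm : Measurable fun y : ℂ × ℂ => Real.log ‖y.2 - y.1‖ :=
    (measurable_snd.sub measurable_fst).norm.log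
  have hae := ae_circularMeasure hψ hB
  have hψi : Integrable ψ unitMeasure := integrable_unitMeasure hψ
  have hI : Integrable (fun y : ℂ × ℂ => Real.log ‖y.2 - y.1‖)
      ((circularMeasure ψ).prod (circularMeasure ψ)) := by
    refine integrable_prod_of_le (C := Real.log 2 + B) hm ?_ ?_ ?_ (by positivity)
    · filter_upwards [hae] with w hw
      filter_upwards [hae] with z hz
      refine log_le_of_le_two_mul_exp hB0 (norm_nonneg _) ((norm_sub_le _ _).trans ?_)
      linarith [hw.2, hz.2]
    · filter_upwards [hae] with w hw
      exact (integrable_log_norm_sub_circularMeasure hψ hB hw.1 hw.2).1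
    · filter_upwards [hae] with w hw
      rw [(integrable_log_norm_sub_circularMeasure hψ hB hw.1 hw.2).2]
      calc -(Real.log 2 + B) ≤ ∫ _, -(Real.log 2 + B) ∂unitMeasure := by simp
        _ ≤ ∫ s, max (ψ s) (Real.log ‖w‖) ∂unitMeasure := by
            refine integral_mono (integrable_const _) (hψi.sup (integrable_const _)) fun s => ?_
            have := (abs_le.1 (hB s)).1
            have := le_max_left (ψ s) (Real.log ‖w‖)
            simp only
            linarith
  have e : ∀ y : ℂ × ℂ, Real.log (1 / ‖y.1 - y.2‖) = -Real.log ‖y.2 - y.1‖ := fun y => by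
    rw [one_div, Real.log_inv, norm_sub_rev]
  simp only [e]
  refine ⟨hI.neg, ?_⟩
  rw [integral_neg, integral_prod _ hI]
  congr 1
  have h1 : ∫ w, ∫ z, Real.log ‖z - w‖ ∂(circularMeasure ψ) ∂(circularMeasure ψ) =
      ∫ w, ∫ s, max (ψ s) (Real.log ‖w‖) ∂unitMeasure ∂(circularMeasure ψ) := by
    refine integral_congr_ae ?_
    filter_upwards [hae] with w hw
    exact (integrable_log_norm_sub_circularMeasure hψ hB hw.1 hw.2).2
  have hGm : Measurable fun u : ℝ => ∫ s, max (ψ s) u ∂unitMeasure := by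
    have : Measurable fun y : ℝ × ℝ => max (ψ y.2) y.1 :=
      (hψ.measurable.comp measurable_snd).max measurable_fst
    exact this.stronglyMeasurable.integral_prod_right'.measurable
  have hmaxi : Integrable (fun y : ℝ × ℝ => max (ψ y.1) (ψ y.2)) (unitMeasure.prod unitMeasure) :=
    (hψi.comp_fst unitMeasure).sup (hψi.comp_snd unitMeasure)
  simp only
  rw [h1, ← integral_map (φ := fun z : ℂ => Real.log ‖z‖)
    (f := fun u => ∫ s, max (ψ s) u ∂unitMeasure) measurable_norm.log.aemeasurable
    hGm.aestronglyMeasurable, map_log_norm_circularMeasure hψ,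
    integral_map hψ.measurable.aemeasurable hGm.aestronglyMeasurable, integral_prod _ hmaxi]
  simp only [max_comm]

/-- The inner integral is `s ψ s + ∫_s^1 ψ`. It differs from `2 s ψ s` by the derivative of `s ∫_s^1
ψ`, which vanishes at both ends of the unit interval. -/
theorem integral_max_of_monotoneOn (hψ : Continuous ψ) (hmono : MonotoneOn ψ (Set.Icc 0 1)) :
    ∫ y : ℝ × ℝ, max (ψ y.1) (ψ y.2) ∂(unitMeasure.prod unitMeasure) =
      ∫ s in (0 : ℝ)..1, 2 * s * ψ s := by
  have hψi : Integrable ψ unitMeasure := integrable_unitMeasure hψ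
  have hmaxi : Integrable (fun y : ℝ × ℝ => max (ψ y.1) (ψ y.2)) (unitMeasure.prod unitMeasure) :=
    (hψi.comp_fst unitMeasure).sup (hψi.comp_snd unitMeasure)
  have hinner : ∀ s ∈ Set.Icc (0 : ℝ) 1, ∫ t, max (ψ s) (ψ t) ∂unitMeasure =
      s * ψ s + ∫ t in s..1, ψ t := by
    intro s hs
    have hc : Continuous fun t => max (ψ s) (ψ t) := continuous_const.max hψ
    rw [integral_unitMeasure, ← intervalIntegral.integral_add_adjacent_intervals
      (hc.intervalIntegrable 0 s) (hc.intervalIntegrable s 1)]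
    congr 1
    · rw [intervalIntegral.integral_congr (g := fun _ => ψ s) fun t ht => ?_]
      · simp
      · rw [Set.uIcc_of_le hs.1] at ht
        exact max_eq_left (hmono ⟨ht.1, ht.2.trans hs.2⟩ hs ht.2)
    · refine intervalIntegral.integral_congr fun t ht => ?_
      rw [Set.uIcc_of_le hs.2] at ht
      exact max_eq_right (hmono hs ⟨hs.1.trans ht.1, ht.2⟩ ht.1)
  have hd : ∀ s, HasDerivAt (fun s => s * ∫ t in s..1, ψ t) ((∫ t in s..1, ψ t) - s * ψ s) s := by
    intro s
    have h1 : HasDerivAt (fun s => ∫ t in s..1, ψ t) (-ψ s) s :=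
      intervalIntegral.integral_hasDerivAt_left (hψ.intervalIntegrable _ _)
        (hψ.stronglyMeasurableAtFilter _ _) hψ.continuousAt
    refine ((hasDerivAt_id s).mul h1).congr_deriv ?_
    simp only [id]; ring
  have hcP : Continuous fun s => ∫ t in s..1, ψ t := by
    refine continuous_iff_continuousAt.2 fun s => ?_
    exact (intervalIntegral.integral_hasDerivAt_left (hψ.intervalIntegrable _ _)
        (hψ.stronglyMeasurableAtFilter _ _) hψ.continuousAt).continuousAt
  have hcd : Continuous fun s => (∫ t in s..1, ψ t) - s * ψ s := hcP.sub (continuous_id.mul hψ)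
  have hftc := intervalIntegral.integral_eq_sub_of_hasDerivAt (fun s _ => hd s)
    (hcd.intervalIntegrable 0 1)
  rw [integral_prod _ hmaxi]
  have h2 : ∫ s, ∫ t, max (ψ s) (ψ t) ∂unitMeasure ∂unitMeasure =
      ∫ s, (2 * s * ψ s + ((∫ t in s..1, ψ t) - s * ψ s)) ∂unitMeasure := by
    refine integral_congr_ae ?_
    filter_upwards [ae_unitMeasure] with s hs
    rw [hinner s hs]; ring
  simp only
  rw [h2, integral_unitMeasure, intervalIntegral.integral_add
    ((by fun_prop : Continuous fun s => 2 * s * ψ s).intervalIntegrable _ _)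
    (hcd.intervalIntegrable 0 1), hftc]
  simp

end CircularMeasure

/-! ### The equilibrium measure of a radially symmetric potential -/

theorem _root_.StieltjesFunction.eq_of_ae_eq {F G : StieltjesFunction ℝ}
    (h : ∀ᵐ t, F t = G t) : F = G := by
  refine StieltjesFunction.ext fun t => ?_
  have hF := (F.right_continuous t).mono_left (nhdsWithin_mono t Set.Ioi_subset_Ici_self)
  have hG := (G.right_continuous t).mono_left (nhdsWithin_mono t Set.Ioi_subset_Ici_self)
  refine tendsto_nhds_unique_of_frequently_eq hF hG fun hne => ?_
  obtain ⟨u, hu, hsub⟩ := mem_nhdsGT_iff_exists_Ioo_subset.1 hne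
  have h0 : volume (Set.Ioo t u) = 0 := measure_mono_null hsub (ae_iff.1 h)
  rw [Real.volume_Ioo, ENNReal.ofReal_eq_zero] at h0
  exact absurd (Set.mem_Ioi.1 hu) (not_lt.2 (by linarith))

section

variable {Q : ℂ → ℝ} {p : ℝ → ℝ} {u₀ u₁ δ m : ℝ} {ψ : ℝ → ℝ}

theorem IsSaddle.exists_bound (hψ : IsSaddle p u₀ u₁ δ ψ) : ∃ B, ∀ s, |ψ s| ≤ B :=
  ⟨max |u₀ - δ| |u₁ + δ|, fun s =>
    abs_le_max_abs_abs (hψ.mem_enlarged s).1 (hψ.mem_enlarged s).2⟩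

theorem ae_eq_comp_log_norm (hQ : ∀ z ≠ 0, Q z = p (Real.log ‖z‖)) {ν : Measure ℂ}
    (h0 : ν {0} = 0) : Q =ᵐ[ν] fun z => p (Real.log ‖z‖) := by
  filter_upwards [measure_eq_zero_iff_ae_notMem.1 h0] with z hz
  exact hQ z hz

theorem IsSaddle.hasFiniteEnergy (hψ : IsSaddle p u₀ u₁ δ ψ) (h : IsConvexProfile p u₀ u₁ δ m)
    (hQ : ∀ z ≠ 0, Q z = p (Real.log ‖z‖)) : HasFiniteEnergy Q (circularMeasure ψ) := by
  obtain ⟨B, hB⟩ := hψ.exists_bound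
  have hat := circularMeasure_singleton hψ.continuous (hψ.strictMonoOn h).injOn
  refine ⟨hat, (integrable_log_norm_sub_circularMeasure_prod hψ.continuous hB).1, ?_⟩
  have hp : Continuous p := by simpa using h.continuous 0
  refine Integrable.congr ?_ (ae_eq_comp_log_norm hQ (hat 0)).symm
  have hi : Integrable p (unitMeasure.map ψ) :=
    (integrable_map_measure hp.aestronglyMeasurable hψ.continuous.aemeasurable).2
      (integrable_unitMeasure (hp.comp hψ.continuous))
  rw [← map_log_norm_circularMeasure hψ.continuous] at hi
  exact (integrable_map_measure hp.aestronglyMeasurable measurable_norm.log.aemeasurable).1 hi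

theorem IsSaddle.weightedEnergy_eq (hψ : IsSaddle p u₀ u₁ δ ψ) (h : IsConvexProfile p u₀ u₁ δ m)
    (hQ : ∀ z ≠ 0, Q z = p (Real.log ‖z‖)) :
    weightedEnergy Q (circularMeasure ψ) = (∫ s, p (ψ s) ∂unitMeasure) -
      ∫ y : ℝ × ℝ, max (ψ y.1) (ψ y.2) ∂(unitMeasure.prod unitMeasure) := by
  obtain ⟨B, hB⟩ := hψ.exists_bound
  have hat := circularMeasure_singleton hψ.continuous (hψ.strictMonoOn h).injOn
  have hp : Continuous p := by simpa using h.continuous 0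
  rw [weightedEnergy, (integrable_log_norm_sub_circularMeasure_prod hψ.continuous hB).2,
    integral_congr_ae (ae_eq_comp_log_norm hQ (hat 0)),
    ← integral_map (φ := fun z : ℂ => Real.log ‖z‖) measurable_norm.log.aemeasurable
      hp.aestronglyMeasurable, map_log_norm_circularMeasure hψ.continuous,
    integral_map hψ.continuous.aemeasurable hp.aestronglyMeasurable]
  ring

theorem IsSaddle.weightedEnergy_eq_neg_integral_legendre (hψ : IsSaddle p u₀ u₁ δ ψ)
    (h : IsConvexProfile p u₀ u₁ δ m) (hQ : ∀ z ≠ 0, Q z = p (Real.log ‖z‖)) :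
    weightedEnergy Q (circularMeasure ψ) = -∫ s in (0 : ℝ)..1, legendre p ψ s := by
  have hp : Continuous p := by simpa using h.continuous 0
  have hc := hψ.continuous
  rw [hψ.weightedEnergy_eq h hQ, integral_max_of_monotoneOn hc (hψ.strictMonoOn h).monotoneOn,
    integral_unitMeasure]
  simp only [legendre]
  rw [intervalIntegral.integral_sub
    ((by fun_prop : Continuous fun s => 2 * s * ψ s).intervalIntegrable _ _)
    ((by fun_prop : Continuous fun s => p (ψ s)).intervalIntegrable _ _)]
  ring

theorem IsSaddle.cdf_bounds (hψ : IsSaddle p u₀ u₁ δ ψ) (h : IsConvexProfile p u₀ u₁ δ m)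
    {F : ℝ → ℝ} (hF0 : ∀ t, 0 ≤ F t) (hF1 : ∀ t, F t ≤ 1) (t : ℝ) :
    (F t - unitMeasure.real {s | ψ s ≤ t}) ^ 2 ≤ energyDensity p u₀ F t -
      energyDensity p u₀ (fun t => unitMeasure.real {s | ψ s ≤ t}) t :=
  h.energyDensity_sub_ge (G := fun t => unitMeasure.real {s | ψ s ≤ t}) (hF0 t) (hF1 t)
    hψ.cdf_of_lt (fun h0 h1 => hψ.cdf_of_mem h ⟨h0, h1⟩) hψ.cdf_of_gt

/-- The energy of a measure exceeds the energy of the circular measure by at least the squared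
`L²` distance of the distribution functions of the radial parts. -/
theorem IsSaddle.weightedEnergy_sub_ge (hψ : IsSaddle p u₀ u₁ δ ψ)
    (h : IsConvexProfile p u₀ u₁ δ m) (hQ : ∀ z ≠ 0, Q z = p (Real.log ‖z‖)) {ν : Measure ℂ}
    [IsProbabilityMeasure ν] (hν : HasFiniteEnergy Q ν) :
    ∃ D : ℝ → ℝ, Integrable D ∧
      (∀ t, (ν.real {z | Real.log ‖z‖ ≤ t} - unitMeasure.real {s | ψ s ≤ t}) ^ 2 ≤ D t) ∧
      ∫ t, D t ≤ weightedEnergy Q ν - weightedEnergy Q (circularMeasure ψ) := by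
  have hp : Continuous p := by simpa using h.continuous 0
  have hm : Measurable fun z : ℂ => Real.log ‖z‖ := measurable_norm.log
  have hae := ae_eq_comp_log_norm hQ (hν.noAtoms 0)
  have hpi : Integrable (fun z => p (Real.log ‖z‖)) ν := hν.integrable_potential.congr hae
  have hpi' : Integrable (fun s => p (ψ s)) unitMeasure :=
    integrable_unitMeasure (hp.comp hψ.continuous)
  obtain ⟨i1, v1⟩ := h.integral_energyDensity hm hpi
  obtain ⟨i2, v2⟩ := h.integral_energyDensity hψ.continuous.measurable hpi'
  refine ⟨_, i1.sub i2, fun t => ?_, ?_⟩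
  · exact hψ.cdf_bounds h (F := fun t => ν.real {z | Real.log ‖z‖ ≤ t})
      (fun t => measureReal_nonneg) (fun t => measureReal_le_one) t
  · have hmax := integral_log_max_norm_ge hν.noAtoms hν.integrable_log
      (h.integrable_of_comp hm hpi)
    have e := integral_congr_ae hae
    simp only [Pi.sub_apply]
    rw [integral_sub i1 i2, v1, v2, hψ.weightedEnergy_eq h hQ, weightedEnergy, e]
    linarith

theorem IsSaddle.isEquilibriumMeasure (hψ : IsSaddle p u₀ u₁ δ ψ)
    (h : IsConvexProfile p u₀ u₁ δ m) (hQ : ∀ z ≠ 0, Q z = p (Real.log ‖z‖)) :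
    IsEquilibriumMeasure Q (circularMeasure ψ) := by
  refine ⟨isProbabilityMeasure_circularMeasure hψ.continuous, hψ.hasFiniteEnergy h hQ,
    fun ν hν hfin => ?_⟩
  obtain ⟨D, _, h2, h3⟩ := hψ.weightedEnergy_sub_ge h hQ hfin
  have : 0 ≤ ∫ t, D t := integral_nonneg fun t => (sq_nonneg _).trans (h2 t)
  linarith

/-- Equal energies force the squared distance of the distribution functions to vanish almost
everywhere, hence everywhere by right continuity. Only the law of `log |z|` is identified; this
suffices for integrals of radial functions, whichever minimizer `equilibriumMeasure` selects. -/
theorem IsSaddle.map_log_norm_eq (hψ : IsSaddle p u₀ u₁ δ ψ) (h : IsConvexProfile p u₀ u₁ δ m)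
    (hQ : ∀ z ≠ 0, Q z = p (Real.log ‖z‖)) {μ : Measure ℂ} (hμ : IsEquilibriumMeasure Q μ) :
    μ.map (fun z => Real.log ‖z‖) = unitMeasure.map ψ := by
  have := hμ.isProbabilityMeasure
  have hm : Measurable fun z : ℂ => Real.log ‖z‖ := measurable_norm.log
  obtain ⟨D, hD, h2, h3⟩ := hψ.weightedEnergy_sub_ge h hQ hμ.hasFiniteEnergy
  have hle := hμ.energy_le _ (isProbabilityMeasure_circularMeasure hψ.continuous)
    (hψ.hasFiniteEnergy h hQ)
  have hD0 : 0 ≤ D := fun t => (sq_nonneg _).trans (h2 t)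
  have hint : ∫ t, D t = 0 := le_antisymm (by linarith) (integral_nonneg hD0)
  have hDae := (integral_eq_zero_iff_of_nonneg hD0 hD).1 hint
  have := Measure.isProbabilityMeasure_map (μ := μ) hm.aemeasurable
  have := Measure.isProbabilityMeasure_map (μ := unitMeasure) hψ.continuous.aemeasurable
  refine Measure.eq_of_cdf _ _ (StieltjesFunction.eq_of_ae_eq ?_)
  filter_upwards [hDae] with t ht
  have h4 := h2 t
  rw [ht, Pi.zero_apply] at h4
  have h5 := sub_eq_zero.1 (pow_eq_zero_iff two_ne_zero |>.1 (le_antisymm h4 (sq_nonneg _)))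
  rw [ProbabilityTheory.cdf_eq_real, ProbabilityTheory.cdf_eq_real,
    map_measureReal_apply hm measurableSet_Iic,
    map_measureReal_apply hψ.continuous.measurable measurableSet_Iic]
  exact h5

theorem IsSaddle.isEquilibriumMeasure_equilibriumMeasure (hψ : IsSaddle p u₀ u₁ δ ψ)
    (h : IsConvexProfile p u₀ u₁ δ m) (hQ : ∀ z ≠ 0, Q z = p (Real.log ‖z‖)) :
    IsEquilibriumMeasure Q (equilibriumMeasure Q) :=
  Classical.epsilon_spec ⟨_, hψ.isEquilibriumMeasure h hQ⟩

theorem IsSaddle.weightedEnergy_equilibriumMeasure (hψ : IsSaddle p u₀ u₁ δ ψ)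
    (h : IsConvexProfile p u₀ u₁ δ m) (hQ : ∀ z ≠ 0, Q z = p (Real.log ‖z‖)) :
    weightedEnergy Q (equilibriumMeasure Q) = -∫ s in (0 : ℝ)..1, legendre p ψ s := by
  have hμ := hψ.isEquilibriumMeasure_equilibriumMeasure h hQ
  have hσ := hψ.isEquilibriumMeasure h hQ
  rw [← hψ.weightedEnergy_eq_neg_integral_legendre h hQ]
  exact le_antisymm (hμ.energy_le _ hσ.isProbabilityMeasure hσ.hasFiniteEnergy)
    (hσ.energy_le _ hμ.isProbabilityMeasure hμ.hasFiniteEnergy)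

theorem IsSaddle.integral_comp_log_norm_equilibriumMeasure (hψ : IsSaddle p u₀ u₁ δ ψ)
    (h : IsConvexProfile p u₀ u₁ δ m) (hQ : ∀ z ≠ 0, Q z = p (Real.log ‖z‖)) {g : ℝ → ℝ}
    (hg : Measurable g) {f : ℂ → ℝ} (hf : ∀ z ≠ 0, f z = g (Real.log ‖z‖)) :
    ∫ z, f z ∂(equilibriumMeasure Q) = ∫ s in (0 : ℝ)..1, g (ψ s) := by
  have hμ := hψ.isEquilibriumMeasure_equilibriumMeasure h hQ
  rw [integral_congr_ae (ae_eq_comp_log_norm hf (hμ.hasFiniteEnergy.noAtoms 0)),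
    ← integral_map (φ := fun z : ℂ => Real.log ‖z‖) measurable_norm.log.aemeasurable
      hg.aestronglyMeasurable, hψ.map_log_norm_eq h hQ hμ,
    integral_map hψ.continuous.aemeasurable hg.aestronglyMeasurable, integral_unitMeasure]

theorem IsSaddle.logPotential_equilibriumMeasure_zero (hψ : IsSaddle p u₀ u₁ δ ψ)
    (h : IsConvexProfile p u₀ u₁ δ m) (hQ : ∀ z ≠ 0, Q z = p (Real.log ‖z‖)) :
    logPotential (equilibriumMeasure Q) 0 = -∫ s in (0 : ℝ)..1, ψ s := by
  rw [logPotential, hψ.integral_comp_log_norm_equilibriumMeasure h hQ measurable_neg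
    (fun z _ => by simp [one_div, Real.log_inv])]
  simp

end

theorem IsAnnularPotential.entropy_equilibriumMeasure {Q : ℂ → ℝ} {q : ℝ → ℝ} {r₀ r₁ δ m : ℝ}
    {ψ : ℝ → ℝ} (hQ : IsAnnularPotential Q q r₀ r₁)
    (h : IsConvexProfile (logProfile q) (Real.log r₀) (Real.log r₁) δ m)
    (hψ : IsSaddle (logProfile q) (Real.log r₀) (Real.log r₁) δ ψ) :
    entropy Q (equilibriumMeasure Q) =
      ∫ s in (0 : ℝ)..1, Real.log (radialLaplacian Q (Real.exp (ψ s))) := by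
  have hlap : ∀ z ≠ 0, quarterLaplacian Q z =
      iteratedDeriv 2 (logProfile q) (Real.log ‖z‖) / (4 * Real.exp (Real.log ‖z‖) ^ 2) :=
    fun z hz => by rw [hQ.quarterLaplacian_eq hz, Real.exp_log (norm_pos_iff.2 hz)]
  have hm : Measurable fun u =>
      Real.log (iteratedDeriv 2 (logProfile q) u / (4 * Real.exp u ^ 2)) :=
    ((h.continuous 2).measurable.div
      ((Real.measurable_exp.pow_const 2).const_mul 4)).log
  rw [entropy, hψ.integral_comp_log_norm_equilibriumMeasure h (fun z hz => hQ.eq_logProfile hz) hm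
    (fun z hz => by rw [hlap z hz])]
  refine intervalIntegral.integral_congr fun s _ => ?_
  have hz : ((Real.exp (ψ s) : ℝ) : ℂ) ≠ 0 := by
    exact_mod_cast (Real.exp_pos (ψ s)).ne'
  simp only [radialLaplacian]
  rw [hlap _ hz, Complex.norm_real, Real.norm_of_nonneg (Real.exp_pos _).le, Real.log_exp]


/-! ### Asymptotic expansion of the partition functions -/

/-- The increments of `log (stirlingSeq n)` are controlled by the telescoping `1 / (12 n (n + 1))`,
so subtracting `1 / (12 n)` gives an increasing sequence, which lies below its limit. -/
theorem log_stirlingSeq_le {n : ℕ} (hn : 1 ≤ n) :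
    Real.log (Stirling.stirlingSeq n) ≤ Real.log √Real.pi + 1 / (12 * n) := by
  have hmono : Monotone fun k : ℕ =>
      Real.log (Stirling.stirlingSeq (k + 1)) - 1 / (12 * ((k : ℝ) + 1)) := by
    refine monotone_nat_of_le_succ fun k => ?_
    have h := Stirling.log_stirlingSeq_sdiff_le (k + 1)
    have e : 1 / (12 * ((k + 1 : ℕ) : ℝ) * (((k + 1 : ℕ) : ℝ) + 1)) =
        1 / (12 * ((k : ℝ) + 1)) - 1 / (12 * (((k + 1 : ℕ) : ℝ) + 1)) := by
      push_cast
      field_simp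
      ring
    rw [e] at h
    linarith
  have hlim : Tendsto (fun k : ℕ =>
      Real.log (Stirling.stirlingSeq (k + 1)) - 1 / (12 * ((k : ℝ) + 1))) atTop
      (𝓝 (Real.log √Real.pi)) := by
    have h1 : Tendsto (fun k : ℕ => Real.log (Stirling.stirlingSeq (k + 1))) atTop
        (𝓝 (Real.log √Real.pi)) :=
      (Stirling.tendsto_stirlingSeq_sqrt_pi.comp (tendsto_add_atTop_nat 1)).log
        (Real.sqrt_pos.2 Real.pi_pos).ne'
    have h2 := (tendsto_one_div_add_atTop_nhds_zero_nat (𝕜 := ℝ)).const_mul (1 / 12)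
    have h3 := h1.sub h2
    rw [mul_zero, sub_zero] at h3
    refine h3.congr fun k => ?_
    rw [one_div_mul_one_div]
  obtain ⟨k, rfl⟩ := Nat.exists_eq_add_of_le' hn
  have := hmono.ge_of_tendsto hlim k
  push_cast
  linarith

theorem log_factorial_isBigO :
    (fun N : ℕ => Real.log (N.factorial : ℝ) - ((N : ℝ) * Real.log N - N + Real.log N / 2
      + Real.log (2 * Real.pi) / 2)) =O[atTop] fun N : ℕ => (N : ℝ)⁻¹ := by
  refine IsBigO.of_bound 1 (eventually_atTop.2 ⟨1, fun N hN => ?_⟩)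
  have hN' : (0 : ℝ) < N := by exact_mod_cast hN
  have h1 := Stirling.le_log_factorial_stirling (Nat.one_le_iff_ne_zero.1 hN)
  have h2 := log_stirlingSeq_le hN
  rw [Stirling.log_stirlingSeq_formula, Real.log_mul two_ne_zero hN'.ne',
    Real.log_div hN'.ne' (Real.exp_pos 1).ne', Real.log_exp, Real.log_sqrt Real.pi_pos.le] at h2
  rw [Real.log_mul two_ne_zero Real.pi_ne_zero] at h1 ⊢
  have e : 1 / (12 * (N : ℝ)) ≤ 1 * (N : ℝ)⁻¹ := by
    rw [one_mul, one_div, mul_inv]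
    have := inv_pos.2 hN'
    nlinarith
  rw [Real.norm_of_nonneg (by linarith), Real.norm_of_nonneg (by positivity)]
  linarith

namespace IsAnnularPotential

variable {Q : ℂ → ℝ} {q : ℝ → ℝ} {r₀ r₁ δ m : ℝ} {ψ : ℝ → ℝ}

theorem radialMoment_node_pos
    (h : IsConvexProfile (logProfile q) (Real.log r₀) (Real.log r₁) δ m)
    (hψ : IsSaddle (logProfile q) (Real.log r₀) (Real.log r₁) δ ψ) {N k : ℕ} (hk : k < N) {M : ℝ}
    (hM : 1 ≤ M) : 0 < radialMoment (logProfile q) M (((k : ℝ) + 1) / N) := by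
  have hN : (0 : ℝ) < N := by exact_mod_cast (Nat.zero_le k).trans_lt hk
  have hs : ((k : ℝ) + 1) / N ∈ Set.Icc (0 : ℝ) 1 := by
    refine ⟨by positivity, (div_le_one hN).2 ?_⟩
    exact_mod_cast hk
  exact h.radialMoment_pos (hψ.mem _ hs) (hψ.deriv_eq _ hs) hM

theorem log_partitionNormal (hQ : IsAnnularPotential Q q r₀ r₁)
    (h : IsConvexProfile (logProfile q) (Real.log r₀) (Real.log r₁) δ m)
    (hψ : IsSaddle (logProfile q) (Real.log r₀) (Real.log r₁) δ ψ) {N : ℕ} (hN : 0 < N) :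
    Real.log (partitionNormal Q N) = Real.log (N.factorial : ℝ) +
      ∑ k ∈ Finset.range N, Real.log (radialMoment (logProfile q) N (((k : ℝ) + 1) / N)) := by
  have hpos : ∀ k : Fin N, 0 < radialMoment (logProfile q) N (((k : ℝ) + 1) / N) := fun k =>
    radialMoment_node_pos h hψ k.2 (by exact_mod_cast hN)
  rw [partitionNormal_eq hQ h hψ hN, Real.log_mul (by positivity)
    (Finset.prod_pos fun k _ => hpos k).ne', Real.log_prod fun k _ => (hpos k).ne',
    Fin.sum_univ_eq_sum_range
      (fun k => Real.log (radialMoment (logProfile q) N (((k : ℝ) + 1) / N)))]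

theorem log_partitionSymplectic (hQ : IsAnnularPotential Q q r₀ r₁)
    (h : IsConvexProfile (logProfile q) (Real.log r₀) (Real.log r₁) δ m)
    (hψ : IsSaddle (logProfile q) (Real.log r₀) (Real.log r₁) δ ψ) {N : ℕ} (hN : 0 < N) :
    Real.log (partitionSymplectic Q N) = Real.log (N.factorial : ℝ) + (N * Real.log 2 +
      ∑ k ∈ Finset.range N,
        Real.log (radialMoment (logProfile q) (2 * N) (((k : ℝ) + 1) / N))) := by
  have hN' : (1 : ℝ) ≤ N := by exact_mod_cast hN
  have hpos : ∀ k : Fin N, 0 < radialMoment (logProfile q) (2 * N) (((k : ℝ) + 1) / N) := fun k =>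
    radialMoment_node_pos h hψ k.2 (by linarith)
  have hpos' : ∀ k : Fin N, 0 < 2 * radialMoment (logProfile q) (2 * N) (((k : ℝ) + 1) / N) :=
    fun k => mul_pos two_pos (hpos k)
  rw [partitionSymplectic_eq hQ h hψ hN, Real.log_mul (by positivity)
    (Finset.prod_pos fun k _ => hpos' k).ne', Real.log_prod fun k _ => (hpos' k).ne']
  simp only [fun k => Real.log_mul two_ne_zero (hpos k).ne', Finset.sum_add_distrib,
    Finset.sum_const, Finset.card_univ, Fintype.card_fin, nsmul_eq_mul]
  rw [Fin.sum_univ_eq_sum_range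
      (fun k => Real.log (radialMoment (logProfile q) (2 * N) (((k : ℝ) + 1) / N)))]

end IsAnnularPotential

end CoulombGas

/-! ### The theorem: assembling the expansions -/

open CoulombGas in
theorem theorem1p1 (Q : ℂ → ℝ) (q : ℝ → ℝ) (r₀ r₁ : ℝ)
    (hQ : CoulombGas.IsAnnularPotential Q q r₀ r₁) :
    (fun N : ℕ =>
        Real.log (CoulombGas.partitionNormal Q N) -
          (-(N : ℝ) ^ 2 * CoulombGas.weightedEnergy Q (CoulombGas.equilibriumMeasure Q)
            + (1 / 2) * (N : ℝ) * Real.log (N : ℝ)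
            + (Real.log (2 * Real.pi) / 2 - 1
                - (1 / 2) * CoulombGas.entropy Q (CoulombGas.equilibriumMeasure Q)) * (N : ℝ)
            + (1 / 2) * Real.log (N : ℝ)
            + Real.log (2 * Real.pi) / 2
            + CoulombGas.annulusFunctional Q r₀ r₁))
      =O[atTop] (fun N : ℕ => ((N : ℝ))⁻¹) ∧
    (fun N : ℕ =>
        Real.log (CoulombGas.partitionSymplectic Q N) -
          (-2 * (N : ℝ) ^ 2 * CoulombGas.weightedEnergy Q (CoulombGas.equilibriumMeasure Q)
            + (1 / 2) * (N : ℝ) * Real.log (N : ℝ)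
            + (Real.log (4 * Real.pi) / 2 - 1
                - CoulombGas.logPotential (CoulombGas.equilibriumMeasure Q) 0
                - (1 / 2) * CoulombGas.entropy Q (CoulombGas.equilibriumMeasure Q)) * (N : ℝ)
            + (1 / 2) * Real.log (N : ℝ)
            + Real.log (2 * Real.pi) / 2
            + (1 / 2) * CoulombGas.annulusFunctional Q r₀ r₁
            + (1 / 8) * Real.log
                (CoulombGas.radialLaplacian Q r₀ / CoulombGas.radialLaplacian Q r₁)))
      =O[atTop] (fun N : ℕ => ((N : ℝ))⁻¹) := by

  obtain ⟨δ, m, h⟩ := hQ.exists_isConvexProfile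
  obtain ⟨ψ, hψ⟩ := h.exists_isSaddle
  have hpot : ∀ z ≠ 0, Q z = logProfile q (Real.log ‖z‖) := fun z hz => hQ.eq_logProfile hz
  have hr : r₀ < r₁ := (Real.log_lt_log_iff hQ.inner_radius_pos hQ.outer_radius_pos).1 h.lt
  have hD0 : 0 < radialLaplacian Q r₀ :=
    hQ.radialLaplacian_pos (Set.left_mem_Icc.2 hr.le)
  have hD1 : 0 < radialLaplacian Q r₁ :=
    hQ.radialLaplacian_pos (Set.right_mem_Icc.2 hr.le)
  have hl4 : Real.log 4 = 2 * Real.log 2 := by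
    rw [show (4 : ℝ) = 2 ^ 2 by norm_num, Real.log_pow]; norm_num
  have hl4p : Real.log (4 * Real.pi) = 2 * Real.log 2 + Real.log Real.pi := by
    rw [Real.log_mul four_ne_zero Real.pi_ne_zero, hl4]
  have hl2p : Real.log (2 * Real.pi) = Real.log 2 + Real.log Real.pi :=
    Real.log_mul two_ne_zero Real.pi_ne_zero
  have hdiv : ∀ {c : ℝ}, 1 ≤ c → ∀ {N : ℕ}, 0 < N → Real.log (2 * Real.pi / (c * N)) =
      Real.log 2 + Real.log Real.pi - (Real.log c + Real.log N) := by
    intro c hc N hN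
    have hN' : (N : ℝ) ≠ 0 := by exact_mod_cast hN.ne'
    have hc' : c ≠ 0 := (zero_lt_one.trans_le hc).ne'
    rw [Real.log_div (mul_ne_zero two_ne_zero Real.pi_ne_zero) (mul_ne_zero hc' hN'), hl2p,
      Real.log_mul hc' hN']
  have hdl := hQ.log_iteratedDeriv_two_sub h
  have hlc := hQ.laplace_constant_eq h hψ
  have hil := hQ.integral_log_iteratedDeriv_two h hψ
  rw [hψ.weightedEnergy_equilibriumMeasure h hpot, hψ.logPotential_equilibriumMeasure_zero h hpot,
    hQ.entropy_equilibriumMeasure h hψ]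
  constructor
  · refine ((hψ.sum_log_radialMoment_isBigO h le_rfl).add log_factorial_isBigO).congr' ?_
      EventuallyEq.rfl
    filter_upwards [eventually_gt_atTop 0] with N hN
    -- The terms `N ∫ ψ` cancel against those in `log p''`, and in the constant `log (r₁ / r₀)` has
    -- the coefficient `1/6 - 1/2 + 1/3 = 0`.
    rw [hQ.log_partitionNormal h hψ hN, hdl, hlc, hil, hdiv le_rfl hN, hl2p, hl4]
    simp only [one_mul, Real.log_one]
    ring
  · refine ((hψ.sum_log_radialMoment_isBigO h one_le_two).add log_factorial_isBigO).congr' ?_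
      EventuallyEq.rfl
    filter_upwards [eventually_gt_atTop 0] with N hN
    -- For `c = 2` one `N ∫ ψ` survives as minus `N` times the potential at the origin. In the
    -- constant `log (r₁ / r₀)` has the coefficient `1/3 - 1/2 + 1/6 = 0`, and the logarithm of the
    -- ratio of `ΔQ` at `r₁` and `r₀` has `-1/4 + 1/8 = -1/8`.
    rw [hQ.log_partitionSymplectic h hψ hN, hdl, hlc, hil, hdiv one_le_two hN, hl2p, hl4p, hl4,
      Real.log_div hD0.ne' hD1.ne']
    ring
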